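/- **Conventions.** For $\psi:\mathbb{Z}^2\to\mathbb{R}$ let $(\Delta\psi)(n)=\sum_{|m-n|=1}(\psi(m)-\psi(n))$, and $H=-\Delta+V$, i.e. $(H\psi)(n)=-(\Delta\psi)(n)+V_n\psi(n)$. A square $\Lambda$ of side length $L\in\mathbb{N}$ is a set $\{a_1,\dots,a_1+L-1\}\times\{a_2,\dots,a_2+L-1\}$ with $a\in\mathbb{Z}^2$; its half $\frac12\Lambda$ (same center, half the area) is the set of lattice points of $\prod_{i=1,2}\big[a_i+(\tfrac12-\tfrac{\sqrt2}{4})L,\;a_i+(\tfrac12+\tfrac{\sqrt2}{4})L\big]$. A tilted square is a set $\{(x,y)\in\mathbb{Z}^2: s\le x+y\le s+\ell-1,\ t\le x-y\le t+\ell-1\}$ with $s,t\in\mathbb{Z}$, $\ell\in\mathbb{N}$. A set $F\subset\mathbb{Z}^2$ is $\varepsilon$-sparse in a tilted square $Q$ if $|F\cap Q\cap D|\le\varepsilon|Q\cap D|$ for every diagonal $D=\{x+y=k\}$ and every diagonal $D=\{x-y=k\}$, $k\in\mathbb{Z}$. The set $F$ is $\varepsilon$-regular in $\Lambda$ if $|\bigcup_iQ_i|\le\varepsilon|\Lambda|$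 for all finite families of pairwise disjoint tilted squares $Q_1,\dots,Q_N\subset\Lambda$ such that $F$ is not $\varepsilon$-sparse in any $Q_i$. **Theorem.** Let $M,\gamma,\rho>0$. There is $\varepsilon_0>0$, depending only on $M,\gamma,\rho$, such that for every $\varepsilon\in(0,\varepsilon_0]$ there is $\alpha>1$, depending only on $\varepsilon,M,\gamma,\rho$, with the following property. Let $V=(V_n)_{n\in\mathbb{Z}^2}$ be jointly independent real random variables with $\mathbb{P}[0\le V_n\le M]=1$ for all $n$ and $$\mathbb{P}\big[|V_n-t|>\tfrac{\gamma}{2}\big]\ge\rho\qquad\text{for all }n\in\mathbb{Z}^2,\ t\in[0,M].$$ Let $\overline E\in[0,8+M]$, let $\Lambda\subset\mathbb{Z}^2$ be a square of side length $L\ge\alpha$, and let $F\subset\mathbb{Z}^2$ be $\varepsilon$-regular in $\Lambda$. Let $\mathcal{E}_{\mathrm{uc}}$ be the event that for all $E\in\mathbb{R}$ and all $\psi:\mathbb{Z}^2\to\mathbb{R}$, if $$|E-\overline E|\le e^{-\alpha(L\log L)^{1/2}},\qquad H\psi=E\psi\ \text{ on }\Lambda,$$ $$\big|\{n\in\Lambda\setminus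 F:|\psi(n)|\le1\}\big|\ \ge\ \big(1-\varepsilon(L\log L)^{-1/2}\big)\,|\Lambda\setminus F|,$$ then $|\psi|\le e^{\alpha L\log L}$ on $\frac12\Lambda$. Then for every $v:F\to[0,M]$, $$\mathbb{P}[\mathcal{E}_{\mathrm{uc}}\mid V_F=v]\ \ge\ 1-e^{-\varepsilon L^{1/4}},$$ where the conditional probability is the one obtained by fixing $V_n=v_n$ for $n\in F$ and leaving the joint law of $(V_n)_{n\notin F}$ unchanged. -/

import Mathlib

open MeasureTheory ProbabilityTheory

namespace AndersonZ2

/-! ### The operator -/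

/-- The discrete Laplacian on `ℤ²`: the sum of `ψ m - ψ n` over the four nearest neighbours `m`
of `n`. -/
def laplacian (ψ : ℤ × ℤ → ℝ) (n : ℤ × ℤ) : ℝ :=
  (ψ (n.1 + 1, n.2) - ψ n) + (ψ (n.1 - 1, n.2) - ψ n)
    + (ψ (n.1, n.2 + 1) - ψ n) + (ψ (n.1, n.2 - 1) - ψ n)

/-- The Schrödinger operator `H = -Δ + V` acting on functions on `ℤ²`. -/
def schrodinger (V : ℤ × ℤ → ℝ) (ψ : ℤ × ℤ → ℝ) (n : ℤ × ℤ) : ℝ :=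
  -laplacian ψ n + V n * ψ n

/-! ### Squares, tilted squares, sparsity and regularity -/

/-- The square of side length `L` (with `L` lattice points per side) whose lower left corner
is `a`. -/
def square (a : ℤ × ℤ) (L : ℕ) : Set (ℤ × ℤ) :=
  {n | (a.1 ≤ n.1 ∧ n.1 < a.1 + L) ∧ (a.2 ≤ n.2 ∧ n.2 < a.2 + L)}

/-- The half `½Λ` of the square `Λ = square a L`: the lattice points of the square with the same
center and half the *area*. Here `Λ` is thought of as `[a₁, a₁ + L) × [a₂, a₂ + L)`. -/
def halfSquare (a : ℤ × ℤ) (L : ℕ) : Set (ℤ × ℤ) :=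
  {n | ((n.1 : ℝ) ∈ Set.Icc (a.1 + (1 / 2 - √2 / 4) * L) (a.1 + (1 / 2 + √2 / 4) * L)) ∧
       ((n.2 : ℝ) ∈ Set.Icc (a.2 + (1 / 2 - √2 / 4) * L) (a.2 + (1 / 2 + √2 / 4) * L))}

/-- The tilted square `{(x, y) : x + y ∈ [s, s + ℓ - 1], x - y ∈ [t, t + ℓ - 1]}`
of side length `ℓ`. -/
def tiltedSquare (s t : ℤ) (l : ℕ) : Set (ℤ × ℤ) :=
  {n | (s ≤ n.1 + n.2 ∧ n.1 + n.2 < s + l) ∧ (t ≤ n.1 - n.2 ∧ n.1 - n.2 < t + l)}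

def IsTiltedSquare (Q : Set (ℤ × ℤ)) : Prop :=
  ∃ (s t : ℤ) (l : ℕ), Q = tiltedSquare s t l

/-- `F` is `ε`-sparse in `R`: on every diagonal (in both directions), the set `F` occupies at most
a fraction `ε` of the points of `R`. -/
def IsSparse (ε : ℝ) (F R : Set (ℤ × ℤ)) : Prop :=
  ∀ k : ℤ,
    ((F ∩ R ∩ {n | n.1 + n.2 = k}).ncard : ℝ) ≤ ε * (R ∩ {n | n.1 + n.2 = k}).ncard ∧
    ((F ∩ R ∩ {n | n.1 - n.2 = k}).ncard : ℝ) ≤ ε * (R ∩ {n | n.1 - n.2 = k}).ncard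

/-- `F` is `ε`-regular in `S`: finitely many pairwise disjoint tilted squares contained in `S`, in
each of which `F` fails to be `ε`-sparse, together cover at most a fraction `ε` of `S`. -/
def IsEpsRegular (ε : ℝ) (F S : Set (ℤ × ℤ)) : Prop :=
  ∀ (N : ℕ) (Q : Fin N → Set (ℤ × ℤ)),
    (∀ i, IsTiltedSquare (Q i) ∧ Q i ⊆ S ∧ ¬ IsSparse ε F (Q i)) →
    Pairwise (fun i j => Disjoint (Q i) (Q j)) →
    ((⋃ i, Q i).ncard : ℝ) ≤ ε * S.ncard

theorem square_finite (a : ℤ × ℤ) (L : ℕ) : (square a L).Finite := by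
  refine ((Set.finite_Icc a.1 (a.1 + L)).prod (Set.finite_Icc a.2 (a.2 + L))).subset ?_
  rintro n ⟨⟨h1, h2⟩, h3, h4⟩
  exact ⟨⟨h1, h2.le⟩, h3, h4.le⟩

theorem tiltedSquare_finite (s t : ℤ) (l : ℕ) : (tiltedSquare s t l).Finite := by
  refine ((Set.finite_Icc (-(|s| + |t| + 2 * l)) (|s| + |t| + 2 * l)).prod
    (Set.finite_Icc (-(|s| + |t| + 2 * l)) (|s| + |t| + 2 * l))).subset ?_
  rintro n ⟨⟨h1, h2⟩, h3, h4⟩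
  have := neg_abs_le s
  have := le_abs_self s
  have := neg_abs_le t
  have := le_abs_self t
  simp only [Set.mem_prod, Set.mem_Icc]
  omega

/-! ### The unique continuation event -/

/-- The unique continuation event `𝓔_uc(Λ, F, α, ε)` at the energy `Ebar`, for the square
`Λ = square a L`, as a set of potentials: for all `E` and `ψ`, if `|E - Ebar| ≤ e^{-α √(L log L)}`,
`Hψ = Eψ` on `Λ`, and `|ψ| ≤ 1` on at least a fraction `1 - ε (L log L)^{-1/2}` of the points of
`Λ \ F`, then `|ψ| ≤ e^{α L log L}` on `½Λ`. -/
def ucEvent (Ebar : ℝ) (a : ℤ × ℤ) (L : ℕ) (F : Set (ℤ × ℤ)) (α ε : ℝ) : Set (ℤ × ℤ → ℝ) :=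
  {V | ∀ (E : ℝ) (ψ : ℤ × ℤ → ℝ),
    |E - Ebar| ≤ Real.exp (-α * (L * Real.log L) ^ (1 / 2 : ℝ)) →
    (∀ n ∈ square a L, schrodinger V ψ n = E * ψ n) →
    (1 - ε * (L * Real.log L) ^ (-(1 / 2) : ℝ)) * (square a L \ F).ncard
      ≤ ({n ∈ square a L \ F | |ψ n| ≤ 1}.ncard : ℝ) →
    ∀ n ∈ halfSquare a L, |ψ n| ≤ Real.exp (α * L * Real.log L)}

/-! ### The randomness -/

section Probability

variable {Ω : Type*} [MeasurableSpace Ω]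

/-- Anti-concentration of a random variable with gap `γ` and remainder `ρ`, where `M` is the
almost sure bound. -/
def AntiConcentrated (P : Measure Ω) (M γ ρ : ℝ) (X : Ω → ℝ) : Prop :=
  ∀ t ∈ Set.Icc 0 M, ρ ≤ P.real {ω | γ / 2 < |X ω - t|}

open Classical in
/-- The potential which equals the prescribed `v` on `F`, and `w` off `F`. -/
noncomputable def glue (F : Set (ℤ × ℤ)) (v : F → ℝ) (w : ℤ × ℤ → ℝ) (n : ℤ × ℤ) : ℝ :=
  if h : n ∈ F then v ⟨n, h⟩ else w n

/-- The conditional probability `P[V ∈ A | V_F = v]` for a potential `V` with independent values: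
the values on `F` are frozen to `v`, those off `F` keep their joint law. It is defined for every
`v`, and `condExp_eq_frozenProb` below shows that it is a version of the conditional
probability with respect to `σ(V_F)`. -/
noncomputable def frozenProb (P : Measure Ω) (V : ℤ × ℤ → Ω → ℝ) (F : Set (ℤ × ℤ)) (v : F → ℝ)
    (A : Set (ℤ × ℤ → ℝ)) : ℝ :=
  P.real {ω | glue F v (fun n => V n ω) ∈ A}

/-- The three standing assumptions on the random potential: joint independence, values in `[0, M]`
almost surely, and uniform anti-concentration with gap `γ` and remainder `ρ`. -/
structure IsAdmissible (P : Measure Ω) (M γ ρ : ℝ) (V : ℤ × ℤ → Ω → ℝ) : Prop where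
  measurable : ∀ n, Measurable (V n)
  indep : iIndepFun V P
  bounded : ∀ n, ∀ᵐ ω ∂P, V n ω ∈ Set.Icc 0 M
  antiConcentrated : ∀ n, AntiConcentrated P M γ ρ (V n)

theorem condExp_eq_frozenProb (P : Measure Ω) [IsProbabilityMeasure P] (V : ℤ × ℤ → Ω → ℝ)
    (hmeas : ∀ n, Measurable (V n)) (hind : iIndepFun V P) (F : Set (ℤ × ℤ))
    (A : Set (ℤ × ℤ → ℝ)) (hA : MeasurableSet A) :
    P[({ω | (fun n => V n ω) ∈ A}).indicator (fun _ => (1 : ℝ)) |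
        MeasurableSpace.comap (fun ω (n : F) => V n ω) inferInstance]
      =ᵐ[P] fun ω => frozenProb P V F (fun n => V n ω) A := by
  classical
  set X : Ω → (F → ℝ) := fun ω n => V n ω with hX
  set Y : Ω → ((Fᶜ : Set (ℤ × ℤ)) → ℝ) := fun ω n => V n ω with hY
  have hXm : Measurable X := measurable_pi_lambda _ fun n => hmeas n
  have hYm : Measurable Y := measurable_pi_lambda _ fun n => hmeas n
  have hle : ∀ S : Set (ℤ × ℤ), MeasurableSpace.comap (fun ω (n : S) => V n ω) inferInstance
      ≤ ⨆ i ∈ S, MeasurableSpace.comap (V i) inferInstance := by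
    intro S
    refine Measurable.comap_le ?_
    refine @measurable_pi_lambda _ _ _ (_) _ _ fun n => ?_
    refine Measurable.mono (ma := MeasurableSpace.comap (V n) inferInstance)
      (comap_measurable _) ?_ le_rfl
    exact le_iSup₂_of_le n.1 n.2 le_rfl
  have hXY : IndepFun X Y P := by
    have h := indep_iSup_of_disjoint (fun i => (hmeas i).comap_le) hind.iIndep
      (disjoint_compl_right (a := F))
    exact indep_of_indep_of_le_left (indep_of_indep_of_le_right h (hle Fᶜ)) (hle F)
  let g : (F → ℝ) × ((Fᶜ : Set (ℤ × ℤ)) → ℝ) → (ℤ × ℤ → ℝ) := fun p n =>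
    if h : n ∈ F then p.1 ⟨n, h⟩ else p.2 ⟨n, h⟩
  have hg : Measurable g := by
    refine measurable_pi_lambda _ fun n => ?_
    by_cases h : n ∈ F
    · simp only [g, h, dite_true]
      exact (measurable_pi_apply _).comp measurable_fst
    · simp only [g, h, dite_false]
      exact (measurable_pi_apply _).comp measurable_snd
  have hB : MeasurableSet (g ⁻¹' A) := hg hA
  have hgXY : ∀ ω, g (X ω, Y ω) = fun n => V n ω := by
    intro ω
    funext n
    by_cases h : n ∈ F <;> simp [g, h, X, Y]
  have hfun : ({ω | (fun n => V n ω) ∈ A}).indicator (fun _ => (1 : ℝ))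
      = fun ω => (g ⁻¹' A).indicator (fun _ => (1 : ℝ)) (X ω, Y ω) := by
    funext ω
    simp only [Set.indicator, Set.mem_ofPred_eq, Set.mem_preimage, hgXY]
  have hconst : condDistrib Y X P =ᵐ[P.map X] Kernel.const _ (P.map Y) := by
    have : IsProbabilityMeasure (P.map Y) := Measure.isProbabilityMeasure_map hYm.aemeasurable
    refine condDistrib_ae_eq_of_measure_eq_compProd X hYm.aemeasurable ?_
    rw [(indepFun_iff_map_prod_eq_prod_map_map hXm.aemeasurable hYm.aemeasurable).1 hXY,
      Measure.compProd_const]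
  rw [hfun]
  have h1 := condExp_prod_ae_eq_integral_condDistrib (μ := P) hXm hYm.aemeasurable
    (f := (g ⁻¹' A).indicator (fun _ => (1 : ℝ)))
    (stronglyMeasurable_const.indicator hB)
    ((integrable_const (1 : ℝ)).indicator ((hXm.prodMk hYm) hB))
  refine h1.trans ?_
  filter_upwards [ae_of_ae_map hXm.aemeasurable hconst] with ω hω
  rw [hω, Kernel.const_apply]
  have hs : MeasurableSet (Prod.mk (X ω) ⁻¹' (g ⁻¹' A)) := measurable_prodMk_left hB
  have : (fun y => (g ⁻¹' A).indicator (fun _ => (1 : ℝ)) (X ω, y))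
      = (Prod.mk (X ω) ⁻¹' (g ⁻¹' A)).indicator (fun _ => (1 : ℝ)) := rfl
  rw [this, integral_indicator hs, setIntegral_const, smul_eq_mul, mul_one,
    map_measureReal_apply hYm hs]
  unfold frozenProb
  congr 1

end Probability

/-- The unique continuation event is a Borel set of potentials. -/
theorem measurableSet_ucEvent (Ebar : ℝ) (a : ℤ × ℤ) (L : ℕ) (F : Set (ℤ × ℤ)) (α ε : ℝ) :
    MeasurableSet (ucEvent Ebar a L F α ε) := by
  classical
  set B : Set (ℤ × ℤ) := Set.Icc (a.1 - 1) (a.1 + L) ×ˢ Set.Icc (a.2 - 1) (a.2 + L) with hB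
  have hBf : B.Finite := (Set.finite_Icc _ _).prod (Set.finite_Icc _ _)
  let S : ℤ × ℤ → Finset (ℤ × ℤ) := fun z => insert z hBf.toFinset
  let ex : ∀ z, (S z → ℝ) → ℤ × ℤ → ℝ := fun z φ n => if h : n ∈ S z then φ ⟨n, h⟩ else 0
  let re : ∀ z, (ℤ × ℤ → ℝ) → (S z → ℝ) := fun z ψ n => ψ n
  have hex : ∀ z n, Continuous fun φ : S z → ℝ => ex z φ n := by
    intro z n
    by_cases h : n ∈ S z
    · simp only [ex, h, dite_true]; exact continuous_apply _
    · simp only [ex, h, dite_false]; exact continuous_const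
  have hre : ∀ z, Measurable (re z) := fun z =>
    measurable_pi_lambda _ fun n => measurable_pi_apply _
  have hexre : ∀ z ψ n, n ∈ S z → ex z (re z ψ) n = ψ n := by
    intro z ψ n h
    simp [ex, re, h]
  have hSB : ∀ z n, n ∈ B → n ∈ S z := by
    intro z n h
    simp [S, h]
  have hcong : ∀ z V ψ n, n ∈ square a L →
      schrodinger (ex z (re z V)) (ex z (re z ψ)) n = schrodinger V ψ n := by
    rintro z V ψ n ⟨⟨h1, h2⟩, h3, h4⟩
    unfold schrodinger laplacian
    rw [hexre, hexre, hexre, hexre, hexre, hexre] <;> apply hSB <;>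
      simp only [hB, Set.mem_prod, Set.mem_Icc] <;> omega
  have hcongV : ∀ z V ψ n, n ∈ square a L →
      schrodinger (ex z (re z V)) ψ n = schrodinger V ψ n := by
    rintro z V ψ n ⟨⟨h1, h2⟩, h3, h4⟩
    unfold schrodinger
    rw [hexre]
    apply hSB
    simp only [hB, Set.mem_prod, Set.mem_Icc]; omega
  let K : ∀ (z : ℤ × ℤ) (_ : Finset (ℤ × ℤ)) (_ : ℕ), Set ((S z → ℝ) × ℝ × (S z → ℝ)) :=
    fun z T k => {p | |p.2.1 - Ebar| ≤ Real.exp (-α * (L * Real.log L) ^ (1 / 2 : ℝ)) ∧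
      (∀ n ∈ square a L, schrodinger (ex z p.1) (ex z p.2.2) n = p.2.1 * ex z p.2.2 n) ∧
      (∀ n ∈ T, |ex z p.2.2 n| ≤ 1) ∧
      Real.exp (α * L * Real.log L) + 1 / ((k : ℝ) + 1) ≤ |ex z p.2.2 z|}
  have hK : ∀ z T k, IsClosed (K z T k) := by
    intro z T k
    have hψ : ∀ n, Continuous fun p : (S z → ℝ) × ℝ × (S z → ℝ) => ex z p.2.2 n :=
      fun n => (hex z n).comp (continuous_snd.comp continuous_snd)
    have hV : ∀ n, Continuous fun p : (S z → ℝ) × ℝ × (S z → ℝ) => ex z p.1 n :=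
      fun n => (hex z n).comp continuous_fst
    have hE : Continuous fun p : (S z → ℝ) × ℝ × (S z → ℝ) => p.2.1 :=
      continuous_fst.comp continuous_snd
    refine IsClosed.inter ?_ (IsClosed.inter ?_ (IsClosed.inter ?_ ?_))
    · exact isClosed_le (hE.sub continuous_const).abs continuous_const
    · change IsClosed {p : (S z → ℝ) × ℝ × (S z → ℝ) | ∀ n ∈ square a L,
        schrodinger (ex z p.1) (ex z p.2.2) n = p.2.1 * ex z p.2.2 n}
      simp only [Set.ofPred_forall]
      refine isClosed_iInter fun n => isClosed_iInter fun _ => isClosed_eq ?_ (hE.mul (hψ n))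
      unfold schrodinger laplacian
      have := hψ n
      have := hV n
      have := hψ (n.1 + 1, n.2)
      have := hψ (n.1 - 1, n.2)
      have := hψ (n.1, n.2 + 1)
      have := hψ (n.1, n.2 - 1)
      fun_prop
    · change IsClosed {p : (S z → ℝ) × ℝ × (S z → ℝ) | ∀ n ∈ T, |ex z p.2.2 n| ≤ 1}
      simp only [Set.ofPred_forall]
      exact isClosed_iInter fun n => isClosed_iInter fun _ => isClosed_le (hψ n).abs continuous_const
    · exact isClosed_le continuous_const (hψ z).abs
  have hm : ∀ z T k, MeasurableSet (Prod.fst '' K z T k) := by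
    intro z T k
    have h : IsSigmaCompact (Prod.fst '' K z T k) :=
      ((isSigmaCompact_univ.of_isClosed_subset (hK z T k) (Set.subset_univ _))).image continuous_fst
    obtain ⟨C, hC, hU⟩ := h
    rw [← hU]
    exact MeasurableSet.iUnion fun i => (hC i).isClosed.measurableSet
  have key : (ucEvent Ebar a L F α ε)ᶜ = ⋃ (z : ℤ × ℤ) (_ : z ∈ halfSquare a L)
      (T : Finset (ℤ × ℤ)) (_ : (T : Set (ℤ × ℤ)) ⊆ square a L \ F ∧
        (1 - ε * (L * Real.log L) ^ (-(1 / 2) : ℝ)) * (square a L \ F).ncard ≤ (T.card : ℝ))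
      (k : ℕ), re z ⁻¹' (Prod.fst '' K z T k) := by
    have hfin : (square a L \ F).Finite := (square_finite a L).subset Set.sdiff_subset
    ext V
    simp only [Set.mem_compl_iff, ucEvent, Set.mem_ofPred_eq, Set.mem_iUnion, Set.mem_preimage,
      Set.mem_image, Prod.exists, exists_and_right, exists_eq_right]
    push Not
    constructor
    · rintro ⟨E, ψ, h1, h2, h3, z, hz, h4⟩
      have hTf : {n ∈ square a L \ F | |ψ n| ≤ 1}.Finite := hfin.subset (Set.sep_subset _ _)
      obtain ⟨k, hk⟩ := exists_nat_one_div_lt (sub_pos.2 h4)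
      refine ⟨z.1, z.2, hz, hTf.toFinset, ⟨?_, ?_⟩, k, E, re z ψ, h1, ?_, ?_, ?_⟩
      · rw [hTf.coe_toFinset]; exact Set.sep_subset _ _
      · rwa [← Set.ncard_eq_toFinset_card _ hTf]
      · intro n hn
        have h5 := hcong z V ψ n hn
        rw [h5, h2 n hn, hexre]
        obtain ⟨⟨h1, h2⟩, h3, h4⟩ := hn
        apply hSB
        simp only [hB, Set.mem_prod, Set.mem_Icc]; omega
      · intro n hn
        rw [Set.Finite.mem_toFinset] at hn
        rw [hexre]
        · exact hn.2
        · obtain ⟨⟨⟨⟨h1, h2⟩, h3, h4⟩, _⟩, _⟩ := hn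
          apply hSB
          simp only [hB, Set.mem_prod, Set.mem_Icc]; omega
      · have : ex z (re z ψ) z = ψ z := hexre z ψ z (by simp [S])
        simp only [Prod.mk.eta, this]
        linarith
    · rintro ⟨z1, z2, hz, T, ⟨hT, hTc⟩, k, E, φ, h1, h2, h3, h4⟩
      refine ⟨E, ex (z1, z2) φ, h1, ?_, hTc.trans ?_, (z1, z2), hz, ?_⟩
      · intro n hn
        rw [← h2 n hn, hcongV _ _ _ _ hn]
      · rw [← Set.ncard_coe_finset]
        have hsub : (T : Set (ℤ × ℤ)) ⊆ {n ∈ square a L \ F | |ex (z1, z2) φ n| ≤ 1} :=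
          fun n hn => ⟨hT hn, h3 n hn⟩
        exact_mod_cast Set.ncard_le_ncard hsub (hfin.subset (Set.sep_subset _ _))
      · have : (0 : ℝ) < 1 / ((k : ℝ) + 1) := by positivity
        linarith [h4]
  rw [← MeasurableSet.compl_iff, key]
  exact MeasurableSet.iUnion fun z => MeasurableSet.iUnion fun _ => MeasurableSet.iUnion fun T =>
    MeasurableSet.iUnion fun _ => MeasurableSet.iUnion fun k => hre z (hm z T k)

end AndersonZ2

open AndersonZ2

/-!
In the diagonal coordinates `s = x + y`, `t = x - y` the equation `H ψ = E ψ` becomes a recursion: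
the value at `(s + 2, t + 2)` is determined by the values at `(s, t)`, `(s + 2, t)`, `(s, t + 2)`
and by the potential at `(s + 1, t + 1)`. Hence a solution on a tilted rectangle is determined by
its two lowest rows and its two leftmost columns. Everything below is deterministic except for one
probability estimate, which says that a solution bounded by `1` on the two lowest rows of a thin
rectangle, and at most points of the two highest rows, cannot be large in between.

*No inflation in thin rectangles.* Suppose that a solution vanishes on the two lowest rows and that
its left data are not small. The first row `τ` on which the left datum exceeds a geometrically
growing threshold dominates everything produced by the rows below it, so along this row the
solution alternates in sign with almost constant modulus (`DiagEq.row_lower_bound`). Changing the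
potential at a site `(σ, τ)` of this row does not affect the columns up to `σ`, and changes the
solution in column `σ + 1` by the same amount, up to a sign, on every second row above `τ`
(`diagSol_influence`). Reading the columns from left to right and using anti-concentration of the
potential at each `(σ, τ)`, one of the two highest rows is small at most points only with
probability exponentially small in the length `a` (`measure_card_exceed_le`,
`measure_rowExceed_le`). The left data can be rounded to integers bounded by `A ^ (3 * b)`, where
`b` is the width and `A` bounds the growth per row (`DiagEq.exists_int_data`). Their number
`A ^ O(b ^ 2)` is beaten by the probability if `b ^ 2 * log A` is a small multiple of `a`, which
gives `measure_not_noInflation_le`. A union bound over all rectangles of length at least `L ^ (1/4)`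
yields `measure_not_goodPotential_le`, and with it the error `e ^ (-ε L ^ (1/4))`.

*Doubling.* Let a solution be bounded on a tilted square of radius `r`. If `F` is sparse in the
concentric square of radius `3 r`, and the points off `F` with `|ψ| > 1` have density below a small
multiple of `(L log L) ^ (-1/2)` there, then the bound extends to radius `2 r` at the cost of a
factor `A ^ O(r)`. For `r ≥ L ^ (1/4)` one advances in strips of width `√(r / log A)` up to
constants; every strip contains two consecutive rows with few exceptional points, so that no
inflation occurs (`upStep_of_noInflation`, `bddTsq_double_of_goodPotential`). For smaller `r` the
density bound leaves no exceptional point at all, and a single point off `F` on each row suffices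
(`upStep_of_bounded_off`).

*Covering.* Iterating over dyadic radii bounds `ψ` by `A ^ O(L)` around every center at which the
hypotheses of the doubling step hold at all scales. If no such center existed near a given point of
the half square, the squares violating the hypotheses would cover a neighbourhood of size
comparable to the whole square, and by Vitali's lemma disjoint ones would occupy a positive
fraction of it, against the regularity of `F` and the bound on the number of exceptional points
(`sq_le_of_forall_fails`). This is `mem_ucEvent_of_goodPotential`.
-/

open MeasureTheory ProbabilityTheory

namespace AndersonZ2

/-! ### Large deviations for adapted functions of independent variables -/

/-- The weight `1/2` for a value of modulus above `T`, and `1` otherwise. -/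
noncomputable def halfWeight (T z : ℝ) : ENNReal := if T < |z| then 2⁻¹ else 1

lemma measurable_halfWeight (T : ℝ) : Measurable (halfWeight T) :=
  Measurable.ite (measurableSet_lt measurable_const continuous_abs.measurable)
    measurable_const measurable_const

lemma lintegral_halfWeight_le {Ω : Type*} [MeasurableSpace Ω] (P : Measure Ω)
    [IsProbabilityMeasure P] {ρ T : ℝ} {g : Ω → ℝ} (hg : Measurable g)
    (h : ρ ≤ P.real {ω | T < |g ω|}) :
    ∫⁻ ω, halfWeight T (g ω) ∂P ≤ ENNReal.ofReal (1 - ρ / 2) := by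
  set A := {ω | T < |g ω|} with hA
  have hAm : MeasurableSet A := measurableSet_lt measurable_const hg.abs
  have e : (fun ω => halfWeight T (g ω))
      = fun ω => A.indicator (fun _ => (2⁻¹ : ENNReal)) ω + Aᶜ.indicator (fun _ => 1) ω := by
    funext ω
    by_cases hω : ω ∈ A
    · have : T < |g ω| := hω
      simp [halfWeight, this, hω]
    · have : ¬ T < |g ω| := hω
      simp [halfWeight, this, hω]
  rw [e, lintegral_add_left (measurable_const.indicator hAm), lintegral_indicator_const hAm,
    lintegral_indicator_const hAm.compl, one_mul]
  have h1 : P A = ENNReal.ofReal (P.real A) := by simp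
  have h2 : P Aᶜ = ENNReal.ofReal (1 - P.real A) := by
    rw [← probReal_compl_eq_one_sub hAm]; simp
  have h3 : (2⁻¹ : ENNReal) = ENNReal.ofReal (1 / 2) := by
    rw [one_div, ENNReal.ofReal_inv_of_pos (by norm_num)]; simp
  have h4 : P.real A ≤ 1 := measureReal_le_one
  rw [h1, h2, h3, ← ENNReal.ofReal_mul (by norm_num), ← ENNReal.ofReal_add (by positivity)
    (by linarith)]
  exact ENNReal.ofReal_le_ofReal (by linarith)

variable {Ω ι : Type*} [MeasurableSpace Ω]

lemma indepFun_update [DecidableEq ι] {P : Measure Ω} {W : ι → Ω → ℝ}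
    (hm : ∀ i, Measurable (W i)) (hW : iIndepFun W P) (i : ι) :
    IndepFun (W i) (fun ω => Function.update (fun k => W k ω) i 0) P := by
  have h := indep_iSup_of_disjoint (fun i => (hm i).comap_le) hW.iIndep
    (S := {i}) (T := {i}ᶜ) disjoint_compl_right
  refine indep_of_indep_of_le_left (indep_of_indep_of_le_right h ?_) ?_
  · refine Measurable.comap_le (@measurable_pi_lambda _ _ _ (_) _ _ fun k => ?_)
    by_cases hk : k = i
    · subst hk; simp
    · simp only [Function.update_of_ne hk]
      refine Measurable.mono (ma := MeasurableSpace.comap (W k) inferInstance)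
        (comap_measurable _) ?_ le_rfl
      exact le_iSup₂_of_le (f := fun n (_ : n ∈ ({i}ᶜ : Set ι)) =>
        MeasurableSpace.comap (W n) inferInstance) k hk le_rfl
  · exact le_iSup₂_of_le (f := fun n (_ : n ∈ ({i} : Set ι)) =>
        MeasurableSpace.comap (W n) inferInstance) i rfl le_rfl

/-- Exponential moment bound: if `Z s` does not see the variables `W (p s')` with `s' > s`, and
resampling `W (p s)` alone makes `|Z s| > T` with probability at least `ρ`, then the factors
`halfWeight T (Z s)` can be integrated out one after the other, from the last to the first. -/
lemma lintegral_prod_halfWeight_le [DecidableEq ι] (P : Measure Ω) [IsProbabilityMeasure P]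
    {W : ι → Ω → ℝ} (hm : ∀ i, Measurable (W i)) (hW : iIndepFun W P) {ρ T : ℝ}
    (p : ℕ → ι) (Z : ℕ → (ι → ℝ) → ℝ) (hZ : ∀ s, Measurable (Z s)) (S : Finset ℕ)
    (h1 : ∀ s ∈ S, ∀ s' ∈ S, s < s' → ∀ w x, Z s (Function.update w (p s') x) = Z s w)
    (h2 : ∀ s ∈ S, ∀ w, ρ ≤ P.real {ω | T < |Z s (Function.update w (p s) (W (p s) ω))|}) :
    ∫⁻ ω, ∏ s ∈ S, halfWeight T (Z s (fun k => W k ω)) ∂P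
      ≤ ENNReal.ofReal (1 - ρ / 2) ^ S.card := by
  induction S using Finset.induction_on_max with
  | empty => simp
  | insert n S hn ih =>
    have hnS : n ∉ S := fun h => lt_irrefl _ (hn n h)
    have ih' := ih (fun s hs s' hs' => h1 s (Finset.mem_insert_of_mem hs) s'
      (Finset.mem_insert_of_mem hs')) (fun s hs => h2 s (Finset.mem_insert_of_mem hs))
    set X : Ω → ℝ := W (p n) with hX
    set Y : Ω → ι → ℝ := fun ω => Function.update (fun k => W k ω) (p n) 0 with hY
    have hWm : Measurable fun ω k => W k ω := measurable_pi_lambda _ fun k => hm k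
    have hYm : Measurable Y := by
      refine measurable_pi_lambda _ fun k => ?_
      by_cases hk : k = p n
      · subst hk; simp [hY]
      · simpa [hY, Function.update_of_ne hk] using hm k
    let g : (ι → ℝ) → ENNReal := fun y => ∏ s ∈ S, halfWeight T (Z s y)
    have hgm : Measurable g :=
      Finset.measurable_prod _ fun s _ => (measurable_halfWeight T).comp (hZ s)
    let f : ℝ × (ι → ℝ) → ENNReal := fun q => halfWeight T (Z n (Function.update q.2 (p n) q.1))
    have hum : Measurable fun q : ℝ × (ι → ℝ) => Function.update q.2 (p n) q.1 := by
      refine measurable_pi_lambda _ fun k => ?_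
      by_cases hk : k = p n
      · subst hk; simpa using measurable_fst
      · simp only [Function.update_of_ne hk]
        exact (measurable_pi_apply k).comp measurable_snd
    have hfm : Measurable f := (measurable_halfWeight T).comp ((hZ n).comp hum)
    have hgY : ∀ ω, g (fun k => W k ω) = g (Y ω) := fun ω =>
      Finset.prod_congr rfl fun s hs => by
        rw [hY]; dsimp only
        rw [h1 s (Finset.mem_insert_of_mem hs) n (Finset.mem_insert_self _ _) (hn s hs)]
    have e : ∀ ω, ∏ s ∈ insert n S, halfWeight T (Z s (fun k => W k ω))
        = f (X ω, Y ω) * g (Y ω) := by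
      intro ω
      rw [Finset.prod_insert hnS, ← hgY]
      congr 3
      simp only [hX, hY, Function.update_idem]
      exact (Function.update_eq_self (p n) _).symm
    have hXY : P.map (fun ω => (X ω, Y ω)) = (P.map X).prod (P.map Y) :=
      (indepFun_iff_map_prod_eq_prod_map_map (hm _).aemeasurable hYm.aemeasurable).1
        (indepFun_update hm hW (p n))
    have : IsProbabilityMeasure (P.map X) := Measure.isProbabilityMeasure_map (hm _).aemeasurable
    have : IsProbabilityMeasure (P.map Y) := Measure.isProbabilityMeasure_map hYm.aemeasurable
    have hFm : Measurable fun q : ℝ × (ι → ℝ) => f q * g q.2 := hfm.mul (hgm.comp measurable_snd)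
    calc ∫⁻ ω, ∏ s ∈ insert n S, halfWeight T (Z s (fun k => W k ω)) ∂P
        = ∫⁻ ω, f (X ω, Y ω) * g (Y ω) ∂P := lintegral_congr e
      _ = ∫⁻ q, f q * g q.2 ∂(P.map fun ω => (X ω, Y ω)) :=
          (lintegral_map hFm ((hm _).prodMk hYm)).symm
      _ = ∫⁻ y, ∫⁻ x, f (x, y) * g y ∂(P.map X) ∂(P.map Y) := by
          rw [hXY, lintegral_prod_symm _ hFm.aemeasurable]
      _ ≤ ∫⁻ y, ENNReal.ofReal (1 - ρ / 2) * g y ∂(P.map Y) := by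
          refine lintegral_mono fun y => ?_
          have hfy : Measurable fun x => f (x, y) := hfm.comp measurable_prodMk_right
          rw [lintegral_mul_const _ hfy]
          gcongr
          rw [lintegral_map hfy (hm _)]
          exact lintegral_halfWeight_le P
            ((hZ n).comp (hum.comp (measurable_prodMk_right.comp (hm _))))
            (h2 n (Finset.mem_insert_self _ _) y)
      _ = ENNReal.ofReal (1 - ρ / 2) * ∫⁻ ω, g (Y ω) ∂P := by
          rw [lintegral_const_mul _ hgm, lintegral_map hgm hYm]
      _ ≤ ENNReal.ofReal (1 - ρ / 2) ^ (insert n S).card := by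
          rw [Finset.card_insert_of_notMem hnS, pow_succ, mul_comm]
          gcongr
          rw [← lintegral_congr hgY]
          exact ih'

/-- Under the assumptions of `lintegral_prod_halfWeight_le`, it is exponentially unlikely that at
most `m` of the values `|Z s|` exceed `T`. -/
lemma measure_card_exceed_le [DecidableEq ι] (P : Measure Ω) [IsProbabilityMeasure P]
    {W : ι → Ω → ℝ} (hm : ∀ i, Measurable (W i)) (hW : iIndepFun W P) {ρ T : ℝ}
    (p : ℕ → ι) (Z : ℕ → (ι → ℝ) → ℝ) (hZ : ∀ s, Measurable (Z s)) (S : Finset ℕ)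
    (h1 : ∀ s ∈ S, ∀ s' ∈ S, s < s' → ∀ w x, Z s (Function.update w (p s') x) = Z s w)
    (h2 : ∀ s ∈ S, ∀ w, ρ ≤ P.real {ω | T < |Z s (Function.update w (p s) (W (p s) ω))|})
    (m : ℕ) :
    P {ω | (S.filter fun s => T < |Z s (fun k => W k ω)|).card ≤ m}
      ≤ 2 ^ m * ENNReal.ofReal (1 - ρ / 2) ^ S.card := by
  have hWm : Measurable fun ω k => W k ω := measurable_pi_lambda _ fun k => hm k
  have hprod : ∀ w : ι → ℝ, ∏ s ∈ S, halfWeight T (Z s w)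
      = 2⁻¹ ^ (S.filter fun s => T < |Z s w|).card := by
    intro w
    simp only [halfWeight]
    rw [Finset.prod_ite]
    simp
  have hsub : {ω | (S.filter fun s => T < |Z s (fun k => W k ω)|).card ≤ m}
      ⊆ {ω | (2⁻¹ : ENNReal) ^ m ≤ ∏ s ∈ S, halfWeight T (Z s (fun k => W k ω))} := by
    intro ω hω
    rw [Set.mem_ofPred_eq, hprod]
    exact pow_le_pow_right_of_le_one' (by simp) hω
  have hmeas : Measurable fun ω => ∏ s ∈ S, halfWeight T (Z s (fun k => W k ω)) :=
    Finset.measurable_prod _ fun s _ => (measurable_halfWeight T).comp ((hZ s).comp hWm)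
  calc P _ ≤ P _ := measure_mono hsub
    _ ≤ (∫⁻ ω, ∏ s ∈ S, halfWeight T (Z s (fun k => W k ω)) ∂P) / 2⁻¹ ^ m :=
        meas_ge_le_lintegral_div hmeas.aemeasurable (by simp) (by simp)
    _ ≤ ENNReal.ofReal (1 - ρ / 2) ^ S.card / 2⁻¹ ^ m := by
        gcongr
        exact lintegral_prod_halfWeight_le P hm hW p Z hZ S h1 h2
    _ = _ := by
        rw [ENNReal.div_eq_inv_mul, ENNReal.inv_pow, inv_inv]

/-! ### The recursion along diagonals -/

/-- If consecutive terms (in steps of two) are opposite up to an error `D`, the modulus varies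
by at most `D` per step. -/
lemma abs_abs_sub_abs_le_of_alternating {f : ℕ → ℝ} {D : ℝ} {a : ℕ}
    (h : ∀ s, s + 2 ≤ a → |f (s + 2) + f s| ≤ D) (e k : ℕ) (hk : e + 2 * k ≤ a) :
    |(|f (e + 2 * k)| - |f e|)| ≤ k * D := by
  induction k with
  | zero => simp
  | succ k ih =>
    have h1 := ih (by omega)
    have h2 := h (e + 2 * k) (by omega)
    have h3 := abs_abs_sub_abs_le (f (e + 2 * k + 2)) (-f (e + 2 * k))
    rw [abs_neg, sub_neg_eq_add] at h3
    have e1 : e + 2 * (k + 1) = e + 2 * k + 2 := by ring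
    rw [e1]
    push_cast
    obtain ⟨h4, h5⟩ := abs_le.1 h1
    obtain ⟨h6, h7⟩ := abs_le.1 (h3.trans h2)
    exact abs_le.2 ⟨by linarith, by linarith⟩

/-- The equation satisfied, in the coordinates `s = x + y`, `t = x - y` relative to a corner, by a
generalized eigenfunction `u`: `q` is the potential shifted by `4 - E`, and `r` is an error term. -/
def DiagEq (a b : ℕ) (q r u : ℕ → ℕ → ℝ) : Prop :=
  ∀ s t, s + 2 ≤ a → t + 2 ≤ b →
    u (s + 2) (t + 2) + u s t + u (s + 2) t + u s (t + 2)
      = q (s + 1) (t + 1) * u (s + 1) (t + 1) + r s t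

lemma DiagEq.abs_add_le {a b : ℕ} {q r u : ℕ → ℕ → ℝ} {B P₀ P₁ R : ℝ} (hu : DiagEq a b q r u)
    (hq : ∀ s t, |q s t| ≤ B) {t : ℕ} (ht : t + 2 ≤ b) (h0 : ∀ s ≤ a, |u s t| ≤ P₀)
    (h1 : ∀ s ≤ a, |u s (t + 1)| ≤ P₁) (hr : ∀ s, s + 2 ≤ a → |r s t| ≤ R) (s : ℕ)
    (hs : s + 2 ≤ a) : |u (s + 2) (t + 2) + u s (t + 2)| ≤ B * P₁ + 2 * P₀ + R := by
  have e : u (s + 2) (t + 2) + u s (t + 2)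
      = q (s + 1) (t + 1) * u (s + 1) (t + 1) + r s t - u s t - u (s + 2) t := by
    linarith [hu s t hs ht]
  have b1 : |q (s + 1) (t + 1) * u (s + 1) (t + 1)| ≤ B * P₁ := by
    rw [abs_mul]
    exact mul_le_mul (hq _ _) (h1 _ (by omega)) (abs_nonneg _) ((abs_nonneg _).trans (hq 0 0))
  have b2 := h0 s (by omega)
  have b3 := h0 (s + 2) (by omega)
  have b4 := hr s hs
  rw [e]
  rw [abs_le] at *
  constructor <;> linarith [b1.1, b1.2, b2.1, b2.2, b3.1, b3.2, b4.1, b4.2]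

lemma row_growth_le {a k : ℕ} (hk : 2 * k ≤ a) {A B x : ℝ} (hB : 0 ≤ B)
    (hA : 2 * (B + 3) * (a + 1) ≤ A) (hx : 0 ≤ x) (t : ℕ) :
    k * (B * (x * A ^ (t + 1)) + 2 * (x * A ^ t) + x) + x ≤ x * A ^ (t + 2) / 2 := by
  have hka : (2 : ℝ) * k ≤ a := by exact_mod_cast hk
  have ha : (0 : ℝ) ≤ a := Nat.cast_nonneg a
  have hk0 : (0 : ℝ) ≤ k := Nat.cast_nonneg k
  have hA1 : 1 ≤ A := by nlinarith
  have h1 : (1 : ℝ) ≤ A ^ t := one_le_pow₀ hA1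
  have h2 : A ^ t ≤ A ^ (t + 1) := pow_le_pow_right₀ hA1 (by omega)
  have h3 : B * (x * A ^ (t + 1)) + 2 * (x * A ^ t) + x ≤ (B + 3) * (x * A ^ (t + 1)) := by
    nlinarith [mul_le_mul_of_nonneg_left h2 hx, mul_le_mul_of_nonneg_left (h1.trans h2) hx]
  have hy : 0 ≤ x * A ^ (t + 1) := by positivity
  have h4 : x ≤ x * A ^ (t + 1) := by nlinarith [h1.trans h2]
  calc k * (B * (x * A ^ (t + 1)) + 2 * (x * A ^ t) + x) + x
      ≤ k * ((B + 3) * (x * A ^ (t + 1))) + x * A ^ (t + 1) := by gcongr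
    _ = (k * (B + 3) + 1) * (x * A ^ (t + 1)) := by ring
    _ ≤ (A / 2) * (x * A ^ (t + 1)) := by
        gcongr
        nlinarith
    _ = x * A ^ (t + 2) / 2 := by ring

/-- A priori bound: a solution is determined by its values on the two lowest rows and the two
leftmost columns, and grows at most by a factor `A` from row to row. -/
lemma DiagEq.apriori_bound {a b : ℕ} {q r u : ℕ → ℕ → ℝ} {A B μ : ℝ} (hu : DiagEq a b q r u)
    (hq : ∀ s t, |q s t| ≤ B) (hA : 2 * (B + 3) * (a + 1) ≤ A)
    (hr : ∀ s t, s + 2 ≤ a → t + 2 ≤ b → |r s t| ≤ μ)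
    (hbot : ∀ s ≤ a, |u s 0| ≤ μ ∧ |u s 1| ≤ μ) (hleft : ∀ t ≤ b, |u 0 t| ≤ μ ∧ |u 1 t| ≤ μ) :
    ∀ t ≤ b, ∀ s ≤ a, |u s t| ≤ μ * A ^ t := by
  have hB : 0 ≤ B := (abs_nonneg _).trans (hq 0 0)
  have hμ : 0 ≤ μ := (abs_nonneg _).trans (hbot 0 (by omega)).1
  have hA1 : 1 ≤ A := by nlinarith [Nat.cast_nonneg (α := ℝ) a]
  intro t
  induction t using Nat.strong_induction_on with
  | _ t ih =>
    intro ht s hs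
    match t, ih, ht with
    | 0, _, _ => simpa using (hbot s hs).1
    | 1, _, _ => exact (hbot s hs).2.trans (by rw [pow_one]; nlinarith)
    | t + 2, ih, ht =>
      have hD := hu.abs_add_le hq ht (ih t (by omega) (by omega))
        (ih (t + 1) (by omega) (by omega)) (fun s hs => hr s t hs ht)
      have h1 := abs_abs_sub_abs_le_of_alternating (f := fun s => u s (t + 2)) hD (s % 2) (s / 2)
        (by omega)
      rw [show s % 2 + 2 * (s / 2) = s by omega] at h1
      have h2 := row_growth_le (k := s / 2) (a := a) (by omega) hB hA hμ t
      have h3 : |u (s % 2) (t + 2)| ≤ μ := by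
        rcases Nat.mod_two_eq_zero_or_one s with h | h <;> rw [h]
        exacts [(hleft _ ht).1, (hleft _ ht).2]
      have h4 : 0 ≤ μ * A ^ (t + 2) := by positivity
      linarith [(abs_le.1 h1).2]

/-- If a solution vanishes on the two lowest rows but not on the left columns, there is a whole
diagonal on which it is not small: the first row `τ` whose left value exceeds a threshold growing
geometrically in the row dominates everything produced by the rows below it. -/
lemma DiagEq.row_lower_bound {a b τ e : ℕ} {q u : ℕ → ℕ → ℝ} {A B η : ℝ}
    (hu : DiagEq a b q (fun _ _ => 0) u)
    (hq : ∀ s t, |q s t| ≤ B) (hA : 2 * (B + 3) * (a + 1) ≤ A) (hη : 0 < η)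
    (hbot : ∀ s ≤ a, u s 0 = 0 ∧ u s 1 = 0) (hτ2 : 2 ≤ τ) (hτb : τ ≤ b)
    (hτ : η * A ^ τ ≤ |u e τ|) (hlow : ∀ t < τ, ∀ e < 2, |u e t| ≤ η * A ^ t) :
    ∀ k, e + 2 * k ≤ a → η * A ^ τ / 2 ≤ |u (e + 2 * k) τ| := by
  have hB : 0 ≤ B := (abs_nonneg _).trans (hq 0 0)
  have hA1 : 1 ≤ A := by nlinarith [Nat.cast_nonneg (α := ℝ) a]
  have hA0 : 0 < A := by linarith
  have hsmall : ∀ t < τ, ∀ s ≤ a, |u s t| ≤ 2 * η * A ^ t := by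
    intro t
    induction t using Nat.strong_induction_on with
    | _ t ih =>
      intro ht s hs
      match t, ih, ht with
      | 0, _, _ => rw [(hbot s hs).1]; simp; positivity
      | 1, _, _ => rw [(hbot s hs).2]; simp; positivity
      | t + 2, ih, ht =>
        have hD := hu.abs_add_le hq (by omega) (ih t (by omega) (by omega))
          (ih (t + 1) (by omega) (by omega)) (R := 2 * η) (fun s hs => by simp; positivity)
        have h1 := abs_abs_sub_abs_le_of_alternating (f := fun s => u s (t + 2)) hD (s % 2) (s / 2)
          (by omega)
        rw [show s % 2 + 2 * (s / 2) = s by omega] at h1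
        have h2 := row_growth_le (k := s / 2) (a := a) (by omega) hB hA
          (x := 2 * η) (by positivity) t
        have h3 := hlow _ ht (s % 2) (by omega)
        linarith [(abs_le.1 h1).2]
  intro k hk
  obtain ⟨t, rfl⟩ : ∃ t, τ = t + 2 := ⟨τ - 2, by omega⟩
  have hD := hu.abs_add_le hq (by omega) (hsmall t (by omega))
    (hsmall (t + 1) (by omega)) (R := 2 * η) (fun s hs => by simp; positivity)
  have h1 := abs_abs_sub_abs_le_of_alternating (f := fun s => u s (t + 2)) hD e k hk
  -- The factor `2` in the smaller rows is absorbed because only `k ≤ a / 2` steps are made.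
  have h2 : k * (B * (2 * η * A ^ (t + 1)) + 2 * (2 * η * A ^ t) + 2 * η)
      ≤ η * A ^ (t + 2) / 2 := by
    have hka : (2 : ℝ) * k ≤ a := by exact_mod_cast (by omega : 2 * k ≤ a)
    have g1 : (1 : ℝ) ≤ A ^ t := one_le_pow₀ hA1
    have g2 : A ^ t ≤ A ^ (t + 1) := pow_le_pow_right₀ hA1 (by omega)
    have g3 : B * (2 * η * A ^ (t + 1)) + 2 * (2 * η * A ^ t) + 2 * η
        ≤ (2 * (B + 3)) * (η * A ^ (t + 1)) := by
      nlinarith [mul_le_mul_of_nonneg_left g2 hη.le,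
        mul_le_mul_of_nonneg_left (g1.trans g2) hη.le]
    calc k * (B * (2 * η * A ^ (t + 1)) + 2 * (2 * η * A ^ t) + 2 * η)
        ≤ k * ((2 * (B + 3)) * (η * A ^ (t + 1))) := by gcongr
      _ = (2 * k * (B + 3)) * (η * A ^ (t + 1)) := by ring
      _ ≤ (A / 2) * (η * A ^ (t + 1)) := by
          gcongr
          nlinarith
      _ = η * A ^ (t + 2) / 2 := by ring
  linarith [(abs_le.1 h1).1]

/-- The solution of `DiagEq` without error term which vanishes on rows `0` and `1`, and has the
values prescribed by `w` in columns `0` and `1`. -/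
noncomputable def diagSol (q w : ℕ → ℕ → ℝ) : ℕ → ℕ → ℝ
  | _, 0 => 0
  | _, 1 => 0
  | 0, t + 2 => w 0 (t + 2)
  | 1, t + 2 => w 1 (t + 2)
  | s + 2, t + 2 => q (s + 1) (t + 1) * diagSol q w (s + 1) (t + 1) - diagSol q w s t
      - diagSol q w (s + 2) t - diagSol q w s (t + 2)
termination_by s t => (t, s)

lemma diagSol_row_zero (q w : ℕ → ℕ → ℝ) (s : ℕ) : diagSol q w s 0 = 0 := by
  unfold diagSol; rfl

lemma diagSol_row_one (q w : ℕ → ℕ → ℝ) (s : ℕ) : diagSol q w s 1 = 0 := by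
  rw [diagSol]

lemma diagSol_left (q w : ℕ → ℕ → ℝ) {e : ℕ} (he : e < 2) (t : ℕ) :
    diagSol q w e (t + 2) = w e (t + 2) := by
  interval_cases e <;> · rw [diagSol]

lemma diagSol_succ (q w : ℕ → ℕ → ℝ) (s t : ℕ) :
    diagSol q w (s + 2) (t + 2) = q (s + 1) (t + 1) * diagSol q w (s + 1) (t + 1)
      - diagSol q w s t - diagSol q w (s + 2) t - diagSol q w s (t + 2) := by
  rw [diagSol]

/-- Induction along the recursion defining `diagSol`. -/
lemma diagSol_induction {motive : ℕ → ℕ → Prop} (h0 : ∀ s, motive s 0) (h1 : ∀ s, motive s 1)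
    (h2 : ∀ e < 2, ∀ t, motive e (t + 2))
    (h3 : ∀ s t, motive (s + 1) (t + 1) → motive s t → motive (s + 2) t → motive s (t + 2) →
      motive (s + 2) (t + 2)) (s t : ℕ) : motive s t := by
  induction t using Nat.strong_induction_on generalizing s with
  | _ t iht =>
    induction s using Nat.strong_induction_on with
    | _ s ihs =>
      match s, t, iht, ihs with
      | s, 0, _, _ => exact h0 s
      | s, 1, _, _ => exact h1 s
      | 0, t + 2, _, _ => exact h2 0 (by omega) t
      | 1, t + 2, _, _ => exact h2 1 (by omega) t
      | s + 2, t + 2, iht, ihs =>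
        exact h3 s t (iht _ (by omega) _) (iht _ (by omega) _) (iht _ (by omega) _)
          (ihs _ (by omega))

lemma diagEq_diagSol (a b : ℕ) (q w : ℕ → ℕ → ℝ) :
    DiagEq a b q (fun _ _ => 0) (diagSol q w) := by
  intro s t _ _
  rw [diagSol_succ]; ring

lemma measurable_diagSol {α : Type*} [MeasurableSpace α] {q : α → ℕ → ℕ → ℝ}
    (hq : ∀ s t, Measurable fun x => q x s t) (w : ℕ → ℕ → ℝ) (s t : ℕ) :
    Measurable fun x => diagSol (q x) w s t := by
  induction s, t using diagSol_induction with
  | h0 s => simp [diagSol_row_zero]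
  | h1 s => simp [diagSol_row_one]
  | h2 e he t => simp [diagSol_left _ _ he]
  | h3 s t i1 i2 i3 i4 =>
    simp only [diagSol_succ]
    exact ((((hq _ _).mul i1).sub i2).sub i3).sub i4

section Influence

variable {q q' w : ℕ → ℕ → ℝ} {σ τ : ℕ}

lemma diagSol_eq_of_le (h : ∀ s t, ¬(s = σ ∧ t = τ) → q' s t = q s t) (s t : ℕ) (hs : s ≤ σ) :
    diagSol q' w s t = diagSol q w s t := by
  induction s, t using diagSol_induction with
  | h0 s => simp [diagSol_row_zero]
  | h1 s => simp [diagSol_row_one]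
  | h2 e he t => simp [diagSol_left _ _ he]
  | h3 s t i1 i2 i3 i4 =>
    rw [diagSol_succ, diagSol_succ, i1 (by omega), i2 (by omega), i3 (by omega), i4 (by omega),
      h (s + 1) (t + 1) (by omega)]

lemma diagSol_eq_of_row_le (h : ∀ s t, ¬(s = σ ∧ t = τ) → q' s t = q s t) (s t : ℕ) (ht : t ≤ τ) :
    diagSol q' w s t = diagSol q w s t := by
  induction s, t using diagSol_induction with
  | h0 s => simp [diagSol_row_zero]
  | h1 s => simp [diagSol_row_one]
  | h2 e he t => simp [diagSol_left _ _ he]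
  | h3 s t i1 i2 i3 i4 =>
    rw [diagSol_succ, diagSol_succ, i1 (by omega), i2 (by omega), i3 (by omega), i4 (by omega),
      h (s + 1) (t + 1) (by omega)]

/-- Changing the potential at a single site `(σ, τ)` changes the solution in the column `σ + 1`
by an explicit amount, which only alternates in sign as the row increases. -/
lemma diagSol_influence (h : ∀ s t, ¬(s = σ ∧ t = τ) → q' s t = q s t) (hσ : 1 ≤ σ) (hτ : 1 ≤ τ)
    (j : ℕ) :
    diagSol q' w (σ + 1) (τ + 1 + 2 * j) = diagSol q w (σ + 1) (τ + 1 + 2 * j)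
      + (-1) ^ j * ((q' σ τ - q σ τ) * diagSol q w σ τ) := by
  obtain ⟨σ, rfl⟩ : ∃ k, σ = k + 1 := ⟨σ - 1, by omega⟩
  obtain ⟨τ, rfl⟩ : ∃ k, τ = k + 1 := ⟨τ - 1, by omega⟩
  have hle := diagSol_eq_of_le (w := w) h
  induction j with
  | zero =>
    simp only [mul_zero, add_zero, pow_zero, one_mul, add_assoc, Nat.reduceAdd]
    rw [diagSol_succ, diagSol_succ, hle _ _ le_rfl, hle σ _ (by omega), hle σ _ (by omega),
      diagSol_eq_of_row_le h (σ + 2) τ (by omega)]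
    ring
  | succ j ih =>
    have e : τ + 1 + 1 + 2 * (j + 1) = (τ + 2 + 2 * j) + 2 := by ring
    have e' : τ + 1 + 1 + 2 * j = τ + 2 + 2 * j := by ring
    rw [e'] at ih
    rw [e, show σ + 1 + 1 = σ + 2 by ring, diagSol_succ, diagSol_succ, hle _ _ le_rfl,
      hle σ _ (by omega), hle σ _ (by omega), show σ + 2 = σ + 1 + 1 by ring, ih,
      h (σ + 1) (τ + 2 + 2 * j + 1) (by omega)]
    ring

end Influence

/-! ### Local coordinates on tilted rectangles -/

/-- The lattice point with diagonal coordinates `x + y = c.1 + s` and `x - y = c.2 + t`. This is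
meaningful only if the two numbers have the same parity, see `EvenSite`. -/
def site (c : ℤ × ℤ) (s t : ℕ) : ℤ × ℤ :=
  ((c.1 + s + (c.2 + t)) / 2, (c.1 + s - (c.2 + t)) / 2)

/-- The local coordinates `(s, t)` relative to `c` belong to a lattice point. -/
def EvenSite (c : ℤ × ℤ) (s t : ℕ) : Prop := (c.1 + s + (c.2 + t)) % 2 = 0

lemma site_inj {c : ℤ × ℤ} {s t s' t' : ℕ} (h : EvenSite c s t) (h' : EvenSite c s' t')
    (e : site c s t = site c s' t') : s = s' ∧ t = t' := by
  simp only [EvenSite, site, Prod.mk.injEq] at *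
  omega

open Classical in
/-- A function on `ℤ²` in local coordinates, extended by zero to the coordinates that do not
belong to a lattice point. -/
noncomputable def localize (c : ℤ × ℤ) (φ : ℤ × ℤ → ℝ) (s t : ℕ) : ℝ :=
  if EvenSite c s t then φ (site c s t) else 0

lemma localize_of_even {c : ℤ × ℤ} {s t : ℕ} (h : EvenSite c s t) (φ : ℤ × ℤ → ℝ) :
    localize c φ s t = φ (site c s t) := if_pos h

lemma localize_of_odd {c : ℤ × ℤ} {s t : ℕ} (h : ¬ EvenSite c s t) (φ : ℤ × ℤ → ℝ) :
    localize c φ s t = 0 := if_neg h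

lemma abs_localize_le {c : ℤ × ℤ} {s t : ℕ} {φ : ℤ × ℤ → ℝ} {B : ℝ} (hB : 0 ≤ B)
    (h : EvenSite c s t → |φ (site c s t)| ≤ B) : |localize c φ s t| ≤ B := by
  unfold localize
  split_ifs with h'
  · exact h h'
  · simpa

lemma measurable_localize (c : ℤ × ℤ) (s t : ℕ) :
    Measurable fun φ : ℤ × ℤ → ℝ => localize c φ s t := by
  unfold localize
  split_ifs
  · exact measurable_pi_apply _
  · exact measurable_const

/-- The shifted potential `4 + W - E` in local coordinates. -/
noncomputable def localPot (c : ℤ × ℤ) (E : ℝ) (W : ℤ × ℤ → ℝ) : ℕ → ℕ → ℝ :=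
  localize c fun n => 4 + W n - E

lemma abs_localPot_le {c : ℤ × ℤ} {E M : ℝ} {W : ℤ × ℤ → ℝ} (hM : 0 ≤ M)
    (hE : E ∈ Set.Icc (-1) (9 + M)) (hW : ∀ n, W n ∈ Set.Icc 0 M) (s t : ℕ) :
    |localPot c E W s t| ≤ 5 + M := by
  refine abs_localize_le (by linarith) fun _ => abs_le.2 ⟨?_, ?_⟩ <;>
    linarith [hE.1, hE.2, (hW (site c s t)).1, (hW (site c s t)).2]

lemma localPot_update {c : ℤ × ℤ} {E x : ℝ} {W : ℤ × ℤ → ℝ} {σ τ : ℕ} (h : EvenSite c σ τ)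
    (s t : ℕ) (hst : ¬(s = σ ∧ t = τ)) :
    localPot c E (Function.update W (site c σ τ) x) s t = localPot c E W s t := by
  unfold localPot localize
  split_ifs with h'
  · have : site c s t ≠ site c σ τ := fun e => hst (site_inj h' h e)
    simp only [Function.update_of_ne this]
  · rfl

lemma localPot_update_self {c : ℤ × ℤ} {E x : ℝ} {W : ℤ × ℤ → ℝ} {σ τ : ℕ} (h : EvenSite c σ τ) :
    localPot c E (Function.update W (site c σ τ) x) σ τ = 4 + x - E := by
  simp [localPot, localize, h]

open Classical in
/-- The number of lattice points outside `F` in row `τ` of a tilted rectangle with `a + 1` columns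
and corner `c`, at which the modulus of `u` exceeds `T`. -/
noncomputable def rowExceed (c : ℤ × ℤ) (F : Set (ℤ × ℤ)) (a : ℕ) (T : ℝ) (u : ℕ → ℕ → ℝ)
    (τ : ℕ) : ℕ :=
  ((Finset.range (a + 1)).filter fun s => EvenSite c s τ ∧ site c s τ ∉ F ∧ T < |u s τ|).card

open Classical in
/-- The number of points of `F` in row `τ` of a tilted rectangle with `a + 1` columns and
corner `c`. -/
noncomputable def rowCount (c : ℤ × ℤ) (F : Set (ℤ × ℤ)) (a : ℕ) (τ : ℕ) : ℕ :=
  ((Finset.range (a + 1)).filter fun s => EvenSite c s τ ∧ site c s τ ∈ F).card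

/-! ### Unlikely smallness for fixed data -/

/-- Truncation to the interval `[0, M]`. -/
def clampTo (M x : ℝ) : ℝ := max 0 (min M x)

lemma clampTo_mem {M : ℝ} (hM : 0 ≤ M) (x : ℝ) : clampTo M x ∈ Set.Icc 0 M :=
  ⟨le_max_left _ _, max_le hM (min_le_left _ _)⟩

lemma clampTo_of_mem {M x : ℝ} (hx : x ∈ Set.Icc 0 M) : clampTo M x = x := by
  rw [clampTo, min_eq_right hx.2, max_eq_right hx.1]

lemma measurable_clampTo (M : ℝ) : Measurable (clampTo M) :=
  measurable_const.max (measurable_const.min measurable_id)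

lemma le_card_columns {a e : ℕ} (he : e < 2) :
    (a - 1) / 2 ≤ ((Finset.range (a + 1)).filter fun s => 1 ≤ s ∧ s + 1 ≤ a ∧ s % 2 = e).card := by
  have : ((Finset.range ((a - 1) / 2)).image fun k => 2 * k + (2 - e)) ⊆
      (Finset.range (a + 1)).filter fun s => 1 ≤ s ∧ s + 1 ≤ a ∧ s % 2 = e := by
    intro s hs
    simp only [Finset.mem_image, Finset.mem_range, Finset.mem_filter] at *
    obtain ⟨k, hk, rfl⟩ := hs
    omega
  have h := Finset.card_le_card this
  rwa [Finset.card_image_of_injective _ (fun k k' h => by simp at h; omega), Finset.card_range] at h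

/-- A potential on `ℤ²` with independent values in `[0, M]`, which are anti-concentrated
(uniformly, around every real number) off the set `F`. -/
structure IsTame {Ω : Type*} [MeasurableSpace Ω] (P : Measure Ω) (M γ ρ : ℝ) (F : Set (ℤ × ℤ))
    (W : ℤ × ℤ → Ω → ℝ) : Prop where
  measurable : ∀ n, Measurable (W n)
  indep : iIndepFun W P
  mem_Icc : ∀ n ω, W n ω ∈ Set.Icc 0 M
  anti : ∀ n ∉ F, ∀ t, ρ ≤ P.real {ω | γ / 2 < |W n ω - t|}

/-- For fixed left data which are at least `N` somewhere, it is exponentially unlikely that the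
solution is small at most points off `F` of the two highest rows. -/
lemma measure_rowExceed_le {Ω : Type*} [MeasurableSpace Ω] {P : Measure Ω} [IsProbabilityMeasure P]
    {M γ ρ : ℝ} {F : Set (ℤ × ℤ)} {W : ℤ × ℤ → Ω → ℝ} (hW : IsTame P M γ ρ F W)
    (hM : 0 ≤ M) (hγ : 0 < γ) (hρ : 0 ≤ ρ) (hρ1 : ρ ≤ 1) {E : ℝ} (hE : E ∈ Set.Icc (-1) (9 + M))
    {c : ℤ × ℤ} {a b m : ℕ} {A N T : ℝ} (hA : 2 * (5 + M + 3) * (a + 1) ≤ A) (ha : 8 ≤ a)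
    (hm : 16 * m ≤ a) (hF : ∀ t ≤ b, rowCount c F a t ≤ m) (hT : 0 < T)
    (hN : 4 * T * A ^ b ≤ N * γ) (hN2 : 2 * T < N) {w : ℕ → ℕ → ℝ}
    (hodd : ∀ e t, ¬ EvenSite c e t → w e t = 0)
    (hw : ∃ t, t + 2 ≤ b ∧ ∃ e < 2, N ≤ |w e (t + 2)|) :
    P {ω | rowExceed c F a T (diagSol (localPot c E fun n => W n ω) w) (b - 1) ≤ m ∧
        rowExceed c F a T (diagSol (localPot c E fun n => W n ω) w) b ≤ m}
      ≤ ENNReal.ofReal (2 ^ m * Real.exp (-(ρ * a / 8))) := by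
  classical
  have haR : (8 : ℝ) ≤ a := by exact_mod_cast ha
  have hA1 : 1 ≤ A := by nlinarith
  have hA0 : 0 < A := by linarith
  have hN0 : 0 < N := by linarith
  set η := N / A ^ b with hη
  have hη0 : 0 < η := by positivity
  have hAb : η * A ^ b = N := by rw [hη]; field_simp
  have hex : ∃ t, t + 2 ≤ b ∧ ∃ e < 2, η * A ^ (t + 2) ≤ |w e (t + 2)| := by
    obtain ⟨t, ht, e, he, h⟩ := hw
    refine ⟨t, ht, e, he, le_trans ?_ h⟩
    rw [← hAb]
    gcongr
  obtain ⟨τ, ⟨hτb, e, he, hτ⟩, hmin⟩ : ∃ τ, (τ + 2 ≤ b ∧ ∃ e < 2, η * A ^ (τ + 2) ≤ |w e (τ + 2)|) ∧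
      ∀ t < τ, ¬(t + 2 ≤ b ∧ ∃ e < 2, η * A ^ (t + 2) ≤ |w e (t + 2)|) :=
    ⟨Nat.find hex, Nat.find_spec hex, fun t => Nat.find_min hex⟩
  have hwne : w e (τ + 2) ≠ 0 := by
    intro h
    rw [h, abs_zero] at hτ
    have : 0 < η * A ^ (τ + 2) := by positivity
    linarith
  have heven : EvenSite c e (τ + 2) := by
    by_contra h
    exact hwne (hodd _ _ h)
  -- Lower bound for the solution on the row `τ + 2`, for every bounded potential.
  have hrow : ∀ V : ℤ × ℤ → ℝ, (∀ n, V n ∈ Set.Icc 0 M) → ∀ k, e + 2 * k ≤ a →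
      η * A ^ (τ + 2) / 2 ≤ |diagSol (localPot c E V) w (e + 2 * k) (τ + 2)| := by
    intro V hV
    refine (diagEq_diagSol a b _ w).row_lower_bound (abs_localPot_le hM hE hV) hA hη0
      (fun s _ => ⟨diagSol_row_zero _ _ _, diagSol_row_one _ _ _⟩) (by omega) hτb ?_ ?_
    · rwa [diagSol_left _ _ he]
    · intro t ht e' he'
      match t with
      | 0 => rw [diagSol_row_zero]; simp; positivity
      | 1 => rw [diagSol_row_one]; simp; positivity
      | t + 2 =>
        rw [diagSol_left _ _ he']
        by_contra hc
        exact hmin t (by omega) ⟨by omega, e', he', (not_le.1 hc).le⟩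
  have hcard := le_card_columns (a := a) he
  set S₀ := (Finset.range (a + 1)).filter fun s => 1 ≤ s ∧ s + 1 ≤ a ∧ s % 2 = e with hS₀
  have hS₀e : ∀ s ∈ S₀, EvenSite c s (τ + 2) := by
    intro s hs
    have := (Finset.mem_filter.1 hs).2
    unfold EvenSite at *
    omega
  by_cases hlast : τ + 2 = b
  · -- The large row is the highest one: it has too many large values, whatever the potential is.
    refine le_of_eq_of_le (measure_mono_null (t := ∅) ?_ measure_empty) zero_le
    rintro ω ⟨-, h2⟩
    exfalso
    have hF' := hF b le_rfl
    unfold rowExceed at h2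
    unfold rowCount at hF'
    have hsub : S₀ ⊆ ((Finset.range (a + 1)).filter fun s => EvenSite c s b ∧ site c s b ∈ F) ∪
        (Finset.range (a + 1)).filter fun s => EvenSite c s b ∧ site c s b ∉ F ∧
          T < |diagSol (localPot c E fun n => W n ω) w s b| := by
      intro s hs
      have hse := hS₀e s hs
      rw [hlast] at hse
      have hs' := Finset.mem_filter.1 hs
      have hval := hrow (fun n => W n ω) (fun n => hW.mem_Icc n ω) (s / 2) (by omega)
      rw [show e + 2 * (s / 2) = s by omega, hlast, hAb] at hval
      simp only [Finset.mem_union, Finset.mem_filter]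
      by_cases hsF : site c s b ∈ F
      · exact Or.inl ⟨hs'.1, hse, hsF⟩
      · exact Or.inr ⟨hs'.1, hse, hsF, by linarith⟩
    have := (Finset.card_le_card hsub).trans (Finset.card_union_le _ _)
    omega
  -- The row among the two highest ones which is influenced by the potential on row `τ + 2`.
  obtain ⟨j, hj⟩ : ∃ j, τ + 2 + 1 + 2 * j = b - 1 ∨ τ + 2 + 1 + 2 * j = b := by
    refine ⟨(b - (τ + 3)) / 2, ?_⟩
    omega
  set top := τ + 2 + 1 + 2 * j with htop
  have htopb : top ≤ b := by omega
  set S := S₀.filter fun s => site c s (τ + 2) ∉ F ∧ site c (s + 1) top ∉ F with hS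
  have hSe : ∀ s ∈ S, EvenSite c s (τ + 2) := fun s hs => hS₀e s (Finset.mem_filter.1 hs).1
  have hSt : ∀ s ∈ S₀, EvenSite c (s + 1) top := by
    intro s hs
    have := hS₀e s hs
    unfold EvenSite at *
    push_cast [htop] at *
    omega
  have hScard : a ≤ 4 * S.card := by
    have h1 := hF (τ + 2) hτb
    have h2 := hF top htopb
    unfold rowCount at h1 h2
    have hsub : S₀ ⊆ S ∪ (((Finset.range (a + 1)).filter fun s =>
        EvenSite c s (τ + 2) ∧ site c s (τ + 2) ∈ F) ∪
        ((Finset.range (a + 1)).filter fun s =>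
          EvenSite c s top ∧ site c s top ∈ F).image fun s => s - 1) := by
      intro s hs
      have hs' := Finset.mem_filter.1 hs
      simp only [Finset.mem_union, hS, Finset.mem_filter, Finset.mem_image]
      by_cases g1 : site c s (τ + 2) ∈ F
      · exact Or.inr (Or.inl ⟨hs'.1, hS₀e s hs, g1⟩)
      by_cases g2 : site c (s + 1) top ∈ F
      · refine Or.inr (Or.inr ⟨s + 1, ⟨?_, hSt s hs, g2⟩, by omega⟩)
        have := hs'.2.2.1
        simp; omega
      · exact Or.inl ⟨hs, g1, g2⟩
    have h3 := ((Finset.card_le_card hsub).trans (Finset.card_union_le _ _)).trans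
      (Nat.add_le_add_left ((Finset.card_union_le _ _).trans
        (Nat.add_le_add_left Finset.card_image_le _)) _)
    omega
  -- The value in column `s + 1` of the row `top` depends on the potential at `p s`, but not on the
  -- potential at `p s'` for `s' > s`. The truncation makes the growth bounds hold for every `V`.
  let p : ℕ → ℤ × ℤ := fun s => site c s (τ + 2)
  let Z : ℕ → (ℤ × ℤ → ℝ) → ℝ := fun s V =>
    diagSol (localPot c E fun n => clampTo M (V n)) w (s + 1) top
  have hZ : ∀ s, Measurable (Z s) := fun s => measurable_diagSol
    (fun s t => (measurable_localize c s t).comp (measurable_pi_lambda _ fun n =>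
      (((measurable_clampTo M).comp (measurable_pi_apply n)).const_add 4).sub_const E)) w _ _
  have hclamp : ∀ (V : ℤ × ℤ → ℝ) i x, (fun n => clampTo M (Function.update V i x n))
      = Function.update (fun n => clampTo M (V n)) i (clampTo M x) := by
    intro V i x
    funext n
    by_cases h : n = i
    · subst h; simp
    · simp [h]
  have key := measure_card_exceed_le P hW.measurable hW.indep (ρ := ρ) (T := T) p Z hZ S
    (by
      intro s hs s' hs' hlt V x
      simp only [Z, p, hclamp]
      exact diagSol_eq_of_le (fun s t h => localPot_update (hSe s' hs') s t h) _ _ (by omega))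
    (by
      intro s hs V
      have hsS := (Finset.mem_filter.1 hs)
      have hs0 := Finset.mem_filter.1 hsS.1
      set V' := fun n => clampTo M (V n) with hV'
      have hV'm : ∀ n, V' n ∈ Set.Icc 0 M := fun n => clampTo_mem hM _
      set κ := diagSol (localPot c E V') w s (τ + 2) with hκ
      have hval := hrow V' hV'm (s / 2) (by omega)
      rw [show e + 2 * (s / 2) = s by omega, ← hκ] at hval
      have hκT : 2 * T ≤ |κ| * γ := by
        have h1 : η * 1 ≤ η * A ^ (τ + 2) := by
          gcongr
          exact one_le_pow₀ hA1
        have h2 : 4 * T ≤ η * γ := by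
          rw [hη, div_mul_eq_mul_div, le_div_iff₀ (by positivity)]
          exact hN
        nlinarith
      have hκ0 : 0 < |κ| := by
        have : 0 < η * A ^ (τ + 2) / 2 := by positivity
        linarith
      set d := (-1) ^ j * (diagSol (localPot c E V') w (s + 1) top
        + (-1) ^ j * ((4 - E - localPot c E V' s (τ + 2)) * κ)) with hd
      refine (hW.anti (p s) hsS.2.1 (-(d / κ))).trans (measureReal_mono ?_ (by finiteness))
      intro ω hω
      simp only [Set.mem_ofPred_eq] at hω ⊢
      have hinf : Z s (Function.update V (p s) (W (p s) ω))
          = (-1) ^ j * (W (p s) ω * κ + d) := by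
        simp only [Z, hclamp, clampTo_of_mem (hW.mem_Icc (p s) ω)]
        rw [htop, diagSol_influence (σ := s) (τ := τ + 2) (q := localPot c E V')
          (fun s' t' h => localPot_update (hSe s hs) s' t' h) (by omega) (by omega),
          localPot_update_self (hSe s hs), ← hκ, hd, ← htop]
        have : ((-1 : ℝ) ^ j) * (-1) ^ j = 1 := by
          rw [← mul_pow]; norm_num
        linear_combination (-(diagSol (localPot c E V') w (s + 1) top) -
          (-1) ^ j * ((4 - E - localPot c E V' s (τ + 2)) * κ)) * this
      have hκne : κ ≠ 0 := abs_pos.1 hκ0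
      rw [hinf, abs_mul, abs_pow, abs_neg, abs_one, one_pow, one_mul,
        show W (p s) ω * κ + d = κ * (W (p s) ω - -(d / κ)) by field_simp; ring, abs_mul]
      nlinarith)
    m
  have hmono : {ω | rowExceed c F a T (diagSol (localPot c E fun n => W n ω) w) (b - 1) ≤ m ∧
      rowExceed c F a T (diagSol (localPot c E fun n => W n ω) w) b ≤ m}
      ⊆ {ω | (S.filter fun s => T < |Z s (fun k => W k ω)|).card ≤ m} := by
    rintro ω ⟨h1, h2⟩
    have h3 : rowExceed c F a T (diagSol (localPot c E fun n => W n ω) w) top ≤ m := by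
      rcases hj with h | h <;> rw [h] <;> assumption
    refine le_trans ?_ h3
    have hinj : Set.InjOn (fun s : ℕ => s + 1) (S.filter fun s => T < |Z s (fun k => W k ω)|) :=
      fun x _ y _ h => by simpa using h
    rw [← Finset.card_image_of_injOn hinj]
    refine Finset.card_le_card ?_
    intro s' hs'
    obtain ⟨s, hs, rfl⟩ := Finset.mem_image.1 hs'
    obtain ⟨hsS, hsT⟩ := Finset.mem_filter.1 hs
    obtain ⟨hs0, -, hsF⟩ := Finset.mem_filter.1 hsS
    have hs1 := (Finset.mem_filter.1 hs0).2
    refine Finset.mem_filter.2 ⟨by simp; omega, hSt s hs0, hsF, ?_⟩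
    simpa only [Z, clampTo_of_mem (hW.mem_Icc _ ω)] using hsT
  refine (measure_mono hmono).trans (key.trans ?_)
  rw [← ENNReal.ofReal_pow (by linarith), show (2 : ENNReal) ^ m = ENNReal.ofReal (2 ^ m) by
    rw [ENNReal.ofReal_pow (by norm_num)]; simp, ← ENNReal.ofReal_mul (by positivity)]
  refine ENNReal.ofReal_le_ofReal ?_
  gcongr
  have h1 : 1 - ρ / 2 ≤ Real.exp (-(ρ / 2)) := by
    have := Real.add_one_le_exp (-(ρ / 2)); linarith
  have hSR : (a : ℝ) ≤ 4 * S.card := by exact_mod_cast hScard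
  calc (1 - ρ / 2) ^ S.card ≤ Real.exp (-(ρ / 2)) ^ S.card := by
        gcongr
        linarith
    _ = Real.exp (-(ρ / 2) * S.card) := by rw [← Real.exp_nat_mul]; ring_nf
    _ ≤ Real.exp (-(ρ * a / 8)) := by
        apply Real.exp_le_exp.2
        nlinarith

/-! ### Inflation through a thin rectangle is unlikely -/

/-- A solution `u` with small values on the two lowest rows and a large value somewhere is, after
rescaling, close to a solution for the potential `q'` with integer left data of size exactly `N`;
large values of the latter come from large values of `u`. -/
lemma DiagEq.exists_int_data {a b N : ℕ} {q q' u : ℕ → ℕ → ℝ} {A B δ : ℝ}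
    (hu : DiagEq a b q (fun _ _ => 0) u) (hq : ∀ s t, |q s t| ≤ B) (hq' : ∀ s t, |q' s t| ≤ B)
    (hA : 2 * (B + 3) * (a + 1) ≤ A) (hN : 1 ≤ N) (hδ : ∀ s t, |q s t - q' s t| ≤ δ)
    (hδN : δ * (N * A ^ b) ≤ 1) (hbot : ∀ s ≤ a, |u s 0| ≤ 1 ∧ |u s 1| ≤ 1) (ha : 1 ≤ a)
    (hbig : ∃ s ≤ a, ∃ t ≤ b, N * A ^ b < |u s t|) :
    ∃ w : ℕ → ℕ → ℤ, (∀ e t, |w e t| ≤ N) ∧ (∀ e t, u e t = 0 → w e t = 0) ∧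
      (∃ t, t + 2 ≤ b ∧ ∃ e < 2, (N : ℤ) ≤ |w e (t + 2)|) ∧
      ∀ s ≤ a, ∀ t ≤ b, 2 * A ^ b < |diagSol q' (fun e t => (w e t : ℝ)) s t| → 1 < |u s t| := by
  classical
  have hB : 0 ≤ B := (abs_nonneg _).trans (hq 0 0)
  have hA1 : 1 ≤ A := by nlinarith [Nat.cast_nonneg (α := ℝ) a]
  have hNR : (1 : ℝ) ≤ N := by exact_mod_cast hN
  have hAb : (1 : ℝ) ≤ A ^ b := one_le_pow₀ hA1
  have hpow : ∀ t ≤ b, A ^ t ≤ A ^ b := fun t ht => pow_le_pow_right₀ hA1 ht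
  obtain ⟨⟨e₀, t₀⟩, hmem, hmax⟩ := Finset.exists_max_image
    (Finset.range 2 ×ˢ Finset.range (b + 1)) (fun z : ℕ × ℕ => |u z.1 z.2|) ⟨(0, 0), by simp⟩
  simp only [Finset.mem_product, Finset.mem_range, and_imp, Prod.forall] at hmem hmax
  set μ := |u e₀ t₀| with hμ
  have hleft : ∀ t ≤ b, |u 0 t| ≤ μ ∧ |u 1 t| ≤ μ := fun t ht =>
    ⟨hmax 0 t (by omega) (by omega), hmax 1 t (by omega) (by omega)⟩
  have hμN : N < μ := by
    by_contra hc
    push Not at hc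
    obtain ⟨s, hs, t, ht, hst⟩ := hbig
    have := hu.apriori_bound hq hA (μ := N) (fun _ _ _ _ => by simp)
      (fun s hs => ⟨(hbot s hs).1.trans hNR, (hbot s hs).2.trans hNR⟩)
      (fun t ht => ⟨(hleft t ht).1.trans hc, (hleft t ht).2.trans hc⟩) t ht s hs
    have h2 := mul_le_mul_of_nonneg_left (hpow t ht) (by linarith : (0 : ℝ) ≤ N)
    linarith
  have hμ1 : 1 ≤ μ := by linarith
  have hμ0 : 0 < μ := by linarith
  have hub : ∀ t ≤ b, ∀ s ≤ a, |u s t| ≤ μ * A ^ b := fun t ht s hs =>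
    (hu.apriori_bound hq hA (μ := μ) (fun _ _ _ _ => by simp; linarith)
      (fun s hs => ⟨(hbot s hs).1.trans hμ1, (hbot s hs).2.trans hμ1⟩) hleft t ht s hs).trans
      (mul_le_mul_of_nonneg_left (hpow t ht) hμ0.le)
  set lam : ℝ := N / μ with hlam
  have hlam0 : 0 < lam := by positivity
  have hlam1 : lam ≤ 1 := (div_le_one hμ0).2 hμN.le
  have hlamμ : lam * μ = N := by rw [hlam]; field_simp
  set w : ℕ → ℕ → ℤ := fun e t => if e < 2 ∧ t ≤ b then ⌊lam * u e t⌋ else 0 with hw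
  have hwl : ∀ e < 2, ∀ t ≤ b, |lam * u e t - w e t| ≤ 1 := by
    intro e he t ht
    simp only [hw, he, ht, and_self, if_true]
    rw [abs_le]
    constructor <;> linarith [Int.floor_le (lam * u e t), Int.lt_floor_add_one (lam * u e t)]
  have hmain : ∀ t ≤ b, ∀ s ≤ a,
      |lam * u s t - diagSol q' (fun e t => (w e t : ℝ)) s t| ≤ 1 * A ^ t := by
    refine DiagEq.apriori_bound (q := q')
      (r := fun s t => lam * ((q (s + 1) (t + 1) - q' (s + 1) (t + 1)) * u (s + 1) (t + 1)))
      (u := fun s t => lam * u s t - diagSol q' (fun e t => (w e t : ℝ)) s t)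
      ?_ hq' hA ?_ ?_ ?_
    · intro s t hs ht
      have h1 := hu s t hs ht
      have h2 := diagEq_diagSol a b q' (fun e t => (w e t : ℝ)) s t hs ht
      simp only [add_zero] at h1 h2
      linear_combination lam * h1 - h2
    · intro s t hs ht
      rw [abs_mul, abs_mul, abs_of_pos hlam0]
      calc lam * (|q (s + 1) (t + 1) - q' (s + 1) (t + 1)| * |u (s + 1) (t + 1)|)
          ≤ lam * (δ * (μ * A ^ b)) := by
            have h0 : 0 ≤ δ := (abs_nonneg _).trans (hδ 0 0)
            gcongr
            · exact hδ _ _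
            · exact hub _ (by omega) _ (by omega)
        _ = δ * (lam * μ * A ^ b) := by ring
        _ ≤ 1 := by rw [hlamμ]; exact hδN
    · intro s hs
      rw [diagSol_row_zero, diagSol_row_one, sub_zero, sub_zero, abs_mul, abs_mul,
        abs_of_pos hlam0]
      exact ⟨mul_le_one₀ hlam1 (abs_nonneg _) (hbot s hs).1,
        mul_le_one₀ hlam1 (abs_nonneg _) (hbot s hs).2⟩
    · have : ∀ e < 2, ∀ t ≤ b, |lam * u e t - diagSol q' (fun e t => (w e t : ℝ)) e t| ≤ 1 := by
        intro e he t ht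
        match t with
        | 0 =>
          rw [diagSol_row_zero, sub_zero, abs_mul, abs_of_pos hlam0]
          exact mul_le_one₀ hlam1 (abs_nonneg _) (hbot e (by omega)).1
        | 1 =>
          rw [diagSol_row_one, sub_zero, abs_mul, abs_of_pos hlam0]
          exact mul_le_one₀ hlam1 (abs_nonneg _) (hbot e (by omega)).2
        | t + 2 =>
          rw [diagSol_left _ _ he]
          exact hwl e he _ ht
      exact fun t ht => ⟨this 0 (by omega) t ht, this 1 (by omega) t ht⟩
  refine ⟨w, ?_, ?_, ?_, ?_⟩
  · intro e t
    simp only [hw]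
    split_ifs with h
    · have h1 : |lam * u e t| ≤ N := by
        rw [abs_mul, abs_of_pos hlam0, ← hlamμ]
        gcongr
        exact hmax e t h.1 (by omega)
      obtain ⟨h2, h3⟩ := abs_le.1 h1
      rw [abs_le]
      constructor
      · exact Int.le_floor.2 (by push_cast; linarith)
      · exact_mod_cast (Int.floor_le (lam * u e t)).trans h3
    · simp
  · intro e t h
    simp [hw, h]
  · have ht₀ : 2 ≤ t₀ := by
      by_contra hc
      have : t₀ = 0 ∨ t₀ = 1 := by omega
      rcases this with h | h <;> rw [h] at hμ
      · linarith [(hbot e₀ (by omega)).1]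
      · linarith [(hbot e₀ (by omega)).2]
    refine ⟨t₀ - 2, by omega, e₀, hmem.1, ?_⟩
    rw [show t₀ - 2 + 2 = t₀ by omega]
    have h1 : |lam * u e₀ t₀| = N := by rw [abs_mul, abs_of_pos hlam0, ← hμ, hlamμ]
    simp only [hw, hmem.1, (by omega : t₀ ≤ b), and_self, if_true]
    -- The rescaled maximal value is exactly `N` or `-N`, so that rounding does not change it.
    rcases (abs_eq (by positivity)).1 h1 with h | h <;> rw [h]
    · simp
    · rw [show (-(N : ℝ)) = ((-(N : ℤ) : ℤ) : ℝ) by simp, Int.floor_intCast, abs_neg]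
      exact le_abs_self _
  · intro s hs t ht h
    by_contra hc
    push Not at hc
    have h1 : |lam * u s t| ≤ 1 := by
      rw [abs_mul, abs_of_pos hlam0]
      exact mul_le_one₀ hlam1 (abs_nonneg _) hc
    have h2 := hmain t ht s hs
    have h3 := hpow t ht
    have h4 := abs_sub_abs_le_abs_sub (diagSol q' (fun e t => (w e t : ℝ)) s t) (lam * u s t)
    rw [abs_sub_comm] at h4
    linarith

lemma schrodinger_site {c : ℤ × ℤ} {E : ℝ} {W φ : ℤ × ℤ → ℝ} {s t : ℕ} (h : EvenSite c s t)
    (he : schrodinger W φ (site c (s + 1) (t + 1)) = E * φ (site c (s + 1) (t + 1))) :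
    φ (site c (s + 2) (t + 2)) + φ (site c s t) + φ (site c (s + 2) t) + φ (site c s (t + 2))
      = (4 + W (site c (s + 1) (t + 1)) - E) * φ (site c (s + 1) (t + 1)) := by
  unfold EvenSite at h
  have e1 : site c (s + 2) (t + 2)
      = ((site c (s + 1) (t + 1)).1 + 1, (site c (s + 1) (t + 1)).2) := by
    simp only [site, Prod.mk.injEq]; push_cast; omega
  have e2 : site c s t = ((site c (s + 1) (t + 1)).1 - 1, (site c (s + 1) (t + 1)).2) := by
    simp only [site, Prod.mk.injEq]; push_cast; omega
  have e3 : site c (s + 2) t = ((site c (s + 1) (t + 1)).1, (site c (s + 1) (t + 1)).2 + 1) := by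
    simp only [site, Prod.mk.injEq]; push_cast; omega
  have e4 : site c s (t + 2) = ((site c (s + 1) (t + 1)).1, (site c (s + 1) (t + 1)).2 - 1) := by
    simp only [site, Prod.mk.injEq]; push_cast; omega
  rw [e1, e2, e3, e4]
  unfold schrodinger laplacian at he
  linarith

lemma diagEq_localize {c : ℤ × ℤ} {a b : ℕ} {E : ℝ} {W φ : ℤ × ℤ → ℝ}
    (h : ∀ s t, s + 2 ≤ a → t + 2 ≤ b → EvenSite c s t →
      schrodinger W φ (site c (s + 1) (t + 1)) = E * φ (site c (s + 1) (t + 1))) :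
    DiagEq a b (localPot c E W) (fun _ _ => 0) (localize c φ) := by
  intro s t hs ht
  by_cases hst : EvenSite c s t
  · have p1 : EvenSite c (s + 2) (t + 2) := by unfold EvenSite at *; push_cast; omega
    have p2 : EvenSite c (s + 2) t := by unfold EvenSite at *; push_cast; omega
    have p3 : EvenSite c s (t + 2) := by unfold EvenSite at *; push_cast; omega
    have p4 : EvenSite c (s + 1) (t + 1) := by unfold EvenSite at *; push_cast; omega
    rw [localPot, localize_of_even p1, localize_of_even p2, localize_of_even p3,
      localize_of_even hst, localize_of_even p4, localize_of_even p4, add_zero]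
    exact schrodinger_site hst (h s t hs ht hst)
  · have p1 : ¬ EvenSite c (s + 2) (t + 2) := by unfold EvenSite at *; push_cast; omega
    have p2 : ¬ EvenSite c (s + 2) t := by unfold EvenSite at *; push_cast; omega
    have p3 : ¬ EvenSite c s (t + 2) := by unfold EvenSite at *; push_cast; omega
    have p4 : ¬ EvenSite c (s + 1) (t + 1) := by unfold EvenSite at *; push_cast; omega
    rw [localPot, localize_of_odd p1, localize_of_odd p2, localize_of_odd p3,
      localize_of_odd hst, localize_of_odd p4, localize_of_odd p4]
    simp

/-- No inflation in the tilted rectangle with corner `c`, columns `0, …, a` and rows `0, …, b`: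
a generalized eigenfunction with energy very close to `Ebar`, which is bounded by `1` on the two
lowest rows, and on the two highest rows at all but `m` points off `F`, is bounded by `A ^ (4 * b)`
on the whole rectangle. -/
def NoInflation (A : ℕ) (Ebar : ℝ) (m : ℕ) (W : ℤ × ℤ → ℝ) (F : Set (ℤ × ℤ)) (c : ℤ × ℤ)
    (a b : ℕ) : Prop :=
  ∀ (E : ℝ) (φ : ℤ × ℤ → ℝ), |E - Ebar| ≤ ((A : ℝ) ^ (4 * b))⁻¹ →
    (∀ s t, s + 2 ≤ a → t + 2 ≤ b → EvenSite c s t →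
      schrodinger W φ (site c (s + 1) (t + 1)) = E * φ (site c (s + 1) (t + 1))) →
    (∀ s ≤ a, |localize c φ s 0| ≤ 1 ∧ |localize c φ s 1| ≤ 1) →
    rowExceed c F a 1 (localize c φ) (b - 1) ≤ m → rowExceed c F a 1 (localize c φ) b ≤ m →
    ∀ s ≤ a, ∀ t ≤ b, |localize c φ s t| ≤ (A : ℝ) ^ (4 * b)

/-- Left data of a tilted rectangle, as a function of all local coordinates. -/
def extendData (b : ℕ) (g : Fin 2 × Fin (b + 1) → ℤ) (e t : ℕ) : ℤ :=
  if h : e < 2 ∧ t < b + 1 then g (⟨e, h.1⟩, ⟨t, h.2⟩) else 0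

lemma diagSol_congr {q w w' : ℕ → ℕ → ℝ} {b : ℕ} (h : ∀ e < 2, ∀ t ≤ b, w e t = w' e t) (s t : ℕ)
    (ht : t ≤ b) : diagSol q w s t = diagSol q w' s t := by
  induction s, t using diagSol_induction with
  | h0 s => simp [diagSol_row_zero]
  | h1 s => simp [diagSol_row_one]
  | h2 e he t => simp [diagSol_left _ _ he, h e he _ ht]
  | h3 s t i1 i2 i3 i4 =>
    rw [diagSol_succ, diagSol_succ, i1 (by omega), i2 (by omega), i3 (by omega), i4 (by omega)]

/-- Failure of `NoInflation` forces the event of `measure_rowExceed_le`, for the fixed energy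
`Ebar` and one of finitely many integer left data. -/
lemma exists_data_of_not_noInflation {A a b m : ℕ} {M Ebar : ℝ} {W : ℤ × ℤ → ℝ}
    {F : Set (ℤ × ℤ)} {c : ℤ × ℤ} (hM : 0 ≤ M) (hW : ∀ n, W n ∈ Set.Icc 0 M)
    (hE : Ebar ∈ Set.Icc 0 (8 + M)) (hA : 2 * (5 + M + 3) * ((a : ℝ) + 1) ≤ A) (ha : 1 ≤ a)
    (h : ¬ NoInflation A Ebar m W F c a b) :
    ∃ g : Fin 2 × Fin (b + 1) → ℤ, (∀ z, |g z| ≤ (A ^ (3 * b) : ℕ)) ∧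
      (∀ e t, ¬ EvenSite c e t → extendData b g e t = 0) ∧
      (∃ t, t + 2 ≤ b ∧ ∃ e < 2, ((A ^ (3 * b) : ℕ) : ℤ) ≤ |extendData b g e (t + 2)|) ∧
      rowExceed c F a (2 * (A : ℝ) ^ b)
        (diagSol (localPot c Ebar W) fun e t => (extendData b g e t : ℝ)) (b - 1) ≤ m ∧
      rowExceed c F a (2 * (A : ℝ) ^ b)
        (diagSol (localPot c Ebar W) fun e t => (extendData b g e t : ℝ)) b ≤ m := by
  classical
  unfold NoInflation at h
  push Not at h
  obtain ⟨E, φ, hEE, heq, hbot, ht1, ht2, s₀, hs₀, t₀, ht₀, hbig⟩ := h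
  have hA1 : (1 : ℝ) ≤ A := by nlinarith [Nat.cast_nonneg (α := ℝ) a]
  have hAN : 1 ≤ A := by exact_mod_cast hA1
  have hE1 : |E - Ebar| ≤ 1 := hEE.trans (inv_le_one_of_one_le₀ (one_le_pow₀ hA1))
  have hEI : E ∈ Set.Icc (-1) (9 + M) := by
    obtain ⟨h1, h2⟩ := abs_le.1 hE1
    constructor <;> linarith [hE.1, hE.2]
  have hEbI : Ebar ∈ Set.Icc (-1) (9 + M) := by constructor <;> linarith [hE.1, hE.2]
  obtain ⟨w, hw1, hw2, hw3, hw4⟩ := (diagEq_localize heq).exists_int_data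
    (N := A ^ (3 * b)) (abs_localPot_le hM hEI hW) (abs_localPot_le (c := c) hM hEbI hW) hA
    (Nat.one_le_pow _ _ hAN) (δ := |E - Ebar|)
    (fun s t => by
      by_cases hst : EvenSite c s t
      · simp only [localPot, localize, if_pos hst]
        rw [show 4 + W (site c s t) - E - (4 + W (site c s t) - Ebar) = -(E - Ebar) by ring,
          abs_neg]
      · simp [localPot, localize, if_neg hst])
    (by
      have e : ((A ^ (3 * b) : ℕ) : ℝ) * (A : ℝ) ^ b = (A : ℝ) ^ (4 * b) := by
        push_cast; rw [← pow_add]; congr 1; ring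
      rw [e]
      have : (0 : ℝ) < (A : ℝ) ^ (4 * b) := by positivity
      calc |E - Ebar| * (A : ℝ) ^ (4 * b) ≤ ((A : ℝ) ^ (4 * b))⁻¹ * (A : ℝ) ^ (4 * b) := by gcongr
        _ = 1 := inv_mul_cancel₀ this.ne')
    hbot ha ⟨s₀, hs₀, t₀, ht₀, by
      refine lt_of_eq_of_lt ?_ hbig
      push_cast; rw [← pow_add]; congr 1; ring⟩
  set g : Fin 2 × Fin (b + 1) → ℤ := fun z => w z.1 z.2 with hg
  have hgw : ∀ e < 2, ∀ t ≤ b, extendData b g e t = w e t := by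
    intro e he t ht
    simp [extendData, he, Nat.lt_succ_of_le ht, hg]
  have hex : ∀ τ ≤ b, rowExceed c F a (2 * (A : ℝ) ^ b)
      (diagSol (localPot c Ebar W) fun e t => (extendData b g e t : ℝ)) τ
      ≤ rowExceed c F a 1 (localize c φ) τ := by
    intro τ hτ
    refine Finset.card_le_card fun s hs => ?_
    obtain ⟨h1, h2, h3, h4⟩ := Finset.mem_filter.1 hs
    refine Finset.mem_filter.2 ⟨h1, h2, h3, hw4 s (by simpa [Nat.lt_succ_iff] using h1) τ hτ ?_⟩
    rwa [diagSol_congr (b := b) (w' := fun e t => (extendData b g e t : ℝ))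
      (fun e he t ht => by rw [hgw e he t ht]) s τ hτ]
  refine ⟨g, fun z => hw1 _ _, ?_, ?_, (hex _ (by omega)).trans ht1, (hex _ le_rfl).trans ht2⟩
  · intro e t het
    unfold extendData
    split_ifs with h
    · exact hw2 e t (localize_of_odd het φ)
    · rfl
  · obtain ⟨t, ht, e, he, h⟩ := hw3
    exact ⟨t, ht, e, he, by rwa [hgw e he _ ht]⟩

/-- Inflation through a sufficiently thin rectangle is exponentially unlikely in its length: the
entropy `A ^ (16 * b ^ 2)` of the left data is beaten by `measure_rowExceed_le`. -/
lemma measure_not_noInflation_le {Ω : Type*} [MeasurableSpace Ω] {P : Measure Ω}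
    [IsProbabilityMeasure P] {M γ ρ : ℝ} {F : Set (ℤ × ℤ)} {W : ℤ × ℤ → Ω → ℝ}
    (hW : IsTame P M γ ρ F W) (hM : 0 ≤ M) (hγ : 0 < γ) (hρ : 0 ≤ ρ) (hρ1 : ρ ≤ 1) {Ebar : ℝ}
    (hE : Ebar ∈ Set.Icc 0 (8 + M)) {c : ℤ × ℤ} {A a b m : ℕ}
    (hA : 2 * (5 + M + 3) * ((a : ℝ) + 1) ≤ A) (hAγ : 8 ≤ A * γ) (ha : 8 ≤ a) (hb : 1 ≤ b)
    (hm : m ≤ ρ * a / 16) (hF : ∀ t ≤ b, rowCount c F a t ≤ m)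
    (hbA : (b : ℝ) ^ 2 * Real.log A ≤ ρ * a / 512) :
    P {ω | ¬ NoInflation A Ebar m (fun n => W n ω) F c a b}
      ≤ ENNReal.ofReal (Real.exp (-(ρ * a / 32))) := by
  classical
  have haR : (8 : ℝ) ≤ a := by exact_mod_cast ha
  have hA16 : (16 : ℝ) ≤ A := by nlinarith
  have hA1 : (1 : ℝ) ≤ A := by linarith
  have hA0 : (0 : ℝ) < A := by linarith
  set N : ℕ := A ^ (3 * b) with hN
  set T : ℝ := 2 * (A : ℝ) ^ b with hT
  have hAb : (A : ℝ) ≤ (A : ℝ) ^ b := le_self_pow₀ hA1 (by omega)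
  have hNR : (N : ℝ) = (A : ℝ) ^ b * (A : ℝ) ^ b * (A : ℝ) ^ b := by
    rw [hN]; push_cast; rw [← pow_add, ← pow_add]; congr 1; ring
  set G : Finset (Fin 2 × Fin (b + 1) → ℤ) :=
    Fintype.piFinset fun _ => Finset.Icc (-(N : ℤ)) N with hG
  let bad : (Fin 2 × Fin (b + 1) → ℤ) → Set Ω := fun g =>
    {ω | (∀ e t, ¬ EvenSite c e t → extendData b g e t = 0) ∧
      (∃ t, t + 2 ≤ b ∧ ∃ e < 2, (N : ℤ) ≤ |extendData b g e (t + 2)|) ∧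
      rowExceed c F a T (diagSol (localPot c Ebar fun n => W n ω)
        fun e t => (extendData b g e t : ℝ)) (b - 1) ≤ m ∧
      rowExceed c F a T (diagSol (localPot c Ebar fun n => W n ω)
        fun e t => (extendData b g e t : ℝ)) b ≤ m}
  have hcover : {ω | ¬ NoInflation A Ebar m (fun n => W n ω) F c a b} ⊆ ⋃ g ∈ G, bad g := by
    intro ω hω
    obtain ⟨g, hg, h⟩ := exists_data_of_not_noInflation hM (fun n => hW.mem_Icc n ω) hE hA
      (by omega) hω
    simp only [Set.mem_iUnion]
    refine ⟨g, Fintype.mem_piFinset.2 fun z => Finset.mem_Icc.2 (abs_le.1 (hg z)), h⟩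
  have hm16 : 16 * m ≤ a := by
    have : (16 : ℝ) * m ≤ a := by nlinarith
    exact_mod_cast this
  have hbad : ∀ g, P (bad g) ≤ ENNReal.ofReal (2 ^ m * Real.exp (-(ρ * a / 8))) := by
    intro g
    by_cases hg : (∀ e t, ¬ EvenSite c e t → extendData b g e t = 0) ∧
      ∃ t, t + 2 ≤ b ∧ ∃ e < 2, (N : ℤ) ≤ |extendData b g e (t + 2)|
    · refine (measure_mono fun ω hω => hω.2.2).trans (measure_rowExceed_le hW hM hγ hρ hρ1
        (E := Ebar) (by constructor <;> linarith [hE.1, hE.2]) hA ha hm16 hF (N := N)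
        (by positivity) ?_ ?_ (fun e t h => by simp [hg.1 e t h]) ?_)
      · rw [hNR, hT]
        have : 8 ≤ (A : ℝ) ^ b * γ := hAγ.trans (by gcongr)
        have h0 : (0 : ℝ) < (A : ℝ) ^ b * (A : ℝ) ^ b := by positivity
        nlinarith
      · rw [hNR, hT]
        have h1 : (16 : ℝ) ≤ (A : ℝ) ^ b := hA16.trans hAb
        have h2 : (256 : ℝ) ≤ (A : ℝ) ^ b * (A : ℝ) ^ b := by nlinarith
        nlinarith
      · obtain ⟨t, ht, e, he, h⟩ := hg.2
        exact ⟨t, ht, e, he, by exact_mod_cast h⟩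
    · have : bad g = ∅ := Set.eq_empty_of_forall_notMem fun ω hω => hg ⟨hω.1, hω.2.1⟩
      rw [this, measure_empty]
      exact zero_le
  have hcard : (G.card : ℝ) ≤ Real.exp (ρ * a / 32) := by
    have h1 : G.card = (2 * N + 1) ^ (2 * (b + 1)) := by
      rw [hG, Fintype.card_piFinset]
      simp only [Int.card_Icc, Finset.prod_const, Finset.card_univ, Fintype.card_prod,
        Fintype.card_fin]
      congr 1
      omega
    have hAN : 16 ≤ A := by exact_mod_cast hA16
    have h2 : 2 * N + 1 ≤ A ^ (4 * b) := by
      have e : A ^ (4 * b) = N * A ^ b := by rw [hN, ← pow_add]; congr 1; ring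
      have g1 : A ≤ A ^ b := Nat.le_self_pow (by omega) A
      have g2 : 1 ≤ N := Nat.one_le_pow _ _ (by omega)
      rw [e]
      nlinarith
    have h3 : G.card ≤ A ^ (16 * b ^ 2) := by
      rw [h1]
      calc (2 * N + 1) ^ (2 * (b + 1)) ≤ (A ^ (4 * b)) ^ (2 * (b + 1)) := Nat.pow_le_pow_left h2 _
        _ = A ^ (4 * b * (2 * (b + 1))) := (pow_mul _ _ _).symm
        _ ≤ A ^ (16 * b ^ 2) := Nat.pow_le_pow_right (by omega) (by nlinarith)
    calc (G.card : ℝ) ≤ (A : ℝ) ^ (16 * b ^ 2) := by exact_mod_cast h3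
      _ = Real.exp (Real.log A * ((16 * b ^ 2 : ℕ) : ℝ)) := by
          rw [← Real.rpow_natCast, Real.rpow_def_of_pos hA0]
      _ ≤ Real.exp (ρ * a / 32) := by
          apply Real.exp_le_exp.2
          push_cast
          nlinarith
  have h2m : (2 : ℝ) ^ m ≤ Real.exp (ρ * a / 16) := by
    calc (2 : ℝ) ^ m ≤ Real.exp 1 ^ m := by
          gcongr
          linarith [Real.add_one_le_exp (1 : ℝ)]
      _ = Real.exp m := by rw [← Real.exp_nat_mul, mul_one]
      _ ≤ _ := Real.exp_le_exp.2 hm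
  calc P {ω | ¬ NoInflation A Ebar m (fun n => W n ω) F c a b}
      ≤ P (⋃ g ∈ G, bad g) := measure_mono hcover
    _ ≤ ∑ g ∈ G, P (bad g) := measure_biUnion_finset_le _ _
    _ ≤ ∑ g ∈ G, ENNReal.ofReal (2 ^ m * Real.exp (-(ρ * a / 8))) :=
        Finset.sum_le_sum fun g _ => hbad g
    _ = ENNReal.ofReal (G.card * (2 ^ m * Real.exp (-(ρ * a / 8)))) := by
        rw [Finset.sum_const, nsmul_eq_mul, ENNReal.ofReal_mul (p := (G.card : ℝ)) (by positivity),
          ENNReal.ofReal_natCast]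
    _ ≤ ENNReal.ofReal (Real.exp (-(ρ * a / 32))) := by
        refine ENNReal.ofReal_le_ofReal ?_
        calc (G.card : ℝ) * (2 ^ m * Real.exp (-(ρ * a / 8)))
            ≤ Real.exp (ρ * a / 32) * (Real.exp (ρ * a / 16) * Real.exp (-(ρ * a / 8))) := by
              gcongr
          _ = Real.exp (-(ρ * a / 32)) := by
              rw [← Real.exp_add, ← Real.exp_add]
              congr 1
              ring

/-! ### Growth from a tilted square to its double -/

/-- `|φ| ≤ K` on the tilted rectangle `s₁ ≤ x + y ≤ s₂`, `t₁ ≤ x - y ≤ t₂`. -/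
def BddRect (φ : ℤ × ℤ → ℝ) (s₁ s₂ t₁ t₂ : ℤ) (K : ℝ) : Prop :=
  ∀ n : ℤ × ℤ, s₁ ≤ n.1 + n.2 → n.1 + n.2 ≤ s₂ → t₁ ≤ n.1 - n.2 → n.1 - n.2 ≤ t₂ → |φ n| ≤ K

lemma BddRect.mono {φ : ℤ × ℤ → ℝ} {s₁ s₂ t₁ t₂ s₁' s₂' t₁' t₂' : ℤ} {K K' : ℝ}
    (h : BddRect φ s₁ s₂ t₁ t₂ K) (h1 : s₁ ≤ s₁') (h2 : s₂' ≤ s₂) (h3 : t₁ ≤ t₁') (h4 : t₂' ≤ t₂)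
    (hK : K ≤ K') : BddRect φ s₁' s₂' t₁' t₂' K' := fun n a b c d =>
  (h n (h1.trans a) (b.trans h2) (h3.trans c) (d.trans h4)).trans hK

lemma site_add_sub {c : ℤ × ℤ} {s t : ℕ} (h : EvenSite c s t) :
    (site c s t).1 + (site c s t).2 = c.1 + s ∧ (site c s t).1 - (site c s t).2 = c.2 + t := by
  unfold EvenSite at h
  simp only [site]
  omega

lemma exists_site {c n : ℤ × ℤ} (h1 : c.1 ≤ n.1 + n.2) (h2 : c.2 ≤ n.1 - n.2) :
    ∃ s t : ℕ, EvenSite c s t ∧ site c s t = n ∧ c.1 + s = n.1 + n.2 ∧ c.2 + t = n.1 - n.2 := by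
  refine ⟨(n.1 + n.2 - c.1).toNat, (n.1 - n.2 - c.2).toNat, ?_, ?_, by omega, by omega⟩
  · unfold EvenSite; omega
  · ext <;> simp only [site] <;> omega

lemma BddRect.localize_le {φ : ℤ × ℤ → ℝ} {s₁ s₂ t₁ t₂ : ℤ} {K : ℝ} {c : ℤ × ℤ}
    (h : BddRect φ s₁ s₂ t₁ t₂ K) (hK : 0 ≤ K) {s t : ℕ} (h1 : s₁ ≤ c.1) (h2 : c.1 + s ≤ s₂)
    (h3 : t₁ ≤ c.2) (h4 : c.2 + t ≤ t₂) : |localize c φ s t| ≤ K := by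
  refine abs_localize_le hK fun he => ?_
  obtain ⟨e1, e2⟩ := site_add_sub he
  exact h _ (by omega) (by omega) (by omega) (by omega)

/-- Bounds on tilted rectangles can be extended upwards by `h` rows at the cost of a factor `G`,
for rectangles of length at least `2 * r` in the tilted square of radius `3 * r` around the
origin. -/
def UpStep (φ : ℤ × ℤ → ℝ) (r h : ℕ) (G : ℝ) : Prop :=
  ∀ (s₁ s₂ t₁ t₂ : ℤ) (K : ℝ), 1 ≤ K → -(3 * r) ≤ s₁ → s₂ ≤ 3 * r → s₁ + 2 * r ≤ s₂ →
    -(3 * r) ≤ t₁ → t₁ + 1 ≤ t₂ → t₂ < 2 * r → BddRect φ s₁ s₂ t₁ t₂ K →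
    BddRect φ s₁ s₂ t₁ (t₂ + h) (G * K)

/-- The set `F` has at most `m` points on each row of the tilted square of radius `3 * r`. -/
def RowSparse (F : Set (ℤ × ℤ)) (r m : ℕ) : Prop :=
  ∀ (c : ℤ × ℤ) (a τ : ℕ), -(3 * r : ℤ) ≤ c.1 → c.1 + a ≤ 3 * r → -(3 * r : ℤ) ≤ c.2 + τ →
    c.2 + τ ≤ 3 * r → rowCount c F a τ ≤ m

/-- Equation `H φ = E φ` on the tilted square of radius `3 * r` around the origin. -/
def SolvesNear (W φ : ℤ × ℤ → ℝ) (E : ℝ) (r : ℕ) : Prop :=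
  ∀ n : ℤ × ℤ, -(3 * r : ℤ) ≤ n.1 + n.2 → n.1 + n.2 ≤ 3 * r → -(3 * r : ℤ) ≤ n.1 - n.2 →
    n.1 - n.2 ≤ 3 * r → schrodinger W φ n = E * φ n

lemma SolvesNear.diagEq {W φ : ℤ × ℤ → ℝ} {E : ℝ} {r a b : ℕ} {c : ℤ × ℤ}
    (h : SolvesNear W φ E r) (h1 : -(3 * r : ℤ) ≤ c.1) (h2 : c.1 + a ≤ 3 * r)
    (h3 : -(3 * r : ℤ) ≤ c.2) (h4 : c.2 + b ≤ 3 * r) :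
    ∀ s t, s + 2 ≤ a → t + 2 ≤ b → EvenSite c s t →
      schrodinger W φ (site c (s + 1) (t + 1)) = E * φ (site c (s + 1) (t + 1)) := by
  intro s t hs ht he
  have he' : EvenSite c (s + 1) (t + 1) := by unfold EvenSite at *; push_cast; omega
  obtain ⟨e1, e2⟩ := site_add_sub he'
  push_cast at e1 e2
  exact h _ (by omega) (by omega) (by omega) (by omega)

/-- If all values off a sparse set `F` are at most `1`, a single point of the next row outside `F`
suffices to extend a bound to that row. -/
lemma upStep_of_bounded_off {W φ : ℤ × ℤ → ℝ} {E M A : ℝ} {r m : ℕ} {F : Set (ℤ × ℤ)}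
    (hM : 0 ≤ M) (hW : ∀ n, W n ∈ Set.Icc 0 M) (hE : E ∈ Set.Icc (-1) (9 + M))
    (hsol : SolvesNear W φ E r) (hF : RowSparse F r m) (hmr : m < r)
    (hgood : ∀ n : ℤ × ℤ, -(3 * r : ℤ) ≤ n.1 + n.2 → n.1 + n.2 ≤ 3 * r → -(3 * r : ℤ) ≤ n.1 - n.2 →
      n.1 - n.2 ≤ 3 * r → n ∉ F → |φ n| ≤ 1)
    (hA : 2 * (5 + M + 3) * (6 * r + 1) ≤ A) : UpStep φ r 1 A := by
  classical
  intro s₁ s₂ t₁ t₂ K hK h1 h2 h3 h4 h5 h6 hbd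
  set c : ℤ × ℤ := (s₁, t₂ - 1) with hc
  have hc1 : c.1 = s₁ := rfl
  have hc2 : c.2 = t₂ - 1 := rfl
  obtain ⟨a, ha⟩ : ∃ a : ℕ, s₂ = s₁ + a := ⟨(s₂ - s₁).toNat, by omega⟩
  have har : 2 * r ≤ a := by omega
  have ha6 : (a : ℝ) ≤ 6 * r := by
    have : a ≤ 6 * r := by omega
    exact_mod_cast this
  have haR : (0 : ℝ) ≤ a := Nat.cast_nonneg a
  have hu := diagEq_localize (hsol.diagEq (a := a) (b := 2) (c := c) h1 (by simp [hc]; omega)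
    (by simp [hc]; omega) (by simp [hc]; omega))
  have hD := hu.abs_add_le (abs_localPot_le hM hE hW) (t := 0) (P₀ := K) (P₁ := K) (R := 0) le_rfl
    (fun s hs => hbd.localize_le (by linarith) (by simp [hc]) (by simp [hc]; omega)
      (by simp [hc]; omega) (by simp [hc]))
    (fun s hs => hbd.localize_le (by linarith) (by simp [hc]) (by simp [hc]; omega)
      (by simp [hc]; omega) (by simp [hc])) (fun _ _ => by simp)
  obtain ⟨s', hs'a, hs'e, hs'F⟩ : ∃ s' ≤ a, EvenSite c s' 2 ∧ site c s' 2 ∉ F := by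
    by_contra hcon
    push Not at hcon
    have hcnt := hF c a 2 h1 (by simp [hc]; omega) (by simp [hc]; omega) (by simp [hc]; omega)
    obtain ⟨e, he, hpar⟩ : ∃ e : ℕ, e < 2 ∧ ∀ k : ℕ, EvenSite c (2 * k + e) 2 := by
      refine ⟨((c.1 + c.2) % 2).toNat, by omega, fun k => ?_⟩
      unfold EvenSite; push_cast; omega
    have hsub : (Finset.range r).image (fun k => 2 * k + e) ⊆
        (Finset.range (a + 1)).filter fun s => EvenSite c s 2 ∧ site c s 2 ∈ F := by
      intro s hs
      obtain ⟨k, hk, rfl⟩ := Finset.mem_image.1 hs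
      rw [Finset.mem_range] at hk
      exact Finset.mem_filter.2 ⟨by simp; omega, hpar k, hcon _ (by omega) (hpar k)⟩
    have := Finset.card_le_card hsub
    rw [Finset.card_image_of_injective _ (fun k k' h => by simp at h; omega),
      Finset.card_range] at this
    unfold rowCount at hcnt
    omega
  have hone : |localize c φ s' 2| ≤ 1 := by
    rw [localize_of_even hs'e]
    obtain ⟨e1, e2⟩ := site_add_sub hs'e
    rw [hc1] at e1; rw [hc2] at e2
    exact hgood _ (by omega) (by omega) (by omega) (by omega) hs'F
  intro n n1 n2 n3 n4
  have hA1 : 1 ≤ A := by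
    have : (0 : ℝ) ≤ r := Nat.cast_nonneg r
    nlinarith
  have hbig : K ≤ A * K := by nlinarith
  by_cases hnt : n.1 - n.2 ≤ t₂
  · exact (hbd n n1 n2 n3 hnt).trans hbig
  obtain ⟨s, t, he, hsn, e1, e2⟩ := exists_site (c := c) (n := n) n1 (by simp only [hc]; omega)
  rw [hc1] at e1; rw [hc2] at e2
  push_cast at n4
  obtain rfl : t = 2 := by omega
  rw [← hsn, ← localize_of_even he φ]
  have hpar : s % 2 = s' % 2 := by unfold EvenSite at he hs'e; omega
  have q1 := abs_abs_sub_abs_le_of_alternating (f := fun s => localize c φ s 2) hD (s % 2) (s / 2)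
    (by omega)
  have q2 := abs_abs_sub_abs_le_of_alternating (f := fun s => localize c φ s 2) hD (s % 2) (s' / 2)
    (by omega)
  rw [show s % 2 + 2 * (s / 2) = s by omega] at q1
  rw [show s % 2 + 2 * (s' / 2) = s' by omega] at q2
  have k1 : ((s / 2 : ℕ) : ℝ) + ((s' / 2 : ℕ) : ℝ) ≤ a := by
    have : s / 2 + s' / 2 ≤ a := by omega
    exact_mod_cast this
  have hDpos : 0 ≤ (5 + M) * K + 2 * K + 0 := by nlinarith
  have k2 := mul_le_mul_of_nonneg_right k1 hDpos
  have k3 : (1 : ℝ) + a * ((5 + M) * K + 2 * K + 0) ≤ A * K := by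
    have : (1 + (a : ℝ) * (7 + M)) ≤ A := by nlinarith
    nlinarith
  linarith [(abs_le.1 q1).2, (abs_le.1 q2).1]

lemma schrodinger_div (W φ : ℤ × ℤ → ℝ) (K : ℝ) (n : ℤ × ℤ) :
    schrodinger W (fun n => φ n / K) n = schrodinger W φ n / K := by
  unfold schrodinger laplacian; ring

lemma localize_div (c : ℤ × ℤ) (φ : ℤ × ℤ → ℝ) (K : ℝ) (s t : ℕ) :
    localize c (fun n => φ n / K) s t = localize c φ s t / K := by
  unfold localize; split_ifs <;> simp

/-- Few exceptional points in the tilted square of radius `3 * r` leave, in each strip of width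
about `2 * h`, two consecutive rows with few exceptional points, so that `NoInflation` applies. -/
lemma upStep_of_noInflation {W φ : ℤ × ℤ → ℝ} {E Ebar ρ : ℝ} {r h A : ℕ} {F : Set (ℤ × ℤ)}
    (hA : 1 ≤ A) (hρ : 0 ≤ ρ) (hE : |E - Ebar| ≤ ((A : ℝ) ^ (4 * (2 * h + 1)))⁻¹)
    (hsol : SolvesNear W φ E r)
    (hNI : ∀ (c : ℤ × ℤ) (a b : ℕ), -(3 * r : ℤ) ≤ c.1 → c.1 + a ≤ 3 * r → -(3 * r : ℤ) ≤ c.2 →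
      c.2 + b ≤ 3 * r → 2 * r ≤ a → h + 1 ≤ b → b ≤ 2 * h + 1 →
      NoInflation A Ebar ⌊ρ * a / 16⌋₊ W F c a b)
    (X : Finset (ℤ × ℤ))
    (hX : ∀ n : ℤ × ℤ, -(3 * r : ℤ) ≤ n.1 + n.2 → n.1 + n.2 ≤ 3 * r → -(3 * r : ℤ) ≤ n.1 - n.2 →
      n.1 - n.2 ≤ 3 * r → n ∉ F → 1 < |φ n| → n ∈ X)
    (hXc : (X.card : ℝ) ≤ ρ * r * h / 16) (hh : 2 * h ≤ r) :
    UpStep φ r h ((A : ℝ) ^ (4 * (2 * h + 1))) := by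
  classical
  intro s₁ s₂ t₁ t₂ K hK h1 h2 h3 h4 h5 h6 hbd
  set c : ℤ × ℤ := (s₁, t₂ - 1) with hc
  have hc1 : c.1 = s₁ := rfl
  have hc2 : c.2 = t₂ - 1 := rfl
  obtain ⟨a, ha⟩ : ∃ a : ℕ, s₂ = s₁ + a := ⟨(s₂ - s₁).toNat, by omega⟩
  have har : 2 * r ≤ a := by omega
  have harR : (2 : ℝ) * r ≤ a := by exact_mod_cast har
  have hAR : (1 : ℝ) ≤ A := by exact_mod_cast hA
  set k := ⌊ρ * a / 16⌋₊ with hk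
  set ex : ℕ → ℕ := rowExceed c F a 1 (localize c φ) with hex
  -- The exceptional points of rows `i, …, i + h` are distinct elements of `X`.
  have hsum : ∀ i : ℕ, i + h ≤ 2 * h + 1 → ∑ τ ∈ Finset.range (h + 1), ex (i + τ) ≤ X.card := by
    intro i hi
    let Y : ℕ → Finset ℕ := fun τ => (Finset.range (a + 1)).filter fun s =>
      EvenSite c s (i + τ) ∧ site c s (i + τ) ∉ F ∧ 1 < |localize c φ s (i + τ)|
    have e : ∑ τ ∈ Finset.range (h + 1), ex (i + τ) = ((Finset.range (h + 1)).sigma Y).card := by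
      rw [Finset.card_sigma]
      rfl
    rw [e]
    refine Finset.card_le_card_of_injOn (fun z : (_ : ℕ) × ℕ => site c z.2 (i + z.1)) ?_ ?_
    · rintro ⟨τ, s⟩ hz
      simp only [Finset.coe_sigma, Set.mem_sigma_iff, Finset.mem_coe, Finset.mem_range, Y,
        Finset.mem_filter] at hz
      obtain ⟨hτ, hs, he, hsF, hsT⟩ := hz
      rw [localize_of_even he] at hsT
      obtain ⟨e1, e2⟩ := site_add_sub he
      rw [hc1] at e1; rw [hc2] at e2
      push_cast at e1 e2
      change site c s (i + τ) ∈ X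
      exact hX _ (by omega) (by omega) (by omega) (by omega) hsF hsT
    · rintro ⟨τ, s⟩ hz ⟨τ', s'⟩ hz' heq
      simp only [Finset.coe_sigma, Set.mem_sigma_iff, Finset.mem_coe, Finset.mem_range, Y,
        Finset.mem_filter] at hz hz'
      obtain ⟨g1, g2⟩ := site_inj hz.2.2.1 hz'.2.2.1 heq
      obtain rfl : τ = τ' := by omega
      rw [g1]
  obtain ⟨b, hb1, hb2, hb3, hb4⟩ : ∃ b, h + 1 ≤ b ∧ b ≤ 2 * h + 1 ∧ ex (b - 1) ≤ k ∧ ex b ≤ k := by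
    by_contra hcon
    push Not at hcon
    have hlow : (h + 1) * (k + 1) ≤ ∑ τ ∈ Finset.range (h + 1), (ex (h + τ) + ex (h + 1 + τ)) := by
      have : ∀ τ ∈ Finset.range (h + 1), k + 1 ≤ ex (h + τ) + ex (h + 1 + τ) := by
        intro τ hτ
        rw [Finset.mem_range] at hτ
        have g := hcon (h + 1 + τ) (by omega) (by omega)
        rw [show h + 1 + τ - 1 = h + τ by omega] at g
        by_contra hlt
        have := g (by omega)
        omega
      have := Finset.card_nsmul_le_sum _ _ _ this
      simpa using this
    rw [Finset.sum_add_distrib] at hlow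
    have u1 := hsum h (by omega)
    have u2 := hsum (h + 1) (by omega)
    have u3 : (h + 1) * (k + 1) ≤ 2 * X.card := by omega
    have u4 : ((h : ℝ) + 1) * (k + 1) ≤ 2 * X.card := by exact_mod_cast u3
    have u5 : ρ * a / 16 < k + 1 := Nat.lt_floor_add_one _
    have hr0 : (0 : ℝ) ≤ h := Nat.cast_nonneg h
    have u6 : ρ * (2 * r) / 16 ≤ ρ * a / 16 := by gcongr
    have u7 : (h : ℝ) * (ρ * (2 * r) / 16) ≤ h * (k + 1) := by gcongr; linarith
    have u8 : (0 : ℝ) < k + 1 := by positivity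
    nlinarith
  have hK0 : (0 : ℝ) < K := by linarith
  have hNI' := hNI c a b h1 (by simp [hc]; omega) (by simp [hc]; omega) (by simp [hc]; omega) har
    hb1 hb2 E (fun n => φ n / K)
    (hE.trans (inv_anti₀ (by positivity) (pow_le_pow_right₀ hAR (by omega))))
    (fun s t hs ht he => by
      rw [schrodinger_div, hsol.diagEq (a := a) (b := b) (c := c) h1 (by simp [hc]; omega)
        (by simp [hc]; omega) (by simp [hc]; omega) s t hs ht he]
      ring)
    (fun s hs => by
      simp only [localize_div, abs_div, abs_of_pos hK0, div_le_one hK0]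
      exact ⟨hbd.localize_le hK0.le (by simp [hc]) (by simp [hc]; omega)
          (by simp [hc]; omega) (by simp [hc]),
        hbd.localize_le hK0.le (by simp [hc]) (by simp [hc]; omega)
          (by simp [hc]; omega) (by simp [hc])⟩)
  have hdiv : ∀ τ, rowExceed c F a 1 (localize c fun n => φ n / K) τ ≤ ex τ := by
    intro τ
    refine Finset.card_le_card fun s hs => ?_
    obtain ⟨g1, g2, g3, g4⟩ := Finset.mem_filter.1 hs
    refine Finset.mem_filter.2 ⟨g1, g2, g3, ?_⟩
    rw [localize_div, abs_div, abs_of_pos hK0, lt_div_iff₀ hK0] at g4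
    linarith
  have hfin := hNI' ((hdiv _).trans hb3) ((hdiv _).trans hb4)
  intro n n1 n2 n3 n4
  have hpow1 : (1 : ℝ) ≤ (A : ℝ) ^ (4 * (2 * h + 1)) := one_le_pow₀ hAR
  by_cases hnt : n.1 - n.2 ≤ t₂
  · exact (hbd n n1 n2 n3 hnt).trans (by nlinarith)
  obtain ⟨s, t, he, hsn, e1, e2⟩ := exists_site (c := c) (n := n) n1 (by simp only [hc]; omega)
  rw [hc1] at e1; rw [hc2] at e2
  have hv := hfin s (by omega) t (by omega)
  rw [localize_div, localize_of_even he, hsn, abs_div, abs_of_pos hK0, div_le_iff₀ hK0] at hv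
  refine hv.trans ?_
  gcongr

lemma UpStep.iterate {φ : ℤ × ℤ → ℝ} {r h : ℕ} {G : ℝ} (hup : UpStep φ r h G) (hG : 1 ≤ G)
    {s₁ s₂ t₁ : ℤ} {K : ℝ} (hK : 1 ≤ K) (h1 : -(3 * r) ≤ s₁) (h2 : s₂ ≤ 3 * r)
    (h3 : s₁ + 2 * r ≤ s₂) (h4 : -(3 * r) ≤ t₁) (h5 : t₁ + 1 ≤ r)
    (hbd : BddRect φ s₁ s₂ t₁ r K) {n : ℕ} (hn : r ≤ n * h) :
    BddRect φ s₁ s₂ t₁ (2 * r) (G ^ n * K) := by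
  have key : ∀ n : ℕ, BddRect φ s₁ s₂ t₁ (min (r + n * h) (2 * r)) (G ^ n * K) := by
    intro n
    induction n with
    | zero => exact hbd.mono le_rfl le_rfl le_rfl (by simp) (by simp)
    | succ n ih =>
      have hGn : 1 ≤ G ^ n * K := one_le_mul_of_one_le_of_one_le (one_le_pow₀ hG) hK
      have e : G ^ (n + 1) * K = G * (G ^ n * K) := by ring
      rw [e]
      by_cases hlt : (r : ℤ) + n * h < 2 * r
      · rw [min_eq_left hlt.le] at ih
        have := hup s₁ s₂ t₁ (r + n * h) _ hGn h1 h2 h3 h4 (by nlinarith) hlt ih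
        exact this.mono le_rfl le_rfl le_rfl (by
          push_cast; rw [add_mul, one_mul, ← add_assoc]; exact min_le_left _ _) le_rfl
      · rw [min_eq_right (not_lt.1 hlt)] at ih
        exact ih.mono le_rfl le_rfl le_rfl (min_le_right _ _) (by nlinarith)
  refine (key n).mono le_rfl le_rfl le_rfl (le_min ?_ le_rfl) le_rfl
  have : (r : ℤ) ≤ n * h := by exact_mod_cast hn
  linarith

/-- Rotation of the lattice by a right angle. -/
def rot (n : ℤ × ℤ) : ℤ × ℤ := (-n.2, n.1)

lemma bddRect_comp_rot {φ : ℤ × ℤ → ℝ} {s₁ s₂ t₁ t₂ : ℤ} {K : ℝ} :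
    BddRect (φ ∘ rot) s₁ s₂ t₁ t₂ K ↔ BddRect φ t₁ t₂ (-s₂) (-s₁) K := by
  constructor
  · intro h n h1 h2 h3 h4
    have := h (n.2, -n.1) (by simp; omega) (by simp; omega) (by simp; omega) (by simp; omega)
    simpa [rot] using this
  · intro h n h1 h2 h3 h4
    exact h (rot n) (by simp [rot]; omega) (by simp [rot]; omega) (by simp [rot]; omega)
      (by simp [rot]; omega)

/-- Extension in all four diagonal directions doubles the radius of a tilted square. -/
lemma BddRect.double {φ : ℤ × ℤ → ℝ} {r h n : ℕ} {G K : ℝ} (hr : 1 ≤ r) (hG : 1 ≤ G) (hK : 1 ≤ K)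
    (hn : r ≤ n * h) (hup : ∀ k < 4, UpStep (φ ∘ rot^[k]) r h G)
    (hbd : BddRect φ (-r) r (-r) r K) :
    BddRect φ (-(2 * r)) (2 * r) (-(2 * r)) (2 * r) (G ^ (4 * n) * K) := by
  have hone : ∀ j : ℕ, 1 ≤ (G ^ n) ^ j * K := fun j =>
    one_le_mul_of_one_le_of_one_le (one_le_pow₀ (one_le_pow₀ hG)) hK
  have e2 : φ ∘ rot^[2] = (φ ∘ rot) ∘ rot := rfl
  have e3 : φ ∘ rot^[3] = ((φ ∘ rot) ∘ rot) ∘ rot := rfl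
  have b0 := (hup 0 (by omega)).iterate hG hK (s₁ := -r) (s₂ := r) (t₁ := -r) (by omega) (by omega)
    (by omega) (by omega) (by omega) hbd hn
  have h2 := hup 2 (by omega)
  rw [e2] at h2
  have b2 := h2.iterate hG (hone 1) (s₁ := -r) (s₂ := r) (t₁ := -(2 * r)) (by omega) (by omega)
    (by omega) (by omega) (by omega) (by
      rw [bddRect_comp_rot, bddRect_comp_rot]
      exact b0.mono (by omega) (by omega) (by omega) (by omega) (by simp)) hn
  rw [bddRect_comp_rot, bddRect_comp_rot] at b2
  have h1 := hup 1 (by omega)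
  have b1 := h1.iterate hG (hone 2) (s₁ := -(2 * r)) (s₂ := 2 * r) (t₁ := -r) (by omega) (by omega)
    (by omega) (by omega) (by omega) (by
      change BddRect (φ ∘ rot) _ _ _ _ _
      rw [bddRect_comp_rot]
      exact b2.mono (by omega) (by omega) (by omega) (by omega)
        (by rw [pow_one, pow_two, mul_assoc])) hn
  change BddRect (φ ∘ rot) _ _ _ _ _ at b1
  rw [bddRect_comp_rot] at b1
  have h3 := hup 3 (by omega)
  rw [e3] at h3
  have b3 := h3.iterate hG (hone 3) (s₁ := -(2 * r)) (s₂ := 2 * r) (t₁ := -(2 * r)) (by omega)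
    (by omega) (by omega) (by omega) (by omega) (by
      rw [bddRect_comp_rot, bddRect_comp_rot, bddRect_comp_rot]
      exact b1.mono (by omega) (by omega) (by omega) (by omega) (by
        rw [← mul_assoc, ← pow_succ'])) hn
  rw [bddRect_comp_rot, bddRect_comp_rot, bddRect_comp_rot] at b3
  refine b3.mono (by omega) (by omega) (by omega) (by omega) (le_of_eq ?_)
  rw [← mul_assoc, ← pow_succ', ← pow_mul]
  congr 2
  ring

/-! ### Tilted squares around arbitrary centers, in all four orientations -/

/-- The isometry of the lattice which rotates by `k` right angles and moves the origin to `q`. -/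
def frame (q : ℤ × ℤ) (k : ℕ) (n : ℤ × ℤ) : ℤ × ℤ := q + rot^[k] n

lemma rot_injective : Function.Injective rot := by
  rintro ⟨a, b⟩ ⟨c, d⟩ h
  simp only [rot, Prod.mk.injEq, neg_inj] at h ⊢
  exact ⟨h.2, h.1⟩

lemma frame_injective (q : ℤ × ℤ) (k : ℕ) : Function.Injective (frame q k) :=
  fun _ _ h => rot_injective.iterate k (add_left_cancel h)

lemma schrodinger_rot (W ψ : ℤ × ℤ → ℝ) (n : ℤ × ℤ) :
    schrodinger (W ∘ rot) (ψ ∘ rot) n = schrodinger W ψ (rot n) := by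
  have e1 : -(n.2 + 1) = -n.2 - 1 := by ring
  have e2 : -(n.2 - 1) = -n.2 + 1 := by ring
  simp only [schrodinger, laplacian, Function.comp_apply, rot, e1, e2]
  ring

lemma schrodinger_add (W ψ : ℤ × ℤ → ℝ) (q n : ℤ × ℤ) :
    schrodinger (fun n => W (q + n)) (fun n => ψ (q + n)) n = schrodinger W ψ (q + n) := by
  simp only [schrodinger, laplacian, Prod.add_def, add_assoc, add_sub_assoc]

lemma schrodinger_frame (W ψ : ℤ × ℤ → ℝ) (q : ℤ × ℤ) (k : ℕ) (n : ℤ × ℤ) :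
    schrodinger (W ∘ frame q k) (ψ ∘ frame q k) n = schrodinger W ψ (frame q k n) := by
  rw [frame, ← schrodinger_add]
  have h : ∀ (k : ℕ) (W ψ : ℤ × ℤ → ℝ) (n : ℤ × ℤ),
      schrodinger (W ∘ rot^[k]) (ψ ∘ rot^[k]) n = schrodinger W ψ (rot^[k] n) := by
    intro k
    induction k with
    | zero => intro W ψ n; rfl
    | succ k ih =>
      intro W ψ n
      rw [Function.iterate_succ, Function.comp_apply, ← ih, ← schrodinger_rot]
      rfl
  exact h k (fun n => W (q + n)) (fun n => ψ (q + n)) n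

/-- The diagonal coordinates of a rotated point. -/
lemma frame_coords (q n : ℤ × ℤ) {k : ℕ} (hk : k < 4) :
    (k = 0 ∧ (frame q k n).1 + (frame q k n).2 = q.1 + q.2 + (n.1 + n.2) ∧
        (frame q k n).1 - (frame q k n).2 = q.1 - q.2 + (n.1 - n.2)) ∨
    (k = 1 ∧ (frame q k n).1 + (frame q k n).2 = q.1 + q.2 + (n.1 - n.2) ∧
        (frame q k n).1 - (frame q k n).2 = q.1 - q.2 - (n.1 + n.2)) ∨
    (k = 2 ∧ (frame q k n).1 + (frame q k n).2 = q.1 + q.2 - (n.1 + n.2) ∧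
        (frame q k n).1 - (frame q k n).2 = q.1 - q.2 - (n.1 - n.2)) ∨
    (k = 3 ∧ (frame q k n).1 + (frame q k n).2 = q.1 + q.2 - (n.1 - n.2) ∧
        (frame q k n).1 - (frame q k n).2 = q.1 - q.2 + (n.1 + n.2)) := by
  interval_cases k <;> simp [frame, rot, Function.iterate_succ] <;> omega

/-- The tilted square of radius `r` around `q`. -/
noncomputable def tsq (q : ℤ × ℤ) (r : ℕ) : Finset (ℤ × ℤ) :=
  (tiltedSquare_finite (q.1 + q.2 - r) (q.1 - q.2 - r) (2 * r + 1)).toFinset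

lemma coe_tsq (q : ℤ × ℤ) (r : ℕ) :
    (tsq q r : Set (ℤ × ℤ)) = tiltedSquare (q.1 + q.2 - r) (q.1 - q.2 - r) (2 * r + 1) := by
  simp [tsq]

lemma mem_tsq {q n : ℤ × ℤ} {r : ℕ} :
    n ∈ tsq q r ↔ (q.1 + q.2 - r ≤ n.1 + n.2 ∧ n.1 + n.2 ≤ q.1 + q.2 + r) ∧
      (q.1 - q.2 - r ≤ n.1 - n.2 ∧ n.1 - n.2 ≤ q.1 - q.2 + r) := by
  rw [tsq, Set.Finite.mem_toFinset]
  simp only [tiltedSquare, Set.mem_ofPred_eq]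
  push_cast
  omega

lemma isTiltedSquare_tsq (q : ℤ × ℤ) (r : ℕ) : IsTiltedSquare (tsq q r : Set (ℤ × ℤ)) :=
  ⟨_, _, _, coe_tsq q r⟩

lemma frame_mem_tsq {q n : ℤ × ℤ} {r k : ℕ} (hk : k < 4) (h1 : -(r : ℤ) ≤ n.1 + n.2)
    (h2 : n.1 + n.2 ≤ r) (h3 : -(r : ℤ) ≤ n.1 - n.2) (h4 : n.1 - n.2 ≤ r) :
    frame q k n ∈ tsq q r := by
  rw [mem_tsq]
  rcases frame_coords q n hk with h | h | h | h <;> omega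

lemma card_tsq_le (q : ℤ × ℤ) (r : ℕ) : (tsq q r).card ≤ (2 * r + 1) ^ 2 := by
  have h : (tsq q r).card ≤ (Finset.Icc (q.1 + q.2 - r) (q.1 + q.2 + r) ×ˢ
      Finset.Icc (q.1 - q.2 - r) (q.1 - q.2 + r)).card := by
    refine Finset.card_le_card_of_injOn (fun n => (n.1 + n.2, n.1 - n.2)) ?_ ?_
    · intro n hn
      have hn := mem_tsq.1 hn
      simp only [Finset.coe_product, Set.mem_prod, Finset.mem_coe, Finset.mem_Icc]
      exact hn
    · rintro ⟨a, b⟩ - ⟨c, d⟩ - h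
      simp only [Prod.mk.injEq] at h ⊢
      omega
  rw [Finset.card_product, Int.card_Icc, Int.card_Icc] at h
  refine h.trans (le_of_eq ?_)
  rw [show (q.1 + q.2 + r + 1 - (q.1 + q.2 - r)).toNat = 2 * r + 1 by omega,
    show (q.1 - q.2 + r + 1 - (q.1 - q.2 - r)).toNat = 2 * r + 1 by omega]
  ring

lemma sq_le_card_tsq (q : ℤ × ℤ) (r : ℕ) : r ^ 2 ≤ (tsq q r).card := by
  set m : ℤ := (r : ℤ) / 2 with hm
  have h : (Finset.Icc (-m) m ×ˢ Finset.Icc (-m) m).card ≤ (tsq q r).card := by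
    refine Finset.card_le_card_of_injOn (fun z => (q.1 + (z.1 + z.2), q.2 + (z.1 - z.2))) ?_ ?_
    · intro z hz
      simp only [Finset.coe_product, Set.mem_prod, Finset.mem_coe, Finset.mem_Icc] at hz
      simp only [Finset.mem_coe, mem_tsq]
      omega
    · rintro ⟨a, b⟩ - ⟨c, d⟩ - h
      simp only [Prod.mk.injEq] at h ⊢
      omega
  rw [Finset.card_product, Int.card_Icc] at h
  refine le_trans ?_ h
  rw [pow_two]
  have : r ≤ (m + 1 - -m).toNat := by omega
  exact Nat.mul_le_mul this this

lemma ncard_row_le (q : ℤ × ℤ) (r : ℕ) (κ : ℤ) :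
    ((tsq q r : Set (ℤ × ℤ)) ∩ {n | n.1 + n.2 = κ}).ncard ≤ 2 * r + 1 ∧
    ((tsq q r : Set (ℤ × ℤ)) ∩ {n | n.1 - n.2 = κ}).ncard ≤ 2 * r + 1 := by
  constructor
  · have h := Set.ncard_le_ncard_of_injOn (fun n : ℤ × ℤ => n.1 - n.2)
      (s := (tsq q r : Set (ℤ × ℤ)) ∩ {n | n.1 + n.2 = κ})
      (t := (Finset.Icc (q.1 - q.2 - r) (q.1 - q.2 + r) : Set ℤ))
      (fun n hn => by
        have := mem_tsq.1 hn.1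
        simp; omega)
      (by
        rintro ⟨a, b⟩ ha ⟨c, d⟩ hc h
        have h1 := ha.2
        have h2 := hc.2
        simp only [Set.mem_ofPred_eq, Prod.mk.injEq] at *
        omega)
      (Finset.finite_toSet _)
    rw [Set.ncard_coe_finset, Int.card_Icc] at h
    omega
  · have h := Set.ncard_le_ncard_of_injOn (fun n : ℤ × ℤ => n.1 + n.2)
      (s := (tsq q r : Set (ℤ × ℤ)) ∩ {n | n.1 - n.2 = κ})
      (t := (Finset.Icc (q.1 + q.2 - r) (q.1 + q.2 + r) : Set ℤ))
      (fun n hn => by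
        have := mem_tsq.1 hn.1
        simp; omega)
      (by
        rintro ⟨a, b⟩ ha ⟨c, d⟩ hc h
        have h1 := ha.2
        have h2 := hc.2
        simp only [Set.mem_ofPred_eq, Prod.mk.injEq] at *
        omega)
      (Finset.finite_toSet _)
    rw [Set.ncard_coe_finset, Int.card_Icc] at h
    omega

/-- Sparsity in a tilted square bounds the number of points on the rows, in every orientation. -/
lemma IsSparse.rowSparse {ε : ℝ} {F : Set (ℤ × ℤ)} {q : ℤ × ℤ} {r m k : ℕ} (hε : 0 ≤ ε)
    (h : IsSparse ε F (tsq q (3 * r))) (hk : k < 4) (hm : ε * (6 * r + 1) < m + 1) :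
    RowSparse (frame q k ⁻¹' F) r m := by
  classical
  intro c a τ h1 h2 h3 h4
  -- The diagonal onto which the row is mapped.
  obtain ⟨D, hD, hDτ⟩ : ∃ D : Set (ℤ × ℤ),
      ((F ∩ (tsq q (3 * r) : Set (ℤ × ℤ)) ∩ D).ncard : ℝ) ≤ ε * (6 * r + 1) ∧
      ∀ n : ℤ × ℤ, n.1 - n.2 = c.2 + τ → frame q k n ∈ D := by
    have hs : ∀ κ : ℤ, ((F ∩ (tsq q (3 * r) : Set (ℤ × ℤ)) ∩ {n | n.1 + n.2 = κ}).ncard : ℝ)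
        ≤ ε * (6 * r + 1) := fun κ => (h κ).1.trans (by
      gcongr
      have := (ncard_row_le q (3 * r) κ).1
      have h' : ((((tsq q (3 * r) : Set (ℤ × ℤ)) ∩ {n | n.1 + n.2 = κ}).ncard : ℕ) : ℝ)
        ≤ ((2 * (3 * r) + 1 : ℕ) : ℝ) := by exact_mod_cast this
      refine h'.trans (le_of_eq ?_)
      push_cast; ring)
    have ht : ∀ κ : ℤ, ((F ∩ (tsq q (3 * r) : Set (ℤ × ℤ)) ∩ {n | n.1 - n.2 = κ}).ncard : ℝ)
        ≤ ε * (6 * r + 1) := fun κ => (h κ).2.trans (by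
      gcongr
      have := (ncard_row_le q (3 * r) κ).2
      have h' : ((((tsq q (3 * r) : Set (ℤ × ℤ)) ∩ {n | n.1 - n.2 = κ}).ncard : ℕ) : ℝ)
        ≤ ((2 * (3 * r) + 1 : ℕ) : ℝ) := by exact_mod_cast this
      refine h'.trans (le_of_eq ?_)
      push_cast; ring)
    obtain rfl | rfl | rfl | rfl : k = 0 ∨ k = 1 ∨ k = 2 ∨ k = 3 := by omega
    · refine ⟨_, ht (q.1 - q.2 + (c.2 + τ)), fun n hn => ?_⟩
      have := frame_coords q n hk
      simp only [Set.mem_ofPred_eq]; omega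
    · refine ⟨_, hs (q.1 + q.2 + (c.2 + τ)), fun n hn => ?_⟩
      have := frame_coords q n hk
      simp only [Set.mem_ofPred_eq]; omega
    · refine ⟨_, ht (q.1 - q.2 - (c.2 + τ)), fun n hn => ?_⟩
      have := frame_coords q n hk
      simp only [Set.mem_ofPred_eq]; omega
    · refine ⟨_, hs (q.1 + q.2 - (c.2 + τ)), fun n hn => ?_⟩
      have := frame_coords q n hk
      simp only [Set.mem_ofPred_eq]; omega
  have hfin : (F ∩ (tsq q (3 * r) : Set (ℤ × ℤ)) ∩ D).Finite :=
    ((Finset.finite_toSet _).subset Set.inter_subset_right).subset Set.inter_subset_left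
  have hle : rowCount c (frame q k ⁻¹' F) a τ
      ≤ (F ∩ (tsq q (3 * r) : Set (ℤ × ℤ)) ∩ D).ncard := by
    unfold rowCount
    rw [← Set.ncard_coe_finset]
    refine Set.ncard_le_ncard_of_injOn (fun s => frame q k (site c s τ)) ?_ ?_ hfin
    · intro s hs
      simp only [Finset.coe_filter, Finset.mem_range, Set.mem_ofPred_eq] at hs
      obtain ⟨hsa, he, hsF⟩ := hs
      obtain ⟨e1, e2⟩ := site_add_sub he
      refine ⟨⟨hsF, frame_mem_tsq hk ?_ ?_ ?_ ?_⟩, hDτ _ e2⟩ <;> push_cast <;> omega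
    · intro s hs s' hs' heq
      simp only [Finset.coe_filter, Finset.mem_range, Set.mem_ofPred_eq] at hs hs'
      exact (site_inj hs.2.1 hs'.2.1 (frame_injective q k heq)).1
  have : (rowCount c (frame q k ⁻¹' F) a τ : ℝ) < m + 1 :=
    ((Nat.cast_le.2 hle).trans hD).trans_lt hm
  have h' : rowCount c (frame q k ⁻¹' F) a τ < m + 1 := by exact_mod_cast this
  omega

lemma IsSparse.disjoint {ε : ℝ} {F : Set (ℤ × ℤ)} {q : ℤ × ℤ} {r : ℕ} (hε : 0 ≤ ε)
    (h : IsSparse ε F (tsq q r)) (hr : ε * (2 * r + 1) < 1) : ∀ n ∈ tsq q r, n ∉ F := by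
  intro n hn hnF
  have h1 := (h (n.1 + n.2)).1
  have h2 := (ncard_row_le q r (n.1 + n.2)).1
  have hfin : (F ∩ (tsq q r : Set (ℤ × ℤ)) ∩ {m | m.1 + m.2 = n.1 + n.2}).Finite :=
    ((Finset.finite_toSet _).subset Set.inter_subset_right).subset Set.inter_subset_left
  have h3 : 0 < (F ∩ (tsq q r : Set (ℤ × ℤ)) ∩ {m | m.1 + m.2 = n.1 + n.2}).ncard :=
    (Set.ncard_pos hfin).2 ⟨n, ⟨hnF, hn⟩, rfl⟩
  have h3' : (1 : ℝ) ≤ (F ∩ (tsq q r : Set (ℤ × ℤ)) ∩ {m | m.1 + m.2 = n.1 + n.2}).ncard := by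
    exact_mod_cast h3
  have h2' : (((tsq q r : Set (ℤ × ℤ)) ∩ {m | m.1 + m.2 = n.1 + n.2}).ncard : ℝ)
      ≤ 2 * r + 1 := by exact_mod_cast h2
  have := mul_le_mul_of_nonneg_left h2' hε
  linarith

/-! ### Doubling a tilted square -/

/-- A bound on the tilted square of radius `r` around `q`. -/
def BddTsq (ψ : ℤ × ℤ → ℝ) (q : ℤ × ℤ) (r : ℕ) (K : ℝ) : Prop := ∀ n ∈ tsq q r, |ψ n| ≤ K

lemma bddTsq_iff {ψ : ℤ × ℤ → ℝ} {q : ℤ × ℤ} {r : ℕ} {K : ℝ} :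
    BddTsq ψ q r K ↔ BddRect (ψ ∘ frame q 0) (-r) r (-r) r K := by
  constructor
  · intro h n h1 h2 h3 h4
    exact h _ (frame_mem_tsq (by omega) h1 h2 h3 h4)
  · intro h n hn
    have hn' := mem_tsq.1 hn
    have := h (n - q) (by simp; omega) (by simp; omega) (by simp; omega) (by simp; omega)
    simpa [frame] using this

section Doubling

variable {W ψ : ℤ × ℤ → ℝ} {F : Set (ℤ × ℤ)} {E Ebar M ρ ε : ℝ} {q : ℤ × ℤ} {r A : ℕ}

lemma solvesNear_frame (hsol : ∀ n ∈ tsq q (3 * r), schrodinger W ψ n = E * ψ n) {k : ℕ}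
    (hk : k < 4) : SolvesNear (W ∘ frame q k) (ψ ∘ frame q k) E r := by
  intro n h1 h2 h3 h4
  rw [schrodinger_frame]
  exact hsol _ (frame_mem_tsq hk (by push_cast; omega) (by push_cast; omega) (by push_cast; omega)
    (by push_cast; omega))

lemma BddTsq.double {K G : ℝ} {h n : ℕ} (hr : 1 ≤ r) (hG : 1 ≤ G) (hK : 1 ≤ K) (hn : r ≤ n * h)
    (hup : ∀ k < 4, UpStep (ψ ∘ frame q k) r h G) (hbd : BddTsq ψ q r K) :
    BddTsq ψ q (2 * r) (G ^ (4 * n) * K) := by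
  rw [bddTsq_iff] at hbd ⊢
  have := hbd.double hr hG hK hn (fun k hk => hup k hk)
  simpa using this

/-- Doubling a tilted square in the absence of exceptional points. -/
lemma BddTsq.double_of_no_exceptions {K : ℝ} (hM : 0 ≤ M) (hW : ∀ n, W n ∈ Set.Icc 0 M)
    (hE : E ∈ Set.Icc (-1) (9 + M)) (hA : 2 * (5 + M + 3) * (6 * (r : ℝ) + 1) ≤ A) (hr : 1 ≤ r)
    (hε : 0 ≤ ε) (hεr : ε * (6 * r + 1) < r)
    (hsol : ∀ n ∈ tsq q (3 * r), schrodinger W ψ n = E * ψ n)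
    (hF : IsSparse ε F (tsq q (3 * r))) (hgood : ∀ n ∈ tsq q (3 * r), n ∉ F → |ψ n| ≤ 1)
    (hK : 1 ≤ K) (hbd : BddTsq ψ q r K) : BddTsq ψ q (2 * r) ((A : ℝ) ^ (96 * r) * K) := by
  have hA1 : (1 : ℝ) ≤ A := by
    have : (0 : ℝ) ≤ r := Nat.cast_nonneg r
    nlinarith
  have hup : ∀ k < 4, UpStep (ψ ∘ frame q k) r 1 A := by
    intro k hk
    refine upStep_of_bounded_off (W := W ∘ frame q k) (m := r - 1) (F := frame q k ⁻¹' F) hM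
      (fun n => hW _) hE (solvesNear_frame hsol hk) (hF.rowSparse hε hk ?_) (by omega) ?_ hA
    · rw [Nat.cast_sub hr]
      push_cast
      linarith
    · intro n h1 h2 h3 h4 hn
      exact hgood _ (frame_mem_tsq hk (by push_cast; omega) (by push_cast; omega)
        (by push_cast; omega) (by push_cast; omega)) hn
  have := hbd.double hr hA1 hK (n := r) (by omega) hup
  intro n hn
  exact (this n hn).trans (mul_le_mul_of_nonneg_right (pow_le_pow_right₀ hA1 (by omega))
    (by linarith))

/-- Doubling a tilted square with few exceptional points, provided that no inflation occurs in
thin rectangles. -/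
lemma BddTsq.double_of_noInflation {K : ℝ} {h : ℕ} (hA : 1 ≤ A) (hρ : 0 ≤ ρ)
    (hE : |E - Ebar| ≤ ((A : ℝ) ^ (4 * (2 * h + 1)))⁻¹) (hr : 1 ≤ r) (hh1 : 1 ≤ h)
    (hh : 2 * h ≤ r) (hε : 0 ≤ ε) (hεr : ε * (6 * r + 1) ≤ ρ * r / 8)
    (hsol : ∀ n ∈ tsq q (3 * r), schrodinger W ψ n = E * ψ n)
    (hF : IsSparse ε F (tsq q (3 * r)))
    (hNI : ∀ k < 4, ∀ (c : ℤ × ℤ) (a b : ℕ), -(3 * r : ℤ) ≤ c.1 → c.1 + a ≤ 3 * r →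
      -(3 * r : ℤ) ≤ c.2 → c.2 + b ≤ 3 * r → 2 * r ≤ a → h + 1 ≤ b → b ≤ 2 * h + 1 →
      (∀ t ≤ b, rowCount c (frame q k ⁻¹' F) a t ≤ ⌊ρ * a / 16⌋₊) →
      NoInflation A Ebar ⌊ρ * a / 16⌋₊ (W ∘ frame q k) (frame q k ⁻¹' F) c a b)
    (X : Finset (ℤ × ℤ)) (hX : ∀ n ∈ tsq q (3 * r), n ∉ F → 1 < |ψ n| → n ∈ X)
    (hXc : (X.card : ℝ) ≤ ρ * r * h / 16)
    (hK : 1 ≤ K) (hbd : BddTsq ψ q r K) : BddTsq ψ q (2 * r) ((A : ℝ) ^ (96 * r) * K) := by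
  classical
  have hA1 : (1 : ℝ) ≤ A := by exact_mod_cast hA
  have hup : ∀ k < 4, UpStep (ψ ∘ frame q k) r h ((A : ℝ) ^ (4 * (2 * h + 1))) := by
    intro k hk
    have hrow : RowSparse (frame q k ⁻¹' F) r ⌊ρ * r / 8⌋₊ :=
      hF.rowSparse hε hk (hεr.trans_lt (Nat.lt_floor_add_one _))
    refine upStep_of_noInflation (W := W ∘ frame q k) (F := frame q k ⁻¹' F) hA hρ hE
      (solvesNear_frame hsol hk) ?_ (X.preimage (frame q k) (frame_injective q k).injOn) ?_ ?_ hh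
    · intro c a b h1 h2 h3 h4 h5 h6 h7
      refine hNI k hk c a b h1 h2 h3 h4 h5 h6 h7 fun t ht => ?_
      refine (hrow c a t h1 h2 (by omega) (by omega)).trans (Nat.floor_le_floor ?_)
      have : (2 : ℝ) * r ≤ a := by exact_mod_cast h5
      nlinarith
    · intro n h1 h2 h3 h4 hn hψ
      rw [Finset.mem_preimage]
      exact hX _ (frame_mem_tsq hk (by push_cast; omega) (by push_cast; omega)
        (by push_cast; omega) (by push_cast; omega)) hn hψ
    · refine le_trans ?_ hXc
      exact_mod_cast Finset.card_le_card_of_injOn (frame q k)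
        (fun n hn => by simpa using hn) (frame_injective q k).injOn
  -- The number of steps, and their total cost.
  have hn1 : r ≤ (r / h + 1) * h := by
    have := Nat.div_add_mod r h
    have := Nat.mod_lt r hh1
    nlinarith
  have hn2 : (r / h + 1) * h ≤ 2 * r := by
    have := Nat.div_mul_le_self r h
    nlinarith
  have := hbd.double hr (one_le_pow₀ hA1) hK hn1 hup
  intro n hn
  refine (this n hn).trans ?_
  rw [← pow_mul]
  refine mul_le_mul_of_nonneg_right (pow_le_pow_right₀ hA1 ?_) (by linarith)
  generalize r / h + 1 = N at hn2 ⊢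
  have : N ≤ N * h := Nat.le_mul_of_pos_right N hh1
  nlinarith

end Doubling

/-! ### Covering by squares on which the growth argument fails -/

/-- The definition of regularity, for a disjoint family indexed by the centers of its squares. -/
lemma IsEpsRegular.sum_card_le {ε : ℝ} {F S : Set (ℤ × ℤ)} (hreg : IsEpsRegular ε F S)
    (U : Finset (ℤ × ℤ)) (R : ℤ × ℤ → ℕ) (hU : ∀ q ∈ U, (tsq q (R q) : Set (ℤ × ℤ)) ⊆ S)
    (hF : ∀ q ∈ U, ¬ IsSparse ε F (tsq q (R q)))
    (hd : ∀ q ∈ U, ∀ q' ∈ U, q ≠ q' → Disjoint (tsq q (R q)) (tsq q' (R q'))) :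
    ∑ q ∈ U, ((tsq q (R q)).card : ℝ) ≤ ε * S.ncard := by
  classical
  have h := hreg U.card (fun i => (tsq (U.equivFin.symm i : ℤ × ℤ) (R (U.equivFin.symm i : ℤ × ℤ)) :
    Set (ℤ × ℤ))) (fun i => ⟨isTiltedSquare_tsq _ _, hU _ (U.equivFin.symm i).2,
      hF _ (U.equivFin.symm i).2⟩) (by
    intro i j hij
    rw [Finset.disjoint_coe]
    refine hd _ (U.equivFin.symm i).2 _ (U.equivFin.symm j).2 fun e => hij ?_
    exact U.equivFin.symm.injective (Subtype.ext e))
  refine le_trans (le_of_eq ?_) h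
  have e : (⋃ i, (tsq (U.equivFin.symm i : ℤ × ℤ) (R (U.equivFin.symm i : ℤ × ℤ)) : Set (ℤ × ℤ)))
      = (U.biUnion fun q => tsq q (R q) : Finset (ℤ × ℤ)) := by
    ext n
    simp only [Set.mem_iUnion, Finset.mem_coe, Finset.mem_biUnion]
    constructor
    · rintro ⟨i, hi⟩
      exact ⟨_, (U.equivFin.symm i).2, hi⟩
    · rintro ⟨q, hq, hn⟩
      exact ⟨U.equivFin ⟨q, hq⟩, by simpa using hn⟩
  rw [e, Set.ncard_coe_finset, Finset.card_biUnion fun q hq q' hq' hne => hd q hq q' hq' hne]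
  push_cast
  rfl

/-- If around every point `q` of a tilted square there is a square of dyadic size in which `F` is
not sparse, or in which the points of `X` have density at least `1 / Y`, then a Vitali covering
argument bounds the size of the tilted square. -/
lemma sq_le_of_forall_fails {ε Y : ℝ} {F S : Set (ℤ × ℤ)} (hY : 0 ≤ Y)
    (hreg : IsEpsRegular ε F S) (X : Finset (ℤ × ℤ)) (p : ℤ × ℤ) (R : ℕ) (κ : ℤ × ℤ → ℕ)
    (hsub : ∀ q ∈ tsq p R, (tsq q (3 * 2 ^ κ q) : Set (ℤ × ℤ)) ⊆ S)
    (hfail : ∀ q ∈ tsq p R, ¬ IsSparse ε F (tsq q (3 * 2 ^ κ q)) ∨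
      ((tsq q (3 * 2 ^ κ q)).card : ℝ) ≤ Y * (X ∩ tsq q (3 * 2 ^ κ q)).card) :
    (R : ℝ) ^ 2 ≤ 41 * (ε * S.ncard + Y * X.card) := by
  classical
  obtain ⟨u, hut, hud, hucov⟩ := Vitali.exists_disjoint_subfamily_covering_enlargement
    (fun q => (tsq q (3 * 2 ^ κ q) : Set (ℤ × ℤ))) (tsq p R : Set (ℤ × ℤ))
    (fun q => (2 : ℝ) ^ κ q) 2 (by norm_num) (fun _ _ => by positivity)
    (∑ q ∈ tsq p R, (2 : ℝ) ^ κ q)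
    (fun q hq => Finset.single_le_sum (f := fun q => (2 : ℝ) ^ κ q) (fun _ _ => by positivity) hq)
    (fun q _ => ⟨q, by simp only [Finset.mem_coe, mem_tsq]; omega⟩)
  have hufin : u.Finite := (Finset.finite_toSet _).subset hut
  set U := hufin.toFinset with hU
  have hUu : ∀ q, q ∈ U ↔ q ∈ u := fun q => hufin.mem_toFinset
  have hUt : ∀ q ∈ U, q ∈ tsq p R := fun q hq => hut ((hUu q).1 hq)
  have hUd : ∀ q ∈ U, ∀ q' ∈ U, q ≠ q' →
      Disjoint (tsq q (3 * 2 ^ κ q)) (tsq q' (3 * 2 ^ κ q')) := by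
    intro q hq q' hq' hne
    rw [← Finset.disjoint_coe]
    exact hud ((hUu q).1 hq) ((hUu q').1 hq') hne
  have hcov : tsq p R ⊆ U.biUnion fun q => tsq q (9 * 2 ^ κ q) := by
    intro q hq
    obtain ⟨b, hb, ⟨z, hz1, hz2⟩, hle⟩ := hucov q hq
    refine Finset.mem_biUnion.2 ⟨b, (hUu b).2 hb, ?_⟩
    have h1 := mem_tsq.1 (Finset.mem_coe.1 hz1)
    have h2 := mem_tsq.1 (Finset.mem_coe.1 hz2)
    have hle' : 2 ^ κ q ≤ 2 * 2 ^ κ b := by exact_mod_cast hle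
    rw [mem_tsq]
    push_cast at *
    zify at hle'
    omega
  have hQ : ∀ q, ((tsq q (9 * 2 ^ κ q)).card : ℝ) ≤ 41 * (tsq q (3 * 2 ^ κ q)).card := by
    intro q
    have h1 : ((tsq q (9 * 2 ^ κ q)).card : ℝ) ≤ ((2 * (9 * 2 ^ κ q) + 1) ^ 2 : ℕ) := by
      exact_mod_cast card_tsq_le _ _
    have h2 : (((3 * 2 ^ κ q) ^ 2 : ℕ) : ℝ) ≤ (tsq q (3 * 2 ^ κ q)).card := by
      exact_mod_cast sq_le_card_tsq _ _
    push_cast at h1 h2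
    have h3 : (1 : ℝ) ≤ 2 ^ κ q := one_le_pow₀ (by norm_num)
    nlinarith
  set U₁ := U.filter fun q => ¬ IsSparse ε F (tsq q (3 * 2 ^ κ q)) with hU₁
  set U₂ := U.filter fun q => ¬ ¬ IsSparse ε F (tsq q (3 * 2 ^ κ q)) with hU₂
  have hs1 : ∑ q ∈ U₁, ((tsq q (3 * 2 ^ κ q)).card : ℝ) ≤ ε * S.ncard :=
    hreg.sum_card_le U₁ (fun q => 3 * 2 ^ κ q)
      (fun q hq => hsub q (hUt q (Finset.mem_filter.1 hq).1))
      (fun q hq => (Finset.mem_filter.1 hq).2)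
      (fun q hq q' hq' => hUd q (Finset.mem_filter.1 hq).1 q' (Finset.mem_filter.1 hq').1)
  have hs2 : ∑ q ∈ U₂, ((tsq q (3 * 2 ^ κ q)).card : ℝ) ≤ Y * X.card := by
    calc ∑ q ∈ U₂, ((tsq q (3 * 2 ^ κ q)).card : ℝ)
        ≤ ∑ q ∈ U₂, Y * ((X ∩ tsq q (3 * 2 ^ κ q)).card : ℝ) := by
          refine Finset.sum_le_sum fun q hq => ?_
          obtain ⟨h1, h2⟩ := Finset.mem_filter.1 hq
          exact (hfail q (hUt q h1)).resolve_left h2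
      _ = Y * ((∑ q ∈ U₂, (X ∩ tsq q (3 * 2 ^ κ q)).card : ℕ) : ℝ) := by
          rw [← Finset.mul_sum]; push_cast; rfl
      _ ≤ Y * X.card := by
          gcongr
          rw [← Finset.card_biUnion]
          · exact Finset.card_le_card (Finset.biUnion_subset.2 fun q _ => Finset.inter_subset_left)
          · intro q hq q' hq' hne
            exact (hUd q (Finset.mem_filter.1 hq).1 q' (Finset.mem_filter.1 hq').1 hne).mono
              Finset.inter_subset_right Finset.inter_subset_right
  have hR : (R : ℝ) ^ 2 ≤ (tsq p R).card := by exact_mod_cast sq_le_card_tsq p R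
  calc (R : ℝ) ^ 2 ≤ (tsq p R).card := hR
    _ ≤ ((U.biUnion fun q => tsq q (9 * 2 ^ κ q)).card : ℝ) := by
        exact_mod_cast Finset.card_le_card hcov
    _ ≤ ∑ q ∈ U, ((tsq q (9 * 2 ^ κ q)).card : ℝ) := by exact_mod_cast Finset.card_biUnion_le
    _ ≤ ∑ q ∈ U, 41 * ((tsq q (3 * 2 ^ κ q)).card : ℝ) := Finset.sum_le_sum fun q _ => hQ q
    _ = 41 * (∑ q ∈ U₁, ((tsq q (3 * 2 ^ κ q)).card : ℝ)
          + ∑ q ∈ U₂, ((tsq q (3 * 2 ^ κ q)).card : ℝ)) := by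
        rw [← Finset.mul_sum, Finset.sum_filter_add_sum_filter_not]
    _ ≤ 41 * (ε * S.ncard + Y * X.card) := by gcongr

/-! ### Unique continuation for good potentials -/

/-- A potential for which there is no inflation in thin tilted rectangles of length at least
`L ^ (1/4)` close to a point of the square, in all four orientations. The thinness condition is the
one under which `measure_not_noInflation_le` applies. -/
def GoodPotential (A : ℕ) (Ebar ρ : ℝ) (W : ℤ × ℤ → ℝ) (F : Set (ℤ × ℤ)) (z : ℤ × ℤ) (L : ℕ) :
    Prop :=
  ∀ q ∈ square z L, ∀ k < 4, ∀ (c : ℤ × ℤ) (a b : ℕ), c.1 ∈ Finset.Icc (-(3 * L : ℤ)) (3 * L) →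
    c.2 ∈ Finset.Icc (-(3 * L : ℤ)) (3 * L) → a ≤ 6 * L → b ≤ 6 * L → 1 ≤ b → L ≤ a ^ 4 →
    (b : ℝ) ^ 2 * Real.log A ≤ ρ * a / 512 →
    (∀ t ≤ b, rowCount c (frame q k ⁻¹' F) a t ≤ ⌊ρ * a / 16⌋₊) →
    NoInflation A Ebar ⌊ρ * a / 16⌋₊ (W ∘ frame q k) (frame q k ⁻¹' F) c a b

/-- The width of the strips used at scale `r` is comparable to `√(ρ r / l)`, where `l` is the
logarithm of the growth factor. -/
lemma exists_strip_width {ρ l : ℝ} {r : ℕ} (hρ1 : ρ ≤ 1) (hl : 1 ≤ l) (h : 2304 * l ≤ ρ * r) :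
    ∃ w : ℕ, 1 ≤ w ∧ 2 * w ≤ r ∧ 2304 * (w : ℝ) ^ 2 * l ≤ ρ * r ∧
      ρ * r ≤ 9216 * (w : ℝ) ^ 2 * l := by
  set x := √(ρ * r / (2304 * l)) with hx
  have hl0 : 0 < 2304 * l := by linarith
  have hr0 : (0 : ℝ) ≤ r := Nat.cast_nonneg r
  have hy1 : 1 ≤ ρ * r / (2304 * l) := (one_le_div hl0).2 h
  have hx2 : x ^ 2 = ρ * r / (2304 * l) := Real.sq_sqrt (by linarith)
  have hx2' : x ^ 2 * (2304 * l) = ρ * r := by rw [hx2]; field_simp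
  have hx1 : 1 ≤ x := Real.one_le_sqrt.2 hy1
  have hw1 : 1 ≤ ⌊x⌋₊ := Nat.one_le_floor_iff x |>.2 hx1
  have hwx : (⌊x⌋₊ : ℝ) ≤ x := Nat.floor_le (by linarith)
  have hxw : x < ⌊x⌋₊ + 1 := Nat.lt_floor_add_one x
  have hw1R : (1 : ℝ) ≤ ⌊x⌋₊ := by exact_mod_cast hw1
  have hsq : (⌊x⌋₊ : ℝ) ^ 2 ≤ x ^ 2 := by gcongr
  have hsq' : x ^ 2 ≤ 4 * (⌊x⌋₊ : ℝ) ^ 2 := by nlinarith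
  refine ⟨⌊x⌋₊, hw1, ?_, by nlinarith, by nlinarith⟩
  have h1 : (⌊x⌋₊ : ℝ) ^ 2 * 2304 ≤ r := by nlinarith
  have h2 : ⌊x⌋₊ ^ 2 * 2304 ≤ r := by exact_mod_cast h1
  nlinarith

/-- The energy window is narrower than what `NoInflation` requires for strips of width `w`. -/
lemma strip_energy_le {ρ l D r w : ℝ} (hρ1 : ρ ≤ 1) (hl : 0 ≤ l) (hr : 0 ≤ r) (hD : 0 ≤ D)
    (hw : 2304 * w ^ 2 * l ≤ ρ * r) (hrl : r * l ≤ 2 * D ^ 2) : 12 * (w * l) ≤ D := by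
  refine abs_le_of_sq_le_sq' (?_ : (12 * (w * l)) ^ 2 ≤ D ^ 2) hD |>.2
  have h1 : 2304 * w ^ 2 * l * l ≤ ρ * r * l := by gcongr
  have h2 : ρ * r * l ≤ 1 * (r * l) := by
    rw [mul_assoc]
    gcongr
  linarith [sq_nonneg D, (by ring : (12 * (w * l)) ^ 2 = 2304 * w ^ 2 * l * l / 16)]

/-- A set of density less than `1 / Y` has few points compared with the number of strips. -/
lemma strip_density_le {ρ l D r w Y : ℝ} (hρ : 0 < ρ) (hρ1 : ρ ≤ 1) (hr : 0 ≤ r) (hD : 0 ≤ D)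
    (hw0 : 0 ≤ w) (hw : ρ * r ≤ 9216 * w ^ 2 * l) (hrl : r * l ≤ 2 * D ^ 2)
    (hY : 150528 / ρ ^ 2 * D ≤ Y) : 49 * r ^ 2 ≤ Y * (ρ * r * w / 16) := by
  have hmain : 784 * ρ * r ≤ 150528 * (D * w) := by
    refine abs_le_of_sq_le_sq' (?_ : (784 * ρ * r) ^ 2 ≤ (150528 * (D * w)) ^ 2)
      (by positivity) |>.2
    have g1 : ρ * r * r ≤ 9216 * w ^ 2 * l * r := by gcongr
    have g2 : w ^ 2 * (r * l) ≤ w ^ 2 * (2 * D ^ 2) := by gcongr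
    have g3 : ρ * (ρ * r * r) ≤ 1 * (ρ * r * r) := by gcongr
    have g4 : (784 * ρ * r) ^ 2 = 784 ^ 2 * (ρ * (ρ * r * r)) := by ring
    have g5 : 9216 * w ^ 2 * l * r = 9216 * (w ^ 2 * (r * l)) := by ring
    have g6 : (150528 * (D * w)) ^ 2 = 150528 ^ 2 * (w ^ 2 * D ^ 2) := by ring
    have g7 : 0 ≤ w ^ 2 * D ^ 2 := by positivity
    rw [g4, g6]
    linarith
  have e : 150528 / ρ ^ 2 * D * (ρ * r * w / 16) = 150528 * (D * w) * r / (16 * ρ) := by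
    field_simp
  refine le_trans ?_ (mul_le_mul_of_nonneg_right hY (by positivity))
  rw [e, le_div_iff₀ (by positivity)]
  have := mul_le_mul_of_nonneg_right hmain hr
  linarith

lemma ncard_square_le (z : ℤ × ℤ) (L : ℕ) : (square z L).ncard ≤ L ^ 2 := by
  have h : square z L
      ⊆ (Finset.Ico z.1 (z.1 + L) ×ˢ Finset.Ico z.2 (z.2 + L) : Finset (ℤ × ℤ)) := by
    rintro n ⟨h1, h2⟩
    simp only [Finset.coe_product, Set.mem_prod, Finset.mem_coe, Finset.mem_Ico]
    exact ⟨h1, h2⟩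
  have := Set.ncard_le_ncard h (Finset.finite_toSet _)
  rw [Set.ncard_coe_finset, Finset.card_product, Int.card_Ico, Int.card_Ico] at this
  simpa [pow_two] using this

lemma tsq_subset_square {z p q : ℤ × ℤ} {L R r : ℕ} (hL : 1 ≤ L) (hp : p ∈ halfSquare z L)
    (hR : 20 * R ≤ L) (hq : q ∈ tsq p R) (hr : 2 * r ≤ R) :
    (tsq q (3 * r) : Set (ℤ × ℤ)) ⊆ square z L := by
  have hs : √2 ≤ 1.44 := Real.sqrt_le_iff.2 ⟨by norm_num, by norm_num⟩
  have hL0 : (0 : ℝ) ≤ L := Nat.cast_nonneg L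
  have key : ∀ x y : ℤ, (x : ℝ) ∈ Set.Icc (y + (1 / 2 - √2 / 4) * L : ℝ)
      (y + (1 / 2 + √2 / 4) * L) → 14 * (L : ℤ) ≤ 100 * (x - y) ∧ 100 * (x - y) ≤ 86 * L := by
    rintro x y ⟨h1, h2⟩
    have g1 : 14 * (L : ℝ) ≤ 100 * (x - y) := by nlinarith
    have g2 : 100 * ((x : ℝ) - y) ≤ 86 * L := by nlinarith
    exact ⟨by exact_mod_cast g1, by exact_mod_cast g2⟩
  have k1 := key _ _ hp.1
  have k2 := key _ _ hp.2
  intro n hn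
  have h1 := mem_tsq.1 (Finset.mem_coe.1 hn)
  have h2 := mem_tsq.1 hq
  push_cast at h1
  simp only [square, Set.mem_ofPred_eq]
  omega

section Deterministic

variable {W ψ : ℤ × ℤ → ℝ} {F : Set (ℤ × ℤ)} {E Ebar M ρ ε Y : ℝ} {z q : ℤ × ℤ} {A L K : ℕ}

/-- Doubling at the scales `r ≥ L ^ (1/4)`, where the randomness is used. -/
lemma bddTsq_double_of_goodPotential (hρ : 0 < ρ) (hρ1 : ρ ≤ 1) (hlogL : 1 ≤ Real.log L)
    (hA1 : 1 ≤ A) (hl1 : 1 ≤ Real.log A) (hlogA : Real.log A ≤ 2 * Real.log L)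
    (hE : |E - Ebar| ≤ Real.exp (-√(L * Real.log L)))
    (hgood : GoodPotential A Ebar ρ W F z L) (hqz : q ∈ square z L)
    (hY : 150528 / ρ ^ 2 * √(L * Real.log L) ≤ Y) (X : Finset (ℤ × ℤ)) {r : ℕ}
    (hX : ∀ n ∈ tsq q (3 * r), n ∉ F → 1 < |ψ n| → n ∈ X)
    (hsol : ∀ n ∈ tsq q (3 * r), schrodinger W ψ n = E * ψ n) (hr1 : 1 ≤ r) (hrL : r ≤ L)
    (hreg : L ≤ r ^ 4) (hlarge : 2304 * Real.log A ≤ ρ * r) (hε : 0 ≤ ε)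
    (hεr : ε * (6 * r + 1) ≤ ρ * r / 8) (hsp : IsSparse ε F (tsq q (3 * r)))
    (hden : Y * (X ∩ tsq q (3 * r)).card < (tsq q (3 * r)).card)
    (hcard : ((tsq q (3 * r)).card : ℝ) ≤ 49 * r ^ 2) {B : ℝ} (hB : 1 ≤ B)
    (hbd : BddTsq ψ q r B) : BddTsq ψ q (2 * r) ((A : ℝ) ^ (96 * r) * B) := by
  classical
  have hL0 : (0 : ℝ) ≤ L := Nat.cast_nonneg L
  have hA1R : (1 : ℝ) ≤ A := by exact_mod_cast hA1
  have hrR : (0 : ℝ) ≤ r := Nat.cast_nonneg r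
  set l := Real.log A with hl
  set D := √(L * Real.log L) with hD
  have hD2 : D ^ 2 = L * Real.log L := Real.sq_sqrt (by positivity)
  have hD0 : 0 ≤ D := Real.sqrt_nonneg _
  have hYpos : 0 ≤ Y := le_trans (by positivity) hY
  have hrLR : (r : ℝ) ≤ L := by exact_mod_cast hrL
  obtain ⟨w, hw1, hw2, hw3, hw4⟩ := exists_strip_width hρ1 hl1 hlarge
  have hw1R : (1 : ℝ) ≤ w := by exact_mod_cast hw1
  have hrl : (r : ℝ) * l ≤ 2 * D ^ 2 := by
    rw [hD2]
    calc (r : ℝ) * l ≤ L * (2 * Real.log L) := by gcongr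
      _ = 2 * (L * Real.log L) := by ring
  refine hbd.double_of_noInflation (h := w) hA1 hρ.le (hE.trans ?_) hr1 hw1
    hw2 hε hεr hsol hsp ?_ (X ∩ tsq q (3 * r)) ?_ ?_ hB
  · have h1 := strip_energy_le hρ1 (by linarith) hrR hD0 hw3 hrl
    rw [Real.exp_neg]
    refine inv_anti₀ (by positivity) ?_
    rw [← Real.rpow_natCast, Real.rpow_def_of_pos (by linarith), ← hl]
    apply Real.exp_le_exp.2
    push_cast
    have : l * 1 ≤ l * w := by gcongr
    linarith
  · intro k hk c a b h1 h2 h3 h4 h5 h6 h7 h8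
    refine hgood q hqz k hk c a b (by simp; omega) (by simp; omega) (by omega) (by omega)
      (by omega) (hreg.trans (Nat.pow_le_pow_left (by omega) 4)) ?_ h8
    have hb : (b : ℝ) ≤ 3 * w := by
      have : b ≤ 3 * w := by omega
      exact_mod_cast this
    have ha : (2 : ℝ) * r ≤ a := by exact_mod_cast h5
    have hb2 : (b : ℝ) ^ 2 * l ≤ (3 * w) ^ 2 * l := by gcongr
    have : ρ * (2 * r) ≤ ρ * a := by gcongr
    rw [mul_pow] at hb2
    linarith
  · intro n hn hnF hnψ
    exact Finset.mem_inter.2 ⟨hX n hn hnF hnψ, hn⟩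
  · have hYr := strip_density_le hρ hρ1 hrR hD0 (by linarith) hw4 hrl hY
    exact (lt_of_mul_lt_mul_left (hden.trans_le (hcard.trans hYr)) hYpos).le

/-- The growth argument around `q`: if at all dyadic scales `F` is sparse and the exceptional set
`X` has density less than `1 / Y`, the bounds propagate from scale `1` to scale `2 ^ K`. -/
lemma bddTsq_of_forall_pass (hM : 0 ≤ M) (hW : ∀ n, W n ∈ Set.Icc 0 M) (hρ : 0 < ρ) (hρ1 : ρ ≤ 1)
    (hEbar : Ebar ∈ Set.Icc 0 (8 + M)) (hε : 0 ≤ ε) (hερ : 56 * ε ≤ ρ)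
    (hA : 2 * (5 + M + 3) * (6 * (L : ℝ) + 1) ≤ A) (hlogL : 1 ≤ Real.log L)
    (hlogA : Real.log A ≤ 2 * Real.log L)
    (hlarge : ∀ r : ℕ, L ≤ r ^ 4 → 2304 * Real.log A ≤ ρ * r)
    (hE : |E - Ebar| ≤ Real.exp (-√(L * Real.log L)))
    (hgood : GoodPotential A Ebar ρ W F z L)
    (hqz : q ∈ square z L) (hK : 2 ^ K ≤ L)
    (hY : 150528 / ρ ^ 2 * √(L * Real.log L) ≤ Y) (X : Finset (ℤ × ℤ))
    (hX : ∀ n ∈ square z L, n ∉ F → 1 < |ψ n| → n ∈ X)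
    (hsub : ∀ k < K, (tsq q (3 * 2 ^ k) : Set (ℤ × ℤ)) ⊆ square z L)
    (hsol : ∀ n ∈ square z L, schrodinger W ψ n = E * ψ n)
    (hpass : ∀ k < K, IsSparse ε F (tsq q (3 * 2 ^ k)) ∧
      Y * (X ∩ tsq q (3 * 2 ^ k)).card < (tsq q (3 * 2 ^ k)).card) (hK0 : 0 < K) :
    BddTsq ψ q (2 ^ K) ((A : ℝ) ^ (96 * 2 ^ K)) := by
  classical
  have hL0 : (0 : ℝ) ≤ L := Nat.cast_nonneg L
  have hLe : 1 < (L : ℝ) := by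
    by_contra hc
    have := Real.log_nonpos hL0 (not_lt.1 hc)
    linarith
  have hLN : 1 < L := by exact_mod_cast hLe
  have hAL : (L : ℝ) ≤ A := by nlinarith
  have hA0 : (0 : ℝ) < A := by linarith
  have hA1 : (1 : ℝ) ≤ A := by linarith
  have hl1 : 1 ≤ Real.log A := hlogL.trans (Real.log_le_log (by linarith) hAL)
  set l := Real.log A with hl
  set D := √(L * Real.log L) with hD
  have hD0 : 0 < D := Real.sqrt_pos.2 (by nlinarith)
  have hD2 : D ^ 2 = L * Real.log L := Real.sq_sqrt (by nlinarith)
  have hYpos : 0 < Y := lt_of_lt_of_le (by positivity) hY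
  have hρ2 : 1 ≤ 1 / ρ ^ 2 := (one_le_div (by positivity)).2 (pow_le_one₀ hρ.le hρ1)
  have hEI : E ∈ Set.Icc (-1) (9 + M) := by
    have h1 : |E - Ebar| ≤ 1 := hE.trans (Real.exp_le_one_iff.2 (by linarith))
    obtain ⟨h2, h3⟩ := abs_le.1 h1
    constructor <;> linarith [hEbar.1, hEbar.2]
  have hcardR : ∀ r : ℕ, 1 ≤ r → ((tsq q (3 * r)).card : ℝ) ≤ 49 * r ^ 2 := by
    intro r hr
    have h1 : ((tsq q (3 * r)).card : ℝ) ≤ ((2 * (3 * r) + 1) ^ 2 : ℕ) := by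
      exact_mod_cast card_tsq_le _ _
    have h2 : (1 : ℝ) ≤ r := by exact_mod_cast hr
    push_cast at h1
    nlinarith
  have hεr : ∀ r : ℕ, 1 ≤ r → ε * (6 * r + 1) ≤ ρ * r / 8 := by
    intro r hr
    have h2 : (1 : ℝ) ≤ r := by exact_mod_cast hr
    nlinarith
  have hnone : ∀ k < K, (2 ^ k) ^ 4 < L → ∀ n ∈ tsq q (3 * 2 ^ k), n ∉ F → |ψ n| ≤ 1 := by
    intro k hk hkL n hn hnF
    by_contra hc
    have hnX := hX n (hsub k hk hn) hnF (not_le.1 hc)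
    have h1 : 1 ≤ (X ∩ tsq q (3 * 2 ^ k)).card :=
      Finset.card_pos.2 ⟨n, Finset.mem_inter.2 ⟨hnX, hn⟩⟩
    have h1R : (1 : ℝ) ≤ (X ∩ tsq q (3 * 2 ^ k)).card := by exact_mod_cast h1
    have h2 := hcardR (2 ^ k) Nat.one_le_two_pow
    have h3 := (hpass k hk).2
    set x : ℝ := ((2 ^ k : ℕ) : ℝ) ^ 2 with hx
    have hx4 : x ^ 2 ≤ D ^ 2 := by
      have : (((2 ^ k) ^ 4 : ℕ) : ℝ) ≤ L := by exact_mod_cast hkL.le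
      rw [hD2, hx]
      push_cast at this ⊢
      nlinarith
    have hxD : x ≤ D := abs_le_of_sq_le_sq' hx4 hD0.le |>.2
    have hYD : 150528 * D ≤ Y := by
      refine le_trans ?_ hY
      rw [show 150528 / ρ ^ 2 * D = 150528 * (1 / ρ ^ 2 * D) by ring]
      nlinarith
    nlinarith
  have hpos : ∀ j, 1 ≤ (A : ℝ) ^ j := fun j => one_le_pow₀ hA1
  have key : ∀ j ≤ K, BddTsq ψ q (2 ^ j) ((A : ℝ) ^ (96 * 2 ^ j)) := by
    intro j
    induction j with
    | zero =>
      intro _ n hn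
      have hn3 : n ∈ tsq q (3 * 2 ^ 0) := by
        rw [mem_tsq] at hn ⊢
        push_cast at *
        omega
      have hnF := (hpass 0 hK0).1.disjoint hε (by push_cast; linarith) n hn3
      exact (hnone 0 hK0 (by simpa using hLN) n hn3 hnF).trans (hpos _)
    | succ j ih =>
      intro hj
      have hjK : j < K := by omega
      have hr1 : 1 ≤ 2 ^ j := Nat.one_le_two_pow
      have hrL : 2 ^ j ≤ L := (Nat.pow_le_pow_right (by omega) hjK.le).trans hK
      have hrLR : ((2 ^ j : ℕ) : ℝ) ≤ L := by exact_mod_cast hrL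
      have hsolj : ∀ n ∈ tsq q (3 * 2 ^ j), schrodinger W ψ n = E * ψ n :=
        fun n hn => hsol n (hsub j hjK hn)
      have e1 : (2 : ℕ) ^ (j + 1) = 2 * 2 ^ j := pow_succ' 2 j
      have e2 : (A : ℝ) ^ (96 * 2 ^ (j + 1)) = (A : ℝ) ^ (96 * 2 ^ j) * (A : ℝ) ^ (96 * 2 ^ j) := by
        rw [← pow_add]; congr 1; omega
      rw [e2, e1]
      have ih' := ih hjK.le
      have hrpos : (1 : ℝ) ≤ ((2 ^ j : ℕ) : ℝ) := by exact_mod_cast hr1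

      have hsp := (hpass j hjK).1
      have hden := (hpass j hjK).2
      have hnonej := hnone j hjK
      have hsub' := fun n (hn : n ∈ tsq q (3 * 2 ^ j)) => hsub j hjK hn
      generalize 2 ^ j = r at *
      by_cases hreg : r ^ 4 < L
      · refine ih'.double_of_no_exceptions hM hW hEI ?_ hr1 hε ?_ hsolj hsp (hnonej hreg) (hpos _)
        · refine le_trans ?_ hA
          gcongr
        · have := hεr r hr1
          nlinarith
      · exact bddTsq_double_of_goodPotential hρ hρ1 hlogL (by exact_mod_cast hA1) hl1 hlogA hE hgood
          hqz hY X (fun n hn => hX n (hsub' n hn)) hsolj hr1 hrL (not_lt.1 hreg)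
          (hlarge r (not_lt.1 hreg)) hε (hεr r hr1) hsp hden (hcardR r hr1) (hpos _) ih'
  exact key K le_rfl

end Deterministic

lemma ncard_exceptional_le {S : Set (ℤ × ℤ)} (hS : S.Finite) (ψ : ℤ × ℤ → ℝ) {δ : ℝ}
    (h : (1 - δ) * S.ncard ≤ ({n ∈ S | |ψ n| ≤ 1}.ncard : ℝ)) :
    ({n ∈ S | 1 < |ψ n|}.ncard : ℝ) ≤ δ * S.ncard := by
  have e : {n ∈ S | |ψ n| ≤ 1} ∪ {n ∈ S | 1 < |ψ n|} = S := by
    ext n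
    simp only [Set.mem_union, Set.mem_ofPred_eq, ← and_or_left, and_iff_left_iff_imp]
    exact fun _ => le_or_gt _ _
  have hd : Disjoint {n ∈ S | |ψ n| ≤ 1} {n ∈ S | 1 < |ψ n|} :=
    Set.disjoint_left.2 fun n h1 h2 => not_lt.2 h1.2 h2.2
  have hc := Set.ncard_union_eq hd (hS.subset (Set.sep_subset _ _)) (hS.subset (Set.sep_subset _ _))
  rw [e] at hc
  have hc' : (S.ncard : ℝ) = {n ∈ S | |ψ n| ≤ 1}.ncard + {n ∈ S | 1 < |ψ n|}.ncard := by
    exact_mod_cast hc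
  linarith

/-- Good potentials satisfy unique continuation. Around every point of the half square there is a
center from which the growth argument never gets stuck, because the squares on which it gets stuck
can only cover a small part of the square. -/
lemma mem_ucEvent_of_goodPotential {W : ℤ × ℤ → ℝ} {F : Set (ℤ × ℤ)} {Ebar M ρ ε α : ℝ}
    {z : ℤ × ℤ} {A L : ℕ} (hM : 0 ≤ M) (hW : ∀ n, W n ∈ Set.Icc 0 M) (hρ : 0 < ρ) (hρ1 : ρ ≤ 1)
    (hEbar : Ebar ∈ Set.Icc 0 (8 + M)) (hε : 0 ≤ ε) (hερ : 10 ^ 10 * ε ≤ ρ ^ 2)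
    (hA : 2 * (5 + M + 3) * (6 * (L : ℝ) + 1) ≤ A) (hL : 40 ≤ L) (hlogL : 1 ≤ Real.log L)
    (hlogA : Real.log A ≤ 2 * Real.log L)
    (hlarge : ∀ r : ℕ, L ≤ r ^ 4 → 2304 * Real.log A ≤ ρ * r) (hα : 10 ≤ α)
    (hreg : IsEpsRegular ε F (square z L)) (hgood : GoodPotential A Ebar ρ W F z L) :
    W ∈ ucEvent Ebar z L F α ε := by
  classical
  intro E ψ hE hsol hcnt p hp
  have hL0 : (0 : ℝ) < L := by exact_mod_cast (by omega : 0 < L)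
  have hlog0 : 0 < (L : ℝ) * Real.log L := by positivity
  rw [← Real.sqrt_eq_rpow] at hE
  rw [Real.rpow_neg hlog0.le, ← Real.sqrt_eq_rpow] at hcnt
  set D := √((L : ℝ) * Real.log L) with hD
  have hD0 : 0 < D := Real.sqrt_pos.2 hlog0
  have hE' : |E - Ebar| ≤ Real.exp (-D) := hE.trans (Real.exp_le_exp.2 (by nlinarith))
  have hρ2 : ρ ^ 2 ≤ ρ := by nlinarith
  have hfin : (square z L \ F).Finite := (square_finite z L).subset Set.sdiff_subset
  have hXfin : {n ∈ square z L \ F | 1 < |ψ n|}.Finite := hfin.subset (Set.sep_subset _ _)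
  set X := hXfin.toFinset with hXdef
  have hX : ∀ n ∈ square z L, n ∉ F → 1 < |ψ n| → n ∈ X := fun n h1 h2 h3 =>
    hXfin.mem_toFinset.2 ⟨⟨h1, h2⟩, h3⟩
  have hsqcard : ((square z L).ncard : ℝ) ≤ (L : ℝ) ^ 2 := by exact_mod_cast ncard_square_le z L
  have hXcard : (X.card : ℝ) ≤ ε * D⁻¹ * L ^ 2 := by
    rw [hXdef, ← Set.ncard_eq_toFinset_card _ hXfin]
    refine (ncard_exceptional_le hfin ψ hcnt).trans ?_
    have : ((square z L \ F).ncard : ℝ) ≤ (square z L).ncard := by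
      exact_mod_cast Set.ncard_le_ncard Set.sdiff_subset (square_finite z L)
    have h0 : 0 ≤ ε * D⁻¹ := by positivity
    exact mul_le_mul_of_nonneg_left (this.trans hsqcard) h0
  set K := Nat.log 2 (L / 20) with hK
  have hL20 : L / 20 ≠ 0 := by omega
  have hK1 : 2 ^ K ≤ L / 20 := Nat.pow_log_le_self 2 hL20
  have hK2 : L / 20 < 2 ^ (K + 1) := Nat.lt_pow_succ_log_self (by omega) _
  have hK0 : 0 < K := Nat.log_pos (by omega) (by omega)
  have hsub : ∀ q ∈ tsq p (2 ^ K), ∀ k < K,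
      (tsq q (3 * 2 ^ k) : Set (ℤ × ℤ)) ⊆ square z L := by
    intro q hq k hk
    refine tsq_subset_square (by omega) hp (by omega) hq ?_
    rw [← pow_succ']
    exact Nat.pow_le_pow_right (by omega) hk
  set Y : ℝ := 150528 / ρ ^ 2 * D with hY
  -- A center at which the growth argument succeeds on all scales.
  obtain ⟨q, hq, hpass⟩ : ∃ q ∈ tsq p (2 ^ K), ∀ k < K, IsSparse ε F (tsq q (3 * 2 ^ k)) ∧
      Y * (X ∩ tsq q (3 * 2 ^ k)).card < (tsq q (3 * 2 ^ k)).card := by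
    by_contra hcon
    push Not at hcon
    choose! κ hκ1 hκ2 using hcon
    have h := sq_le_of_forall_fails (Y := Y) (by positivity) hreg X p (2 ^ K) κ
      (fun q hq => hsub q hq _ (hκ1 q hq))
      (fun q hq => by
        by_cases hs : IsSparse ε F (tsq q (3 * 2 ^ κ q))
        · exact Or.inr (hκ2 q hq hs)
        · exact Or.inl hs)
    have h1 : (L : ℝ) ≤ 40 * ((2 ^ K : ℕ) : ℝ) := by
      have : L ≤ 40 * 2 ^ K := by
        rw [pow_succ] at hK2
        omega
      exact_mod_cast this
    have h2 : Y * X.card ≤ 150528 / ρ ^ 2 * ε * L ^ 2 := by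
      calc Y * X.card ≤ Y * (ε * D⁻¹ * L ^ 2) := by gcongr
        _ = 150528 / ρ ^ 2 * ε * L ^ 2 := by
            rw [hY]; field_simp
    have h3 : ε * (square z L).ncard ≤ ε * L ^ 2 := by gcongr
    have h4 : 150528 / ρ ^ 2 * ε ≤ 150528 / 10 ^ 10 := by
      rw [div_mul_eq_mul_div, div_le_iff₀ (by positivity)]
      linarith
    have h5 : 150528 / ρ ^ 2 * ε * L ^ 2 ≤ 150528 / 10 ^ 10 * L ^ 2 := by gcongr
    have h6 : ε * (L : ℝ) ^ 2 ≤ 1 / 10 ^ 10 * L ^ 2 := by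
      gcongr
      nlinarith
    have h7 : (L : ℝ) ^ 2 ≤ (40 * ((2 ^ K : ℕ) : ℝ)) ^ 2 := by gcongr
    have h8 : 0 < (L : ℝ) ^ 2 := by positivity
    linarith
  have hqz : q ∈ square z L := hsub q hq 0 hK0 (by
    simp only [Finset.mem_coe, mem_tsq]; push_cast; omega)
  have hbd := bddTsq_of_forall_pass (ψ := ψ) (E := E) (ε := ε) (Y := Y) hM hW hρ hρ1 hEbar hε
    (by nlinarith) hA hlogL hlogA hlarge hE' hgood hqz (by omega) le_rfl X hX (hsub q hq) hsol
    hpass hK0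
  have hpq : p ∈ tsq q (2 ^ K) := by
    rw [mem_tsq] at hq ⊢
    omega
  refine (hbd p hpq).trans ?_
  have hA0 : (0 : ℝ) < A := by nlinarith
  rw [← Real.rpow_natCast, Real.rpow_def_of_pos hA0]
  apply Real.exp_le_exp.2
  have h1 : ((96 * 2 ^ K : ℕ) : ℝ) ≤ 5 * L := by
    have : 96 * 2 ^ K ≤ 5 * L := by omega
    exact_mod_cast this
  calc Real.log A * ((96 * 2 ^ K : ℕ) : ℝ) ≤ (2 * Real.log L) * (5 * L) := by gcongr
    _ = 10 * L * Real.log L := by ring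
    _ ≤ α * L * Real.log L := by gcongr

/-! ### Good potentials are likely -/

lemma IsTame.comp_injective {Ω : Type*} [MeasurableSpace Ω] {P : Measure Ω} {M γ ρ : ℝ}
    {F : Set (ℤ × ℤ)} {W : ℤ × ℤ → Ω → ℝ} (h : IsTame P M γ ρ F W) {f : ℤ × ℤ → ℤ × ℤ}
    (hf : f.Injective) : IsTame P M γ ρ (f ⁻¹' F) fun n => W (f n) where
  measurable _ := h.measurable _
  indep := h.indep.precomp hf
  mem_Icc _ := h.mem_Icc _
  anti _ hn := h.anti _ hn

/-- Potentials which are not good are unlikely, by a union bound over the polynomially many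
rectangles in `GoodPotential`. -/
lemma measure_not_goodPotential_le {Ω : Type*} [MeasurableSpace Ω] {P : Measure Ω}
    [IsProbabilityMeasure P] {M γ ρ : ℝ} {F : Set (ℤ × ℤ)} {W : ℤ × ℤ → Ω → ℝ}
    (hW : IsTame P M γ ρ F W) (hM : 0 ≤ M) (hγ : 0 < γ) (hρ : 0 ≤ ρ) (hρ1 : ρ ≤ 1) {Ebar : ℝ}
    (hE : Ebar ∈ Set.Icc 0 (8 + M)) {z : ℤ × ℤ} {A L : ℕ} (hL : 2401 < L)
    (hA : 2 * (5 + M + 3) * (6 * (L : ℝ) + 1) ≤ A) (hAγ : 8 ≤ A * γ) :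
    P {ω | ¬ GoodPotential A Ebar ρ (fun n => W n ω) F z L}
      ≤ ENNReal.ofReal (9604 * L ^ 6 * Real.exp (-(ρ * (L : ℝ) ^ (1 / 4 : ℝ) / 32))) := by
  classical
  set S := (square_finite z L).toFinset with hS
  set I : Finset ℤ := Finset.Icc (-(3 * L : ℤ)) (3 * L) with hI
  set N : Finset ℕ := Finset.range (6 * L + 1) with hN
  -- The parameters are `(q, k, c, a, b)`.
  set J : Finset ((ℤ × ℤ) × ℕ × (ℤ × ℤ) × ℕ × ℕ) :=
    S ×ˢ Finset.range 4 ×ˢ (I ×ˢ I) ×ˢ N ×ˢ N with hJ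
  let C : (ℤ × ℤ) × ℕ × (ℤ × ℤ) × ℕ × ℕ → Prop := fun ⟨q, k, c, a, b⟩ =>
    1 ≤ b ∧ L ≤ a ^ 4 ∧ (b : ℝ) ^ 2 * Real.log A ≤ ρ * a / 512 ∧
      ∀ t ≤ b, rowCount c (frame q k ⁻¹' F) a t ≤ ⌊ρ * a / 16⌋₊
  let bad : (ℤ × ℤ) × ℕ × (ℤ × ℤ) × ℕ × ℕ → Set Ω := fun ⟨q, k, c, a, b⟩ =>
    {ω | ¬ NoInflation A Ebar ⌊ρ * a / 16⌋₊ (fun n => W (frame q k n) ω) (frame q k ⁻¹' F) c a b}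
  have hcover : {ω | ¬ GoodPotential A Ebar ρ (fun n => W n ω) F z L}
      ⊆ ⋃ j ∈ J.filter C, bad j := by
    intro ω hω
    simp only [Set.mem_ofPred_eq, GoodPotential] at hω
    push Not at hω
    obtain ⟨q, hq, k, hk, c, a, b, h1, h2, h3, h4, h5, h6, h7, h8, h9⟩ := hω
    refine Set.mem_biUnion (x := (q, k, c, a, b)) (Finset.mem_coe.2 (Finset.mem_filter.2 ⟨?_, ?_⟩))
      h9
    · simp only [hJ, Finset.mem_product, hN, Finset.mem_range]
      exact ⟨(square_finite z L).mem_toFinset.2 hq, hk, ⟨h1, h2⟩, by omega, by omega⟩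
    · exact ⟨h5, h6, h7, h8⟩
  have hbad : ∀ j ∈ J.filter C,
      P (bad j) ≤ ENNReal.ofReal (Real.exp (-(ρ * (L : ℝ) ^ (1 / 4 : ℝ) / 32))) := by
    rintro ⟨q, k, c, a, b⟩ hj
    obtain ⟨hj1, h5, h6, h7, h8⟩ := Finset.mem_filter.1 hj
    simp only [hJ, Finset.mem_product, hN, Finset.mem_range] at hj1
    have haL : (a : ℝ) ≤ 6 * L := by
      have : a ≤ 6 * L := by omega
      exact_mod_cast this
    have ha8 : 8 ≤ a := by
      by_contra hc
      have : a ^ 4 ≤ 7 ^ 4 := Nat.pow_le_pow_left (by omega) 4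
      omega
    refine (measure_not_noInflation_le (hW.comp_injective (frame_injective q k)) hM hγ hρ hρ1 hE
      (le_trans (by gcongr) hA) hAγ ha8 h5 (Nat.floor_le (by positivity)) h8 h7).trans ?_
    refine ENNReal.ofReal_le_ofReal (Real.exp_le_exp.2 ?_)
    have hLa : (L : ℝ) ^ (1 / 4 : ℝ) ≤ a := by
      have h1 : (L : ℝ) ≤ (a : ℝ) ^ 4 := by exact_mod_cast h6
      calc (L : ℝ) ^ (1 / 4 : ℝ) ≤ ((a : ℝ) ^ 4) ^ (1 / 4 : ℝ) := by gcongr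
        _ = a := by
            rw [← Real.rpow_natCast, ← Real.rpow_mul (Nat.cast_nonneg a)]
            norm_num
    have : ρ * (L : ℝ) ^ (1 / 4 : ℝ) ≤ ρ * a := by gcongr
    linarith
  have hcard : ((J.filter C).card : ℝ) ≤ 9604 * L ^ 6 := by
    have h1 : (J.filter C).card ≤ L ^ 2 * (4 * ((7 * L) * (7 * L) * ((7 * L) * (7 * L)))) := by
      refine (Finset.card_filter_le _ _).trans ?_
      have hSc : S.card ≤ L ^ 2 := by
        rw [hS, ← Set.ncard_eq_toFinset_card _ (square_finite z L)]
        exact ncard_square_le z L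
      have hIc : I.card ≤ 7 * L := by rw [hI, Int.card_Icc]; omega
      have hNc : N.card ≤ 7 * L := by rw [hN, Finset.card_range]; omega
      simp only [hJ, Finset.card_product, Finset.card_range]
      gcongr
    calc ((J.filter C).card : ℝ)
        ≤ ((L ^ 2 * (4 * ((7 * L) * (7 * L) * ((7 * L) * (7 * L)))) : ℕ) : ℝ) := by
          exact_mod_cast h1
      _ = 9604 * L ^ 6 := by push_cast; ring
  calc P {ω | ¬ GoodPotential A Ebar ρ (fun n => W n ω) F z L}
      ≤ P (⋃ j ∈ J.filter C, bad j) := measure_mono hcover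
    _ ≤ ∑ j ∈ J.filter C, P (bad j) := measure_biUnion_finset_le _ _
    _ ≤ ∑ j ∈ J.filter C, ENNReal.ofReal (Real.exp (-(ρ * (L : ℝ) ^ (1 / 4 : ℝ) / 32))) :=
        Finset.sum_le_sum hbad
    _ = ENNReal.ofReal ((J.filter C).card * Real.exp (-(ρ * (L : ℝ) ^ (1 / 4 : ℝ) / 32))) := by
        rw [Finset.sum_const, nsmul_eq_mul,
          ENNReal.ofReal_mul (p := ((J.filter C).card : ℝ)) (by positivity), ENNReal.ofReal_natCast]
    _ ≤ _ := by
        refine ENNReal.ofReal_le_ofReal ?_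
        gcongr

section Tame

variable {Ω : Type*} [MeasurableSpace Ω]

open Classical in
/-- The potential with values `v` on `F` and truncated values of `V` off `F`. It agrees almost
surely with `glue F v V`, but takes values in `[0, M]` everywhere. -/
noncomputable def tamePotential (M : ℝ) (F : Set (ℤ × ℤ)) (v : F → ℝ) (V : ℤ × ℤ → Ω → ℝ)
    (n : ℤ × ℤ) (ω : Ω) : ℝ :=
  if h : n ∈ F then v ⟨n, h⟩ else clampTo M (V n ω)

lemma abs_sub_clampTo_le {M x t : ℝ} (hx : x ∈ Set.Icc 0 M) : |x - clampTo M t| ≤ |x - t| := by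
  obtain ⟨h0, hM⟩ := hx
  unfold clampTo
  rcases le_total t M with h | h
  · rw [min_eq_right h]
    rcases le_total 0 t with h' | h'
    · rw [max_eq_right h']
    · rw [max_eq_left h', abs_of_nonneg (by linarith), abs_of_nonneg (by linarith)]
      linarith
  · rw [min_eq_left h, max_eq_right (h0.trans hM), abs_of_nonpos (by linarith),
      abs_of_nonpos (by linarith)]
    linarith

variable {P : Measure Ω} {M γ ρ : ℝ} {V : ℤ × ℤ → Ω → ℝ}

lemma IsAdmissible.isTame [IsProbabilityMeasure P] (hV : IsAdmissible P M γ ρ V) (hM : 0 ≤ M)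
    (F : Set (ℤ × ℤ)) (v : F → ℝ) (hv : ∀ n, v n ∈ Set.Icc 0 M) :
    IsTame P M γ (min ρ 1) F (tamePotential M F v V) where
  measurable n := by
    unfold tamePotential
    by_cases h : n ∈ F
    · simp only [h, dite_true]; exact measurable_const
    · simp only [h, dite_false]; exact (measurable_clampTo M).comp (hV.measurable n)
  indep := by
    classical
    let g : ℤ × ℤ → ℝ → ℝ := fun n x => if h : n ∈ F then v ⟨n, h⟩ else clampTo M x
    refine hV.indep.comp g fun n => ?_
    by_cases h : n ∈ F
    · simp only [g, h, dite_true]; exact measurable_const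
    · simp only [g, h, dite_false]; exact measurable_clampTo M
  mem_Icc n ω := by
    unfold tamePotential
    split_ifs with h
    · exact hv _
    · exact clampTo_mem hM _
  anti n hn t := by
    -- The hypothesis covers only `t ∈ [0, M]`; truncating `t` does not increase the distance.
    refine (min_le_left _ _).trans
      ((hV.antiConcentrated n (clampTo M t) (clampTo_mem hM t)).trans ?_)
    refine ENNReal.toReal_mono (measure_ne_top P _) (measure_mono_ae ?_)
    filter_upwards [hV.bounded n] with ω hω h
    have e : tamePotential M F v V n ω = V n ω := by
      unfold tamePotential
      rw [dif_neg hn, clampTo_of_mem hω]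
    change γ / 2 < |tamePotential M F v V n ω - t|
    rw [e]
    exact lt_of_lt_of_le h (abs_sub_clampTo_le hω)

lemma IsAdmissible.glue_ae_eq (hV : IsAdmissible P M γ ρ V) (F : Set (ℤ × ℤ)) (v : F → ℝ) :
    ∀ᵐ ω ∂P, glue F v (fun n => V n ω) = fun n => tamePotential M F v V n ω := by
  filter_upwards [ae_all_iff.2 hV.bounded] with ω hω
  funext n
  unfold glue tamePotential
  split_ifs
  · rfl
  · rw [clampTo_of_mem (hω n)]

end Tame

/-- Logarithms are negligible with respect to the fourth root. The factor is `2 * 2304`, because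
the logarithm of the growth factor `A` is at most `2 * log L`. -/
lemma exists_log_le_rpow {c : ℝ} (hc : 0 < c) :
    ∃ x₀ : ℝ, ∀ x ≥ x₀, 4608 * Real.log x ≤ c * x ^ (1 / 4 : ℝ) := by
  have h := (isLittleO_log_rpow_atTop (r := 1 / 4) (by norm_num)).bound
    (show 0 < c / 4608 by positivity)
  obtain ⟨x₀, hx₀⟩ := Filter.eventually_atTop.1 (h.and (Filter.eventually_ge_atTop 0))
  refine ⟨x₀, fun x hx => ?_⟩
  obtain ⟨h1, h2⟩ := hx₀ x hx
  rw [Real.norm_eq_abs, Real.norm_eq_abs, abs_of_nonneg (Real.rpow_nonneg h2 _)] at h1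
  linarith [le_abs_self (Real.log x)]

end AndersonZ2

theorem mainTheorem1 (M γ ρ : ℝ) (hM : 0 < M) (hγ : 0 < γ) (hρ : 0 < ρ) :
    ∃ ε₀ : ℝ, 0 < ε₀ ∧ ∀ ε : ℝ, 0 < ε → ε ≤ ε₀ →
      ∃ α : ℝ, 1 < α ∧
        ∀ (Ω : Type*) [MeasurableSpace Ω] (P : Measure Ω) [IsProbabilityMeasure P]
          (V : ℤ × ℤ → Ω → ℝ), IsAdmissible P M γ ρ V →
        ∀ Ebar ∈ Set.Icc (0 : ℝ) (8 + M),
        ∀ (a : ℤ × ℤ) (L : ℕ), α ≤ (L : ℝ) →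
        ∀ F : Set (ℤ × ℤ), IsEpsRegular ε F (square a L) →
        ∀ v : F → ℝ, (∀ n, v n ∈ Set.Icc 0 M) →
          1 - Real.exp (-ε * (L : ℝ) ^ (1 / 4 : ℝ))
            ≤ frozenProb P V F v (ucEvent Ebar a L F α ε) := by
  set ρ' := min ρ 1 with hρ'
  have hρ0 : 0 < ρ' := lt_min hρ one_pos
  have hρ1 : ρ' ≤ 1 := min_le_right _ _
  -- The constant `10 ^ 10` comes from the covering argument in `mem_ucEvent_of_goodPotential`.
  refine ⟨ρ' ^ 2 / 10 ^ 10, by positivity, fun ε hε hε₀ => ?_⟩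
  have hερ : 10 ^ 10 * ε ≤ ρ' ^ 2 := by
    rw [le_div_iff₀ (by positivity)] at hε₀
    linarith
  have hε64 : 64 * ε ≤ ρ' := by nlinarith
  obtain ⟨x₀, hx₀⟩ := exists_log_le_rpow hρ0
  -- The growth factor is `C * L`.
  obtain ⟨C, hC⟩ := exists_nat_ge (14 * (8 + M) + 8 / γ)
  -- No dependence of `α` on `ε` is needed; `α` enforces that `L` is large, and `α ≥ 10` covers the
  -- exponent in the conclusion.
  refine ⟨max x₀ (max C 10000), lt_max_of_lt_right (lt_max_of_lt_right (by norm_num)), ?_⟩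
  intro Ω _ P _ V hV Ebar hEbar a L hαL F hreg v hv
  set α := max x₀ (max (C : ℝ) 10000) with hα
  have hL1 : (10000 : ℝ) ≤ L := ((le_max_right _ _).trans (le_max_right _ _)).trans hαL
  have hLC : (C : ℝ) ≤ L := ((le_max_left _ _).trans (le_max_right _ _)).trans hαL
  have hα10 : (10 : ℝ) ≤ α :=
    le_trans (by norm_num) ((le_max_right (C : ℝ) 10000).trans (le_max_right x₀ _))
  have hlog := hx₀ L ((le_max_left _ _).trans hαL)
  have hL4 : 10000 ≤ L := by exact_mod_cast hL1
  have hL0 : (0 : ℝ) < L := by linarith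
  have hγ8 : 0 ≤ 8 / γ := by positivity
  have hC0 : (0 : ℝ) < C := by linarith
  set A : ℕ := C * L with hA
  have hAR : (A : ℝ) = C * L := by rw [hA]; push_cast; rfl
  have hA1 : 2 * (5 + M + 3) * (6 * (L : ℝ) + 1) ≤ A := by
    rw [hAR]
    calc 2 * (5 + M + 3) * (6 * (L : ℝ) + 1) ≤ 2 * (5 + M + 3) * (7 * L) := by
          gcongr
          linarith
      _ = 14 * (8 + M) * L := by ring
      _ ≤ C * L := by gcongr; linarith
  have hAγ : 8 ≤ A * γ := by
    have h1 : 8 / γ ≤ C := by linarith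
    rw [div_le_iff₀ hγ] at h1
    rw [hAR]
    nlinarith
  have hlogL : 1 ≤ Real.log L := by
    rw [Real.le_log_iff_exp_le hL0]
    linarith [Real.exp_one_lt_d9]
  have hlogA : Real.log A ≤ 2 * Real.log L := by
    rw [hAR, Real.log_mul hC0.ne' hL0.ne', two_mul]
    gcongr
  have hlarge : ∀ r : ℕ, L ≤ r ^ 4 → 2304 * Real.log A ≤ ρ' * r := by
    intro r hr
    have h1 : (L : ℝ) ≤ (r : ℝ) ^ 4 := by exact_mod_cast hr
    have h2 : (L : ℝ) ^ (1 / 4 : ℝ) ≤ r := by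
      calc (L : ℝ) ^ (1 / 4 : ℝ) ≤ ((r : ℝ) ^ 4) ^ (1 / 4 : ℝ) := by gcongr
        _ = r := by
            rw [← Real.rpow_natCast, ← Real.rpow_mul (Nat.cast_nonneg r)]
            norm_num
    have h3 : ρ' * (L : ℝ) ^ (1 / 4 : ℝ) ≤ ρ' * r := by gcongr
    linarith
  set x := (L : ℝ) ^ (1 / 4 : ℝ) with hx
  have hx0 : 0 ≤ x := by positivity
  -- The number of rectangles is absorbed by half of the exponent.
  have hnum : 9604 * (L : ℝ) ^ 6 * Real.exp (-(ρ' * x / 32)) ≤ Real.exp (-ε * x) := by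
    have h1 : 9604 * (L : ℝ) ^ 6 ≤ Real.exp (7 * Real.log L) := by
      have : Real.exp (7 * Real.log L) = (L : ℝ) ^ 7 := by
        rw [mul_comm, Real.exp_mul, Real.exp_log hL0]
        norm_cast
      rw [this]
      have : (0 : ℝ) < (L : ℝ) ^ 6 := by positivity
      nlinarith
    calc 9604 * (L : ℝ) ^ 6 * Real.exp (-(ρ' * x / 32))
        ≤ Real.exp (7 * Real.log L) * Real.exp (-(ρ' * x / 32)) := by gcongr
      _ = Real.exp (7 * Real.log L - ρ' * x / 32) := by rw [← Real.exp_add]; ring_nf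
      _ ≤ Real.exp (-ε * x) := by
          apply Real.exp_le_exp.2
          nlinarith
  have hT := hV.isTame hM.le F v hv
  set bad := {ω | ¬ GoodPotential A Ebar ρ' (fun n => tamePotential M F v V n ω) F a L} with hbad
  have hPbad : P bad ≤ ENNReal.ofReal (Real.exp (-ε * x)) :=
    (measure_not_goodPotential_le hT hM.le hγ hρ0.le hρ1 hEbar (by omega) hA1 hAγ).trans
      (ENNReal.ofReal_le_ofReal hnum)
  set U := {ω | glue F v (fun n => V n ω) ∈ ucEvent Ebar a L F α ε} with hU
  have hsub : P Uᶜ ≤ P bad := by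
    refine measure_mono_ae ?_
    filter_upwards [hV.glue_ae_eq F v] with ω hω hωU
    by_contra hgood
    refine hωU ?_
    simp only [hU, Set.mem_ofPred_eq, hω]
    exact mem_ucEvent_of_goodPotential hM.le (fun n => hT.mem_Icc n ω) hρ0 hρ1 hEbar hε.le hερ
      hA1 (by omega) hlogL hlogA hlarge hα10 hreg (not_not.1 hgood)
  have hfinal : P.real Uᶜ ≤ Real.exp (-ε * x) :=
    ENNReal.toReal_le_of_le_ofReal (Real.exp_pos _).le (hsub.trans hPbad)
  have huniv : (1 : ℝ) ≤ P.real U + P.real Uᶜ := by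
    have := measureReal_union_le (μ := P) U Uᶜ
    rwa [Set.union_compl_self, probReal_univ] at this
  change 1 - Real.exp (-ε * x) ≤ P.real U
  linarith
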